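/- **Theorem.** All graphs are finite and simple. A *first-fit coloring* of a graph $G$ is a partition of $V(G)$ into nonempty independent sets $C_1,\dots,C_k$ (color classes) such that, whenever $i<j$, every vertex of $C_j$ has at least one neighbor in $C_i$. The *Grundy number* $\Gamma(G)$ is the maximal number $k$ of color classes of a first-fit coloring of $G$. A *cograph* is a graph with no induced path on four vertices. The *Seidel switch* of a graph $H$ with respect to $S\subseteq V(H)$ is the graph on $V(H)$ obtained from $H$ by complementing the adjacency of exactly those pairs that have one element in $S$ and the other in $V(H)\setminus S$. A graph is *Cameron* if it is a Seidel switch of a cograph. There exists a polynomial-time algorithm that computes the Grundy number of Cameron graphs. That is, there are a random-access-machine program $P$ (over the natural numbers, with unit-cost addition, truncated subtraction, comparison with zero and indirect memory access, and without multiplication) and a polynomial $T$ such that for every $n\ge 0$ and every Cameron graph $G$ on $n$ vertices, $P$, started with $n$ and the adjacency matrix of $G$ as its input, halts after at most $T(n)$ steps with output $\Gamma(G)$. -/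

import Mathlib

namespace SimpleGraph

variable {V : Type*}

/-- A proper colouring with colours `0, …, k - 1`, all of them used, is a first-fit colouring if
every vertex has a neighbour in each colour class preceding its own. -/
def IsFirstFit (G : SimpleGraph V) {k : ℕ} (C : G.Coloring (Fin k)) : Prop :=
  Function.Surjective C ∧ ∀ v : V, ∀ i : Fin k, i < C v → ∃ u : V, G.Adj v u ∧ C u = i

/-- The numbers of colour classes attained by first-fit colourings of `G`. -/
def firstFitCounts (G : SimpleGraph V) : Set ℕ :=
  {k | ∃ C : G.Coloring (Fin k), G.IsFirstFit C}

/-- The Grundy number `Γ(G)`: the maximal number of colour classes of a first-fit colouring.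
For a finite graph the maximum exists, see `isGreatest_grundyNumber`. -/
noncomputable def grundyNumber (G : SimpleGraph V) : ℕ :=
  sSup G.firstFitCounts

theorem isGreatest_grundyNumber [Finite V] (G : SimpleGraph V) :
    IsGreatest G.firstFitCounts G.grundyNumber := by
  classical
  have := Fintype.ofFinite V
  have hbdd : BddAbove G.firstFitCounts := by
    refine ⟨Fintype.card V, ?_⟩
    rintro k ⟨C, hC, -⟩
    simpa using Fintype.card_le_of_surjective C hC
  have hne : G.firstFitCounts.Nonempty := by
    let P : ℕ → Prop := fun s => ∃ c : V → ℕ, (∀ u v, G.Adj u v → c u ≠ c v) ∧ ∑ v, c v = s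
    have hP : ∃ s, P s := by
      let e := Fintype.equivFin V
      refine ⟨_, fun v => (e v : ℕ), fun u v h heq => ?_, rfl⟩
      exact h.ne (e.injective (Fin.ext heq))
    obtain ⟨c, hc, hs⟩ := Nat.find_spec hP
    have key : ∀ v, ∀ i < c v, ∃ u, G.Adj v u ∧ c u = i := by
      intro v i hi
      by_contra hcon
      push Not at hcon
      refine Nat.find_min hP (m := ∑ w, Function.update c v i w) ?_
        ⟨Function.update c v i, ?_, rfl⟩
      · rw [← hs]
        apply Finset.sum_lt_sum
        · intro w _
          by_cases h : w = v
          · subst h; simpa using hi.le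
          · simp [h]
        · exact ⟨v, Finset.mem_univ v, by simpa using hi⟩
      · intro u w h
        by_cases hu : u = v
        · subst hu
          have hw : w ≠ u := h.ne'
          simpa [hw] using (hcon w h).symm
        · by_cases hw : w = v
          · subst hw
            simpa [hu] using hcon u h.symm
          · simpa [hu, hw] using hc u w h
    let k := Finset.univ.sup fun v => c v + 1
    have hk : ∀ v, c v < k := fun v =>
      Finset.le_sup (f := fun v => c v + 1) (Finset.mem_univ v)
    refine ⟨k, Coloring.mk (fun v => (⟨c v, hk v⟩ : Fin k)) ?_, ?_, ?_⟩
    · intro u v h heq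
      exact hc u v h (by simpa using heq)
    · intro i
      obtain ⟨v, -, hv⟩ := (Finset.lt_sup_iff (f := fun v => c v + 1)).1 i.2
      rcases Nat.lt_succ_iff_lt_or_eq.1 hv with h | h
      · obtain ⟨u, -, hu⟩ := key v i h
        exact ⟨u, Fin.ext hu⟩
      · exact ⟨v, Fin.ext h.symm⟩
    · intro v i hi
      obtain ⟨u, hu, hui⟩ := key v i hi
      exact ⟨u, hu, Fin.ext hui⟩
  exact ⟨Nat.sSup_mem hne hbdd, fun k hk => le_csSup hbdd hk⟩

/-- A cograph is a graph without an induced path on four vertices. -/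
def IsCograph (G : SimpleGraph V) : Prop :=
  ¬ (pathGraph 4).IsIndContained G

/-- The Seidel switch of `G` with respect to `S`: the adjacency of `u` and `v` is kept if they lie
on the same side of `S`, and complemented if exactly one of them lies in `S`. -/
def seidelSwitch (G : SimpleGraph V) (S : Set V) : SimpleGraph V where
  Adj u v := G.Adj u v ↔ (u ∈ S ↔ v ∈ S)
  symm := ⟨fun u v h => by rw [G.adj_comm v u, Iff.comm (a := v ∈ S)]; exact h⟩
  loopless := ⟨fun u h => G.irrefl (h.2 Iff.rfl)⟩

/-- A graph is Cameron if it is obtained from a cograph by a Seidel switch. -/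
def IsCameron (G : SimpleGraph V) : Prop :=
  ∃ (H : SimpleGraph V) (S : Set V), H.IsCograph ∧ G = H.seidelSwitch S

end SimpleGraph

/-! A random-access machine over the natural numbers, with structured control flow. A program
mentions finitely many variables and finitely many arrays. The only arithmetic operations are
addition and truncated subtraction, so that in `t` steps the bit length of the stored numbers grows
by `O(t)` only, and the unit-cost running time below is polynomially related to the running time of
a Turing machine. -/
namespace RAM

/-- The content of the memory: the variable number `x` holds `var x`, and the cell `i` of the array
number `a` holds `arr a i`. -/
@[ext]
structure State where
  var : ℕ → ℕ
  arr : ℕ → ℕ → ℕ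

inductive Expr where
  | lit (c : ℕ)
  | var (x : ℕ)
  | read (a : ℕ) (i : Expr)
  | add (e₁ e₂ : Expr)
  | sub (e₁ e₂ : Expr)

/-- The value of an expression; `sub` is truncated subtraction. -/
def Expr.eval (s : State) : Expr → ℕ
  | lit c => c
  | var x => s.var x
  | read a i => s.arr a (i.eval s)
  | add e₁ e₂ => e₁.eval s + e₂.eval s
  | sub e₁ e₂ => e₁.eval s - e₂.eval s

/-- The number of elementary operations in the evaluation of an expression. -/
def Expr.cost : Expr → ℕ
  | lit _ => 1
  | var _ => 1
  | read _ i => i.cost + 1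
  | add e₁ e₂ => e₁.cost + e₂.cost + 1
  | sub e₁ e₂ => e₁.cost + e₂.cost + 1

/-- Programs. A test `e` counts as true if its value is not `0`. -/
inductive Program where
  | skip
  | assign (x : ℕ) (e : Expr)
  | write (a : ℕ) (i e : Expr)
  | seq (P Q : Program)
  | ite (e : Expr) (P Q : Program)
  | while (e : Expr) (P : Program)

/-- `Runs P s t s'`: started in the state `s`, the program `P` halts after exactly `t` steps, in
the state `s'`. -/
inductive Runs : Program → State → ℕ → State → Prop
  | skip (s : State) : Runs .skip s 1 s
  | assign (x : ℕ) (e : Expr) (s : State) :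
      Runs (.assign x e) s (e.cost + 1) { s with var := Function.update s.var x (e.eval s) }
  | write (a : ℕ) (i e : Expr) (s : State) :
      Runs (.write a i e) s (i.cost + e.cost + 1)
        { s with arr := Function.update s.arr a
                  (Function.update (s.arr a) (i.eval s) (e.eval s)) }
  | seq {P Q : Program} {s s' s'' : State} {t t' : ℕ} :
      Runs P s t s' → Runs Q s' t' s'' → Runs (.seq P Q) s (t + t') s''
  | ite_true {e : Expr} {P Q : Program} {s s' : State} {t : ℕ} :
      e.eval s ≠ 0 → Runs P s t s' → Runs (.ite e P Q) s (e.cost + 1 + t) s'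
  | ite_false {e : Expr} {P Q : Program} {s s' : State} {t : ℕ} :
      e.eval s = 0 → Runs Q s t s' → Runs (.ite e P Q) s (e.cost + 1 + t) s'
  | while_true {e : Expr} {P : Program} {s s' s'' : State} {t t' : ℕ} :
      e.eval s ≠ 0 → Runs P s t s' → Runs (.while e P) s' t' s'' →
        Runs (.while e P) s (e.cost + 1 + t + t') s''
  | while_false {e : Expr} {P : Program} {s : State} :
      e.eval s = 0 → Runs (.while e P) s (e.cost + 1) s

open Classical in
/-- The initial state on the input `G`: the variable `0` holds the number `n` of vertices and the
array `0` holds the adjacency matrix, row by row; everything else is `0`. -/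
noncomputable def graphInput {n : ℕ} (G : SimpleGraph (Fin n)) : State where
  var x := if x = 0 then n else 0
  arr a k := if a = 0 ∧ ∃ i j : Fin n, k = n * i + j ∧ G.Adj i j then 1 else 0

end RAM

/-!
The Grundy number of a Cameron graph is computed by dynamic programming over a decomposition of a
cograph, and the program that does so is written out and timed.

*The cograph.* Switching a Cameron graph `G` with respect to the neighbourhood `S` of any vertex `v`
gives a cograph `H` (`SimpleGraph.IsCameron.isCograph_seidelSwitch`): the vertex `v` becomes
isolated, and a path on four vertices together with an isolated vertex is not a switch of an induced
subgraph of a cograph. Every cograph on at least two vertices has twins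
(`SimpleGraph.IsCograph.exists_twins`), so that `H` is obtained from single vertices by merging
modules with no edges, or with all edges, between them.

*The tables.* Since first-fit colourings of induced subgraphs extend
(`SimpleGraph.length_le_grundyNumber`), some colour classes may be listed instead of all. Let `v` be
a vertex of the last class. Then every earlier class meets `S`; those which are not contained in `S`
are complete bipartite in `H`. For a module `M` of `H`, consider the triples `(s, t, g)`, where `g`
is the number of classes in `M` that cross the cut `S`, and `s` and `t` are the numbers of the other
classes that meet `M` inside and outside of `S`. When two modules without edges between them are
merged, the numbers `g` are added, and of the numbers `s` and `t` the larger ones remain, because an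
earlier class that meets `M` on one side of the cut dominates this side of `M`. When two modules with
all edges between them are merged, all numbers are added, and then `m` classes that reach one module
inside of `S` and the other one outside of `S` may become classes crossing the cut, which lowers `s`
and `t` by `m` and raises `g` by `m`. Conversely, triples that are built in this way are realized by
`g` edges of `H` crossing the cut and cliques of sizes `s` and `t`, where each edge dominates, in
`G`, the later edges and the cliques. A relation between these two descriptions is a *table* of `M`
(`SimpleGraph.IsTable`), and merging preserves tables (`SimpleGraph.IsTable.union`,
`SimpleGraph.IsTable.join`). For a table of the whole graph, the edges, the vertices of the clique
in `S` and finally `v` are the classes of a first-fit colouring, so that `s + g + 1` is at most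
the Grundy number for all `v`, and equality occurs for some `v`
(`SimpleGraph.exists_add_eq_grundyNumber`).

*The program.* Commands in which all loops have the same bound compile to programs that run in
polynomial time (`RAM.Cmd.runs_compile`), and their effect is a function on states. The command
`RAM.grundyCmd` keeps a table for each module of a partition, looks for twins among representatives
of the modules, and merges them. All `s`, `t`, `g` are at most the number of vertices, so that a
table has polynomially many entries and can be filled by nested loops (`RAM.nest_write_run`).
-/

namespace SimpleGraph

variable {V : Type*}

/-! ### First-fit colourings -/

/-- A colouring by natural numbers that is proper and in which every vertex has a neighbour of
each smaller colour. -/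
structure IsGreedy (G : SimpleGraph V) (c : V → ℕ) : Prop where
  proper : ∀ u w, G.Adj u w → c u ≠ c w
  hits : ∀ u, ∀ i < c u, ∃ w, G.Adj u w ∧ c w = i

theorem IsGreedy.lt_grundyNumber [Finite V] {G : SimpleGraph V} {c : V → ℕ} (h : G.IsGreedy c)
    (v : V) : c v < G.grundyNumber := by
  classical
  have := Fintype.ofFinite V
  let k := Finset.univ.sup fun v => c v + 1
  have hk : ∀ v, c v < k := fun v =>
    Finset.le_sup (f := fun v => c v + 1) (Finset.mem_univ v)
  refine (hk v).trans_le ((isGreatest_grundyNumber G).2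
    ⟨Coloring.mk (fun v => (⟨c v, hk v⟩ : Fin k)) ?_, ?_, ?_⟩)
  · intro u v h' heq
    exact h.proper u v h' (by simpa using heq)
  · intro i
    obtain ⟨v, -, hv⟩ := (Finset.lt_sup_iff (f := fun v => c v + 1)).1 i.2
    rcases Nat.lt_succ_iff_lt_or_eq.1 hv with h' | h'
    · obtain ⟨u, -, hu⟩ := h.hits v i h'
      exact ⟨u, Fin.ext hu⟩
    · exact ⟨v, Fin.ext h'.symm⟩
  · intro v i hi
    obtain ⟨u, hu, hui⟩ := h.hits v i hi
    exact ⟨u, hu, Fin.ext hui⟩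

theorem exists_isGreedy_of_nonempty [Finite V] [Nonempty V] (G : SimpleGraph V) :
    ∃ (c : V → ℕ) (v : V), G.IsGreedy c ∧ c v + 1 = G.grundyNumber := by
  obtain ⟨C, hs, hC⟩ := (isGreatest_grundyNumber G).1
  have hpos : 0 < G.grundyNumber := (C (Classical.arbitrary V)).pos
  obtain ⟨v, hv⟩ := hs ⟨G.grundyNumber - 1, by omega⟩
  refine ⟨fun u => C u, v, ⟨fun u w h he => C.valid h (Fin.ext he), fun u i hi => ?_⟩, ?_⟩
  · obtain ⟨w, hw, hwi⟩ := hC u ⟨i, hi.trans (C u).2⟩ hi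
    exact ⟨w, hw, by rw [hwi]⟩
  · simp only [hv]; omega

theorem grundyNumber_le_card [Fintype V] (G : SimpleGraph V) :
    G.grundyNumber ≤ Fintype.card V := by
  obtain ⟨C, hs, -⟩ := (isGreatest_grundyNumber G).1
  simpa using Fintype.card_le_of_surjective C hs

/-- A first-fit colouring of an induced subgraph extends to the whole graph without losing colours.
The classes of the subgraph are listed; they are disjoint, because each of them is independent and
meets the neighbourhood of every vertex of the later ones. -/
theorem length_le_grundyNumber [Finite V] (G : SimpleGraph V) (l : List (Set V))
    (hne : ∀ C ∈ l, C.Nonempty) (hind : ∀ C ∈ l, ∀ x ∈ C, ∀ y ∈ C, ¬ G.Adj x y)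
    (hdom : l.Pairwise fun C D => ∀ x ∈ D, ∃ y ∈ C, G.Adj x y) :
    l.length ≤ G.grundyNumber := by
  classical
  have := Fintype.ofFinite V
  rw [List.pairwise_iff_getElem] at hdom
  have hlt : ∀ (v : V) (i j : ℕ) (hi : i < l.length) (hj : j < l.length), v ∈ l[i] → v ∈ l[j] →
      ¬ i < j := by
    intro v i j hi hj hvi hvj hij
    obtain ⟨y, hy, hvy⟩ := hdom i j hi hj hij v hvj
    exact hind _ (List.getElem_mem hi) v hvi y hy hvy
  have huniq : ∀ (v : V) (i j : ℕ) (hi : i < l.length) (hj : j < l.length), v ∈ l[i] → v ∈ l[j] →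
      i = j := fun v i j hi hj hvi hvj =>
    le_antisymm (not_lt.1 (hlt v j i hj hi hvj hvi)) (not_lt.1 (hlt v i j hi hj hvi hvj))
  -- Among the proper colourings that extend the given one, one with the least sum is greedy.
  let P : ℕ → Prop := fun s => ∃ c : V → ℕ, (∀ u v, G.Adj u v → c u ≠ c v) ∧
    (∀ v i (hi : i < l.length), v ∈ l[i] → c v = i) ∧ ∑ v, c v = s
  have hP : ∃ s, P s := by
    let e := Fintype.equivFin V
    let c : V → ℕ := fun v =>
      if h : ∃ i, ∃ hi : i < l.length, v ∈ l[i] then h.choose else l.length + e v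
    have hc : ∀ v i (hi : i < l.length), v ∈ l[i] → c v = i := by
      intro v i hi hv
      have h : ∃ i, ∃ hi : i < l.length, v ∈ l[i] := ⟨i, hi, hv⟩
      obtain ⟨hj, hvj⟩ := h.choose_spec
      simp only [c, dif_pos h]
      exact huniq v _ i hj hi hvj hv
    refine ⟨_, c, fun u v h heq => ?_, hc, rfl⟩
    by_cases hu : ∃ i, ∃ hi : i < l.length, u ∈ l[i] <;>
      by_cases hv : ∃ i, ∃ hi : i < l.length, v ∈ l[i]
    · obtain ⟨i, hi, hui⟩ := hu
      obtain ⟨j, hj, hvj⟩ := hv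
      rw [hc u i hi hui, hc v j hj hvj] at heq
      subst heq
      exact hind _ (List.getElem_mem hi) u hui v hvj h
    · obtain ⟨i, hi, hui⟩ := hu
      rw [hc u i hi hui] at heq
      simp only [c, dif_neg hv] at heq
      omega
    · obtain ⟨i, hi, hvi⟩ := hv
      rw [hc v i hi hvi] at heq
      simp only [c, dif_neg hu] at heq
      omega
    · simp only [c, dif_neg hu, dif_neg hv] at heq
      exact h.ne (e.injective (Fin.ext (by omega)))
  obtain ⟨c, hc, hcl, hs⟩ := Nat.find_spec hP
  have hgreedy : G.IsGreedy c := by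
    refine ⟨hc, fun v i hi => ?_⟩
    by_cases hv : ∃ j, ∃ hj : j < l.length, v ∈ l[j]
    · obtain ⟨j, hj, hvj⟩ := hv
      rw [hcl v j hj hvj] at hi
      obtain ⟨y, hy, hvy⟩ := hdom i j (hi.trans hj) hj hi v hvj
      exact ⟨y, hvy, hcl y i _ hy⟩
    by_contra hcon
    push Not at hcon
    refine Nat.find_min hP (m := ∑ w, Function.update c v i w) ?_
      ⟨Function.update c v i, ?_, ?_, rfl⟩
    · rw [← hs]
      apply Finset.sum_lt_sum
      · intro w _
        by_cases h : w = v
        · subst h; simpa using hi.le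
        · simp [h]
      · exact ⟨v, Finset.mem_univ v, by simpa using hi⟩
    · intro u w h
      by_cases hu : u = v
      · subst hu
        have hw : w ≠ u := h.ne'
        simpa [hw] using (hcon w h).symm
      · by_cases hw : w = v
        · subst hw
          simpa [hu] using hcon u h.symm
        · simpa [hu, hw] using hc u w h
    · intro w j hj hw
      have hwv : w ≠ v := fun h => hv ⟨j, hj, h ▸ hw⟩
      simpa [hwv] using hcl w j hj hw
  rcases Nat.eq_zero_or_pos l.length with h0 | hpos
  · omega
  · obtain ⟨v, hv⟩ := hne _ (List.getElem_mem (n := l.length - 1) (by omega))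
    have h1 := hcl v _ _ hv
    have h2 := hgreedy.lt_grundyNumber v
    omega

/-! ### Cographs and Seidel switches -/

theorem IsCograph.not_path {H : SimpleGraph V} (hH : H.IsCograph) {a b c d : V}
    (hab : H.Adj a b) (hbc : H.Adj b c) (hcd : H.Adj c d) (hac : ¬ H.Adj a c)
    (had : ¬ H.Adj a d) (hbd : ¬ H.Adj b d) : False := by
  have nac : a ≠ c := by rintro rfl; exact had hcd
  have nad : a ≠ d := by rintro rfl; exact hac hcd.symm
  have nbd : b ≠ d := by rintro rfl; exact had hab
  have nab := hab.ne
  have nbc := hbc.ne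
  have ncd := hcd.ne
  refine hH ⟨⟨⟨![a, b, c, d], ?_⟩, ?_⟩⟩
  · intro i j h
    fin_cases i <;> fin_cases j <;> simp_all
  · intro i j
    have h1 := hab.symm
    have h2 := hbc.symm
    have h3 := hcd.symm
    have h4 : ¬ H.Adj c a := fun h => hac h.symm
    have h5 : ¬ H.Adj d a := fun h => had h.symm
    have h6 : ¬ H.Adj d b := fun h => hbd h.symm
    fin_cases i <;> fin_cases j <;> simp_all [pathGraph_adj] <;> assumption

theorem IsCograph.of_no_path {H : SimpleGraph V}
    (h : ∀ a b c d, H.Adj a b → H.Adj b c → H.Adj c d → ¬ H.Adj a c → ¬ H.Adj a d →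
      ¬ H.Adj b d → False) : H.IsCograph := by
  rintro ⟨f⟩
  refine h (f 0) (f 1) (f 2) (f 3) ?_ ?_ ?_ ?_ ?_ ?_ <;> rw [f.map_adj_iff] <;>
    simp [pathGraph_adj]

theorem IsCograph.compl {H : SimpleGraph V} (hH : H.IsCograph) : Hᶜ.IsCograph := by
  refine IsCograph.of_no_path fun a b c d hab hbc hcd hac had hbd => ?_
  have nac : a ≠ c := by rintro rfl; exact had hcd
  have nad : a ≠ d := by rintro rfl; exact hac hcd.symm
  have nbd : b ≠ d := by rintro rfl; exact had hab
  simp only [compl_adj, not_and, not_not] at *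
  exact hH.not_path (hbd nbd) (had nad).symm (hac nac) (fun h => hab.2 h.symm) hbc.2
    fun h => hcd.2 h.symm

/-- The vertex set `W` falls into two nonempty parts with all edges, or with no edges, of `H`
between them. -/
def Splits (H : SimpleGraph V) (W : Set V) : Prop :=
  ∃ A B : Set V, A.Nonempty ∧ B.Nonempty ∧ Disjoint A B ∧ A ∪ B = W ∧
    ((∀ a ∈ A, ∀ b ∈ B, H.Adj a b) ∨ ∀ a ∈ A, ∀ b ∈ B, ¬ H.Adj a b)

theorem Splits.of_compl {H : SimpleGraph V} {W : Set V} (h : Hᶜ.Splits W) : H.Splits W := by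
  obtain ⟨A, B, hA, hB, hAB, hW, h⟩ := h
  refine ⟨A, B, hA, hB, hAB, hW, ?_⟩
  rcases h with h | h
  · exact Or.inr fun a ha b hb => (h a ha b hb).2
  · refine Or.inl fun a ha b hb => ?_
    have := h a ha b hb
    rw [compl_adj, not_and, not_not] at this
    exact this (hAB.ne_of_mem ha hb)

/-- If the added vertex `v` has a neighbour `y` in one part and distinguishes two adjacent vertices
of the other one, then these four vertices form a path. -/
theorem IsCograph.splits_insert {H : SimpleGraph V} (hH : H.IsCograph) {A B : Set V} {v : V}
    (hA : A.Nonempty) (hB : B.Nonempty) (hAB : Disjoint A B) (hv : v ∉ A ∪ B)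
    (h : ∀ a ∈ A, ∀ b ∈ B, ¬ H.Adj a b) : H.Splits (insert v (A ∪ B)) := by
  have hvA : v ∉ A := fun h => hv (Or.inl h)
  have hvB : v ∉ B := fun h => hv (Or.inr h)
  have main : ∀ C D : Set V, D.Nonempty → Disjoint C D → v ∉ C → v ∉ D →
      (∀ a ∈ C, ∀ b ∈ D, ¬ H.Adj a b) →
      ∀ x ∈ C, ¬ H.Adj v x → ∀ y ∈ D, H.Adj v y → H.Splits (insert v (C ∪ D)) := by
    intro C D hD hCD hvC hvD h x hx hvx y hy hvy
    refine ⟨{x ∈ C | ¬ H.Adj v x}, insert v ({x ∈ C | H.Adj v x} ∪ D), ⟨x, hx, hvx⟩,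
      Set.insert_nonempty _ _, ?_, ?_, Or.inr ?_⟩
    · rw [Set.disjoint_left]
      rintro a ⟨ha, hva⟩ (rfl | ⟨-, ha'⟩ | ha')
      · exact hvC ha
      · exact hva ha'
      · exact hCD.ne_of_mem ha ha' rfl
    · ext z
      simp only [Set.mem_union, Set.mem_insert_iff, Set.mem_ofPred_eq]
      tauto
    · rintro a ⟨ha, hva⟩ b (rfl | ⟨hb, hvb⟩ | hb) hab
      · exact hva hab.symm
      · exact hH.not_path hab hvb.symm hvy (fun h => hva h.symm) (h a ha y hy) (h b hb y hy)
      · exact h a ha b hb hab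
  by_cases h1 : ∀ x ∈ A ∪ B, H.Adj v x
  · exact ⟨{v}, A ∪ B, Set.singleton_nonempty v, hA.inl, by simpa using hv, rfl,
      Or.inl fun a ha => by rw [Set.mem_singleton_iff.1 ha]; exact h1⟩
  by_cases h2 : ∃ y ∈ B, H.Adj v y
  · by_cases h3 : ∃ y ∈ A, H.Adj v y
    · push Not at h1
      obtain ⟨x, hx | hx, hvx⟩ := h1
      · obtain ⟨y, hy, hvy⟩ := h2
        exact main A B hB hAB hvA hvB h x hx hvx y hy hvy
      · obtain ⟨y, hy, hvy⟩ := h3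
        rw [Set.union_comm]
        exact main B A hA hAB.symm hvB hvA (fun a ha b hb hab => h b hb a ha hab.symm) x hx hvx y
          hy hvy
    · push Not at h3
      refine ⟨A, insert v B, hA, Set.insert_nonempty _ _, ?_, by rw [Set.union_insert], Or.inr ?_⟩
      · rw [Set.disjoint_insert_right]; exact ⟨hvA, hAB⟩
      · rintro a ha b (rfl | hb) hab
        · exact h3 a ha hab.symm
        · exact h a ha b hb hab
  · push Not at h2
    refine ⟨insert v A, B, Set.insert_nonempty _ _, hB, ?_, by rw [Set.insert_union], Or.inr ?_⟩
    · rw [Set.disjoint_insert_left]; exact ⟨hvB, hAB⟩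
    · rintro a (rfl | ha) b hb hab
      · exact h2 b hb hab
      · exact h a ha b hb hab

/-- A cograph on at least two vertices, or its complement, is disconnected. -/
theorem IsCograph.splits {H : SimpleGraph V} (hH : H.IsCograph) (W : Finset V)
    (hW : 2 ≤ W.card) : H.Splits W := by
  classical
  induction W using Finset.induction_on with
  | empty => simp at hW
  | insert v W hv ih =>
    rw [Finset.card_insert_of_notMem hv] at hW
    rw [Finset.coe_insert]
    rcases (show W.card = 1 ∨ 2 ≤ W.card by omega) with h1 | h2
    · obtain ⟨w, rfl⟩ := Finset.card_eq_one.1 h1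
      have hvw : v ≠ w := by simpa using hv
      refine ⟨{v}, {w}, Set.singleton_nonempty v, Set.singleton_nonempty w, by simpa using hvw,
        by rw [Finset.coe_singleton, Set.singleton_union], ?_⟩
      by_cases h : H.Adj v w
      · left; simpa using h
      · right; simpa using h
    · obtain ⟨A, B, hA, hB, hAB, hABW, h⟩ := ih h2
      have hv' : v ∉ A ∪ B := by rw [hABW]; simpa using hv
      rw [← hABW]
      rcases h with h | h
      · exact (hH.compl.splits_insert hA hB hAB hv' fun a ha b hb hab => hab.2 (h a ha b hb)).of_compl
      · exact hH.splits_insert hA hB hAB hv' h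

/-- A cograph on at least two vertices has two vertices that no third one distinguishes. -/
theorem IsCograph.exists_twins {H : SimpleGraph V} (hH : H.IsCograph) (W : Finset V)
    (hW : 2 ≤ W.card) : ∃ x ∈ W, ∃ y ∈ W, x ≠ y ∧
      ∀ z ∈ W, z ≠ x → z ≠ y → (H.Adj x z ↔ H.Adj y z) := by
  classical
  induction W using Finset.strongInduction with
  | H W ih =>
    obtain ⟨A, B, hA, hB, hAB, hABW, h⟩ := hH.splits W hW
    -- Twins of one part are twins in `W`, because no vertex of the other part distinguishes them.
    have main : ∀ C D : Set V, D.Nonempty → Disjoint C D → C ∪ D = W →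
        ((∀ a ∈ C, ∀ b ∈ D, H.Adj a b) ∨ ∀ a ∈ C, ∀ b ∈ D, ¬ H.Adj a b) → C.Nontrivial →
        ∃ x ∈ W, ∃ y ∈ W, x ≠ y ∧ ∀ z ∈ W, z ≠ x → z ≠ y → (H.Adj x z ↔ H.Adj y z) := by
      intro C D hD hCD hW h hC
      have hmem : ∀ z, z ∈ W ↔ z ∈ C ∨ z ∈ D := fun z => by
        rw [← Finset.mem_coe, ← hW]; rfl
      have hlt : {z ∈ W | z ∈ C} ⊂ W := by
        obtain ⟨d, hd⟩ := hD
        refine Finset.filter_ssubset.2 ⟨d, (hmem d).2 (Or.inr hd), fun hd' => ?_⟩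
        exact hCD.ne_of_mem hd' hd rfl
      obtain ⟨x, hx, y, hy, hxy, ht⟩ := ih _ hlt (by
        obtain ⟨a, ha, b, hb, hab⟩ := hC
        exact Finset.one_lt_card.2 ⟨a, by simp [hmem, ha], b, by simp [hmem, hb], hab⟩)
      rw [Finset.mem_filter] at hx hy
      refine ⟨x, hx.1, y, hy.1, hxy, fun z hz hzx hzy => ?_⟩
      rcases (hmem z).1 hz with hz' | hz'
      · exact ht z (by simp [hz, hz']) hzx hzy
      · rcases h with h | h
        · simp [h x hx.2 z hz', h y hy.2 z hz']
        · simp [h x hx.2 z hz', h y hy.2 z hz']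
    by_cases hAn : A.Nontrivial
    · exact main A B hB hAB hABW h hAn
    by_cases hBn : B.Nontrivial
    · refine main B A hA hAB.symm (by rw [Set.union_comm, hABW]) ?_ hBn
      rcases h with h | h
      · exact Or.inl fun a ha b hb => (h b hb a ha).symm
      · exact Or.inr fun a ha b hb hab => h b hb a ha hab.symm
    obtain ⟨a, ha⟩ := hA
    obtain ⟨b, hb⟩ := hB
    rw [Set.not_nontrivial_iff] at hAn hBn
    refine ⟨a, ?_, b, ?_, hAB.ne_of_mem ha hb, fun z hz hza hzb => ?_⟩
    · rw [← Finset.mem_coe, ← hABW]; exact Or.inl ha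
    · rw [← Finset.mem_coe, ← hABW]; exact Or.inr hb
    · rw [← Finset.mem_coe, ← hABW] at hz
      rcases hz with hz | hz
      · exact absurd (hAn hz ha) hza
      · exact absurd (hBn hz hb) hzb

/-- Every switch of the disjoint union of a path on four vertices and a single vertex contains an
induced path on four vertices. The vertex `4` is the isolated one, and `b` is the switching set. -/
theorem exists_path_of_switch_coGem (b : Fin 5 → Bool) :
    ∃ w x y z : Fin 5,
      let E : Fin 5 → Fin 5 → Bool := fun i j =>
        (decide ((i : ℕ) < 4 ∧ (j : ℕ) < 4 ∧ ((i : ℕ) + 1 = j ∨ (j : ℕ) + 1 = i))) ^^ (b i ^^ b j)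
      E w x ∧ E x y ∧ E y z ∧ !E w y ∧ !E w z ∧ !E x z := by
  revert b
  decide

theorem isolated_seidelSwitch_neighborSet (G : SimpleGraph V) (v x : V) :
    ¬ (G.seidelSwitch (G.neighborSet v)).Adj v x := by
  simp only [seidelSwitch, mem_neighborSet, G.irrefl, false_iff]
  tauto

theorem seidelSwitch_seidelSwitch (H : SimpleGraph V) (S T : Set V) :
    (H.seidelSwitch S).seidelSwitch T = H.seidelSwitch (symmDiff S T) := by
  ext x y
  simp only [seidelSwitch, Set.mem_symmDiff]
  tauto

/-- A path on four vertices in the switch avoids the isolated vertex `v`; together with `v` it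
induces, in the cograph, a switch of a path with an isolated vertex. -/
theorem IsCograph.seidelSwitch_of_isolated {H : SimpleGraph V} (hH : H.IsCograph) {S : Set V}
    {v : V} (hv : ∀ x, ¬ (H.seidelSwitch S).Adj v x) : (H.seidelSwitch S).IsCograph := by
  classical
  have hF : ∀ x y, H.Adj x y ↔ ((H.seidelSwitch S).Adj x y ↔ (x ∈ S ↔ y ∈ S)) := by
    intro x y; simp only [seidelSwitch]; tauto
  generalize H.seidelSwitch S = F at *
  refine IsCograph.of_no_path fun a b c d hab hbc hcd hac had hbd => ?_
  have hv' : ∀ x, ¬ F.Adj x v := fun x h => hv x h.symm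
  have hab' := hab.symm
  have hbc' := hbc.symm
  have hcd' := hcd.symm
  have hca : ¬ F.Adj c a := fun h => hac h.symm
  have hda : ¬ F.Adj d a := fun h => had h.symm
  have hdb : ¬ F.Adj d b := fun h => hbd h.symm
  let f : Fin 5 → V := ![a, b, c, d, v]
  let β : Fin 5 → Bool := fun i => decide (f i ∈ S)
  have hFf : ∀ i j, F.Adj (f i) (f j) ↔
      ((i : ℕ) < 4 ∧ (j : ℕ) < 4 ∧ ((i : ℕ) + 1 = j ∨ (j : ℕ) + 1 = i)) := by
    intro i j
    fin_cases i <;> fin_cases j <;> simp [f, *]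
  have key : ∀ i j, H.Adj (f i) (f j) ↔
      ((decide ((i : ℕ) < 4 ∧ (j : ℕ) < 4 ∧ ((i : ℕ) + 1 = j ∨ (j : ℕ) + 1 = i))) ^^
        (β i ^^ β j)) = true := by
    intro i j
    rw [hF, hFf]
    by_cases p1 : f i ∈ S <;> by_cases p2 : f j ∈ S <;> simp [β, p1, p2] <;> omega
  obtain ⟨w, x, y, z, h⟩ := exists_path_of_switch_coGem β
  simp only [Bool.not_eq_true', ← Bool.not_eq_true, ← key] at h
  exact hH.not_path h.1 h.2.1 h.2.2.1 h.2.2.2.1 h.2.2.2.2.1 h.2.2.2.2.2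

theorem IsCameron.isCograph_seidelSwitch {G : SimpleGraph V} (hG : G.IsCameron) (v : V) :
    (G.seidelSwitch (G.neighborSet v)).IsCograph := by
  have hv := isolated_seidelSwitch_neighborSet G v
  obtain ⟨H, S, hH, rfl⟩ := hG
  rw [seidelSwitch_seidelSwitch] at *
  exact hH.seidelSwitch_of_isolated hv

/-! ### Selections of pairs and cliques -/

theorem seidelSwitch_adj_of_same {H : SimpleGraph V} {S : Set V} {x y : V}
    (h : x ∈ S ↔ y ∈ S) : (H.seidelSwitch S).Adj x y ↔ H.Adj x y := by
  simp [seidelSwitch, h]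

theorem seidelSwitch_adj_of_not_same {H : SimpleGraph V} {S : Set V} {x y : V}
    (h : ¬ (x ∈ S ↔ y ∈ S)) : (H.seidelSwitch S).Adj x y ↔ ¬ H.Adj x y := by
  simp [seidelSwitch, h]

/-- The vertex `x` has a neighbour in the pair `e`. -/
def Hits (G : SimpleGraph V) (e : V × V) (x : V) : Prop :=
  G.Adj x e.1 ∨ G.Adj x e.2

/-- A selection in the vertex set `M`: a list `p` of edges of `H` crossing the cut `S`, which are
independent pairs of the switch of `H` and will be colour classes, and cliques `Q` inside and `R`
outside of `S`. In the switch, each pair of `p` hits all later pairs of `p` and all vertices of `Q`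
and `R`. -/
structure IsSelection (H : SimpleGraph V) (S M : Set V) (Q R : Finset V) (p : List (V × V)) :
    Prop where
  left_mem : ∀ x ∈ Q, x ∈ M ∧ x ∈ S
  right_mem : ∀ x ∈ R, x ∈ M ∧ x ∉ S
  left_clique : ∀ x ∈ Q, ∀ y ∈ Q, x ≠ y → H.Adj x y
  right_clique : ∀ x ∈ R, ∀ y ∈ R, x ≠ y → H.Adj x y
  mem_pair : ∀ e ∈ p, (e.1 ∈ M ∧ e.1 ∈ S) ∧ (e.2 ∈ M ∧ e.2 ∉ S) ∧ H.Adj e.1 e.2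
  pairwise : p.Pairwise fun e f =>
    (H.seidelSwitch S).Hits e f.1 ∧ (H.seidelSwitch S).Hits e f.2
  hits_left : ∀ e ∈ p, ∀ x ∈ Q, (H.seidelSwitch S).Hits e x
  hits_right : ∀ e ∈ p, ∀ x ∈ R, (H.seidelSwitch S).Hits e x

theorem IsSelection.mono {H : SimpleGraph V} {S M : Set V} {Q R Q' R' : Finset V}
    {p : List (V × V)} (h : H.IsSelection S M Q R p) (hQ : Q' ⊆ Q) (hR : R' ⊆ R) :
    H.IsSelection S M Q' R' p where
  left_mem x hx := h.left_mem x (hQ hx)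
  right_mem x hx := h.right_mem x (hR hx)
  left_clique x hx y hy := h.left_clique x (hQ hx) y (hQ hy)
  right_clique x hx y hy := h.right_clique x (hR hx) y (hR hy)
  mem_pair := h.mem_pair
  pairwise := h.pairwise
  hits_left e he x hx := h.hits_left e he x (hQ hx)
  hits_right e he x hx := h.hits_right e he x (hR hx)

/-- Adjacent vertices of the two cliques can be turned into a further pair. -/
theorem IsSelection.pop {H : SimpleGraph V} {S M : Set V} {Q R Q' R' : Finset V}
    {p : List (V × V)} (h : H.IsSelection S M Q R p) {q r : V} (hq : q ∈ Q) (hr : r ∈ R)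
    (hqr : H.Adj q r) (hQ : Q' ⊆ Q) (hR : R' ⊆ R) (hqQ : q ∉ Q') (hrR : r ∉ R') :
    H.IsSelection S M Q' R' (p ++ [(q, r)]) where
  left_mem := (h.mono hQ hR).left_mem
  right_mem := (h.mono hQ hR).right_mem
  left_clique := (h.mono hQ hR).left_clique
  right_clique := (h.mono hQ hR).right_clique
  mem_pair e he := by
    rcases List.mem_append.1 he with he | he
    · exact h.mem_pair e he
    · rw [List.mem_singleton.1 he]
      exact ⟨h.left_mem q hq, h.right_mem r hr, hqr⟩
  pairwise := by
    refine List.pairwise_append.2 ⟨h.pairwise, List.pairwise_singleton _ _, fun e he f hf => ?_⟩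
    rw [List.mem_singleton.1 hf]
    exact ⟨h.hits_left e he q hq, h.hits_right e he r hr⟩
  hits_left e he x hx := by
    rcases List.mem_append.1 he with he | he
    · exact h.hits_left e he x (hQ hx)
    · rw [List.mem_singleton.1 he]
      left
      rw [seidelSwitch_adj_of_same (by simp [(h.left_mem x (hQ hx)).2, (h.left_mem q hq).2])]
      exact h.left_clique x (hQ hx) q hq fun hxq => hqQ (hxq ▸ hx)
  hits_right e he x hx := by
    rcases List.mem_append.1 he with he | he
    · exact h.hits_right e he x (hR hx)
    · rw [List.mem_singleton.1 he]
      right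
      rw [seidelSwitch_adj_of_same (by simp [(h.right_mem x (hR hx)).2, (h.right_mem r hr).2])]
      exact h.right_clique x (hR hx) r hr fun hxr => hrR (hxr ▸ hx)

/-- The numbers `s`, `t`, `g` are the sizes of the cliques and the number of pairs of some
selection. -/
def Selectable (H : SimpleGraph V) (S M : Set V) (s t g : ℕ) : Prop :=
  ∃ Q R p, H.IsSelection S M Q R p ∧ Q.card = s ∧ R.card = t ∧ p.length = g

theorem selectable_zero (H : SimpleGraph V) (S M : Set V) : H.Selectable S M 0 0 0 :=
  ⟨∅, ∅, [], by constructor <;> simp, rfl, rfl, rfl⟩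

theorem selectable_of_mem (H : SimpleGraph V) {S : Set V} {v : V} (hv : v ∈ S) :
    H.Selectable S {v} 1 0 0 :=
  ⟨{v}, ∅, [], by constructor <;> simp [hv], rfl, rfl, rfl⟩

theorem selectable_of_notMem (H : SimpleGraph V) {S : Set V} {v : V} (hv : v ∉ S) :
    H.Selectable S {v} 0 1 0 :=
  ⟨∅, {v}, [], by constructor <;> simp [hv], rfl, rfl, rfl⟩

/-- A vertex that does not distinguish the ends of a crossing pair is adjacent, in the switch, to
exactly one of them. -/
theorem hits_of_adj_iff {H : SimpleGraph V} {S : Set V} {e : V × V} {x : V} (h1 : e.1 ∈ S)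
    (h2 : e.2 ∉ S) (h : H.Adj x e.1 ↔ H.Adj x e.2) : (H.seidelSwitch S).Hits e x := by
  unfold Hits
  by_cases hx : x ∈ S
  · rw [seidelSwitch_adj_of_same (by simp [hx, h1]), seidelSwitch_adj_of_not_same (by simp [hx, h2])]
    tauto
  · rw [seidelSwitch_adj_of_not_same (by simp [hx, h1]), seidelSwitch_adj_of_same (by simp [hx, h2])]
    tauto

section

variable {H : SimpleGraph V} {S M₁ M₂ : Set V} {s₁ t₁ g₁ s₂ t₂ g₂ : ℕ}

/-- The pairs of two selections can be put one after another if those of the first one hit the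
vertex set of the second one. -/
theorem pairwise_append_of_isSelection {Q₁ R₁ Q₂ R₂ : Finset V} {p₁ p₂ : List (V × V)}
    (h₁ : H.IsSelection S M₁ Q₁ R₁ p₁) (h₂ : H.IsSelection S M₂ Q₂ R₂ p₂)
    (hits : ∀ e ∈ p₁, ∀ x ∈ M₂, (H.seidelSwitch S).Hits e x) :
    (p₁ ++ p₂).Pairwise fun e f =>
      (H.seidelSwitch S).Hits e f.1 ∧ (H.seidelSwitch S).Hits e f.2 :=
  List.pairwise_append.2 ⟨h₁.pairwise, h₂.pairwise, fun e he f hf =>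
    ⟨hits e he _ (h₂.mem_pair f hf).1.1, hits e he _ (h₂.mem_pair f hf).2.1.1⟩⟩

theorem Selectable.union (h₁ : H.Selectable S M₁ s₁ t₁ g₁) (h₂ : H.Selectable S M₂ s₂ t₂ g₂)
    (hM : ∀ x ∈ M₁, ∀ y ∈ M₂, ¬ H.Adj x y) :
    H.Selectable S (M₁ ∪ M₂) (max s₁ s₂) (max t₁ t₂) (g₁ + g₂) := by
  classical
  obtain ⟨Q₁, R₁, p₁, h₁, rfl, rfl, rfl⟩ := h₁
  obtain ⟨Q₂, R₂, p₂, h₂, rfl, rfl, rfl⟩ := h₂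
  have hits₁ : ∀ e ∈ p₁, ∀ x ∈ M₂, (H.seidelSwitch S).Hits e x := fun e he x hx => by
    obtain ⟨⟨a1, a2⟩, ⟨b1, b2⟩, -⟩ := h₁.mem_pair e he
    exact hits_of_adj_iff a2 b2
      (iff_of_false (fun h => hM _ a1 _ hx h.symm) fun h => hM _ b1 _ hx h.symm)
  have hits₂ : ∀ e ∈ p₂, ∀ x ∈ M₁, (H.seidelSwitch S).Hits e x := fun e he x hx => by
    obtain ⟨⟨a1, a2⟩, ⟨b1, b2⟩, -⟩ := h₂.mem_pair e he
    exact hits_of_adj_iff a2 b2 (iff_of_false (hM _ hx _ a1) (hM _ hx _ b1))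
  -- The larger clique is kept on each side.
  have hQ : ∃ Q : Finset V, (Q = Q₁ ∨ Q = Q₂) ∧ Q.card = max Q₁.card Q₂.card := by
    rcases le_total Q₁.card Q₂.card with h | h
    · exact ⟨Q₂, Or.inr rfl, by simp [h]⟩
    · exact ⟨Q₁, Or.inl rfl, by simp [h]⟩
  have hR : ∃ R : Finset V, (R = R₁ ∨ R = R₂) ∧ R.card = max R₁.card R₂.card := by
    rcases le_total R₁.card R₂.card with h | h
    · exact ⟨R₂, Or.inr rfl, by simp [h]⟩
    · exact ⟨R₁, Or.inl rfl, by simp [h]⟩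
  obtain ⟨Q, hQ, hQc⟩ := hQ
  obtain ⟨R, hR, hRc⟩ := hR
  refine ⟨Q, R, p₁ ++ p₂, ⟨?_, ?_, ?_, ?_, ?_, ?_, ?_, ?_⟩, hQc, hRc, by simp⟩
  · rcases hQ with rfl | rfl
    · exact fun x hx => ⟨Or.inl (h₁.left_mem x hx).1, (h₁.left_mem x hx).2⟩
    · exact fun x hx => ⟨Or.inr (h₂.left_mem x hx).1, (h₂.left_mem x hx).2⟩
  · rcases hR with rfl | rfl
    · exact fun x hx => ⟨Or.inl (h₁.right_mem x hx).1, (h₁.right_mem x hx).2⟩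
    · exact fun x hx => ⟨Or.inr (h₂.right_mem x hx).1, (h₂.right_mem x hx).2⟩
  · rcases hQ with rfl | rfl
    · exact h₁.left_clique
    · exact h₂.left_clique
  · rcases hR with rfl | rfl
    · exact h₁.right_clique
    · exact h₂.right_clique
  · intro e he
    rcases List.mem_append.1 he with he | he
    · obtain ⟨⟨a1, a2⟩, ⟨b1, b2⟩, c⟩ := h₁.mem_pair e he
      exact ⟨⟨Or.inl a1, a2⟩, ⟨Or.inl b1, b2⟩, c⟩
    · obtain ⟨⟨a1, a2⟩, ⟨b1, b2⟩, c⟩ := h₂.mem_pair e he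
      exact ⟨⟨Or.inr a1, a2⟩, ⟨Or.inr b1, b2⟩, c⟩
  · exact pairwise_append_of_isSelection h₁ h₂ hits₁
  · intro e he x hx
    rcases List.mem_append.1 he with he | he <;> rcases hQ with rfl | rfl
    · exact h₁.hits_left e he x hx
    · exact hits₁ e he x (h₂.left_mem x hx).1
    · exact hits₂ e he x (h₁.left_mem x hx).1
    · exact h₂.hits_left e he x hx
  · intro e he x hx
    rcases List.mem_append.1 he with he | he <;> rcases hR with rfl | rfl
    · exact h₁.hits_right e he x hx
    · exact hits₁ e he x (h₂.right_mem x hx).1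
    · exact hits₂ e he x (h₁.right_mem x hx).1
    · exact h₂.hits_right e he x hx

/-- Pairs with the first end in `Q₁` and the second end in `R₂` are taken one by one. -/
theorem exists_isSelection_pop [DecidableEq V] {M : Set V} (hd : Disjoint M₁ M₂)
    (hM : ∀ x ∈ M₁, ∀ y ∈ M₂, H.Adj x y) (m : ℕ) {Q₁ Q₂ R₁ R₂ : Finset V} {p : List (V × V)}
    (h : H.IsSelection S M (Q₁ ∪ Q₂) (R₁ ∪ R₂) p) (hQ₁ : ∀ x ∈ Q₁, x ∈ M₁)
    (hQ₂ : ∀ x ∈ Q₂, x ∈ M₂) (hR₁ : ∀ x ∈ R₁, x ∈ M₁) (hR₂ : ∀ x ∈ R₂, x ∈ M₂)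
    (hmQ : m ≤ Q₁.card) (hmR : m ≤ R₂.card) :
    ∃ Q R p', Q ⊆ Q₁ ∧ R ⊆ R₂ ∧ Q.card + m = Q₁.card ∧ R.card + m = R₂.card ∧
      p'.length = p.length + m ∧ H.IsSelection S M (Q ∪ Q₂) (R₁ ∪ R) p' := by
  induction m with
  | zero => exact ⟨Q₁, R₂, p, subset_rfl, subset_rfl, rfl, rfl, rfl, h⟩
  | succ m ih =>
    obtain ⟨Q, R, p', hQ, hR, hQc, hRc, hp, h'⟩ := ih (by omega) (by omega)
    obtain ⟨q, hq⟩ := Finset.card_pos.1 (show 0 < Q.card by omega)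
    obtain ⟨r, hr⟩ := Finset.card_pos.1 (show 0 < R.card by omega)
    have hq₁ := hQ₁ q (hQ hq)
    have hr₂ := hR₂ r (hR hr)
    refine ⟨Q.erase q, R.erase r, p' ++ [(q, r)], (Finset.erase_subset _ _).trans hQ,
      (Finset.erase_subset _ _).trans hR, ?_, ?_, by simp [hp]; omega, ?_⟩
    · rw [Finset.card_erase_of_mem hq]; omega
    · rw [Finset.card_erase_of_mem hr]; omega
    · refine h'.pop (Finset.mem_union_left _ hq) (Finset.mem_union_right _ hr)
        (hM q hq₁ r hr₂) (Finset.union_subset_union_left (Finset.erase_subset _ _))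
        (Finset.union_subset_union_right (Finset.erase_subset _ _)) ?_ ?_
      · simp only [Finset.mem_union, Finset.mem_erase, ne_eq, not_true, false_and, false_or]
        exact fun hq' => hd.ne_of_mem hq₁ (hQ₂ q hq') rfl
      · simp only [Finset.mem_union, Finset.mem_erase, ne_eq, not_true, false_and, or_false]
        exact fun hr' => hd.ne_of_mem (hR₁ r hr') hr₂ rfl

theorem Selectable.join (h₁ : H.Selectable S M₁ s₁ t₁ g₁) (h₂ : H.Selectable S M₂ s₂ t₂ g₂)
    (hd : Disjoint M₁ M₂) (hM : ∀ x ∈ M₁, ∀ y ∈ M₂, H.Adj x y) {m₁ m₂ s t : ℕ}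
    (hs₁ : m₁ ≤ s₁) (ht₂ : m₁ ≤ t₂) (hs₂ : m₂ ≤ s₂) (ht₁ : m₂ ≤ t₁)
    (hs : s + m₁ + m₂ = s₁ + s₂) (ht : t + m₁ + m₂ = t₁ + t₂) :
    H.Selectable S (M₁ ∪ M₂) s t (g₁ + g₂ + m₁ + m₂) := by
  classical
  obtain ⟨Q₁, R₁, p₁, h₁, rfl, rfl, rfl⟩ := h₁
  obtain ⟨Q₂, R₂, p₂, h₂, rfl, rfl, rfl⟩ := h₂
  have hits₁ : ∀ e ∈ p₁, ∀ x ∈ M₂, (H.seidelSwitch S).Hits e x := fun e he x hx => by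
    obtain ⟨⟨a1, a2⟩, ⟨b1, b2⟩, -⟩ := h₁.mem_pair e he
    exact hits_of_adj_iff a2 b2 (iff_of_true (hM _ a1 _ hx).symm (hM _ b1 _ hx).symm)
  have hits₂ : ∀ e ∈ p₂, ∀ x ∈ M₁, (H.seidelSwitch S).Hits e x := fun e he x hx => by
    obtain ⟨⟨a1, a2⟩, ⟨b1, b2⟩, -⟩ := h₂.mem_pair e he
    exact hits_of_adj_iff a2 b2 (iff_of_true (hM _ hx _ a1) (hM _ hx _ b1))
  have h : H.IsSelection S (M₁ ∪ M₂) (Q₁ ∪ Q₂) (R₁ ∪ R₂) (p₁ ++ p₂) := by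
    refine ⟨?_, ?_, ?_, ?_, ?_, pairwise_append_of_isSelection h₁ h₂ hits₁, ?_, ?_⟩
    · intro x hx
      rcases Finset.mem_union.1 hx with hx | hx
      · exact ⟨Or.inl (h₁.left_mem x hx).1, (h₁.left_mem x hx).2⟩
      · exact ⟨Or.inr (h₂.left_mem x hx).1, (h₂.left_mem x hx).2⟩
    · intro x hx
      rcases Finset.mem_union.1 hx with hx | hx
      · exact ⟨Or.inl (h₁.right_mem x hx).1, (h₁.right_mem x hx).2⟩
      · exact ⟨Or.inr (h₂.right_mem x hx).1, (h₂.right_mem x hx).2⟩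
    · intro x hx y hy hxy
      rcases Finset.mem_union.1 hx with hx | hx <;> rcases Finset.mem_union.1 hy with hy | hy
      · exact h₁.left_clique x hx y hy hxy
      · exact hM x (h₁.left_mem x hx).1 y (h₂.left_mem y hy).1
      · exact (hM y (h₁.left_mem y hy).1 x (h₂.left_mem x hx).1).symm
      · exact h₂.left_clique x hx y hy hxy
    · intro x hx y hy hxy
      rcases Finset.mem_union.1 hx with hx | hx <;> rcases Finset.mem_union.1 hy with hy | hy
      · exact h₁.right_clique x hx y hy hxy
      · exact hM x (h₁.right_mem x hx).1 y (h₂.right_mem y hy).1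
      · exact (hM y (h₁.right_mem y hy).1 x (h₂.right_mem x hx).1).symm
      · exact h₂.right_clique x hx y hy hxy
    · intro e he
      rcases List.mem_append.1 he with he | he
      · obtain ⟨⟨a1, a2⟩, ⟨b1, b2⟩, c⟩ := h₁.mem_pair e he
        exact ⟨⟨Or.inl a1, a2⟩, ⟨Or.inl b1, b2⟩, c⟩
      · obtain ⟨⟨a1, a2⟩, ⟨b1, b2⟩, c⟩ := h₂.mem_pair e he
        exact ⟨⟨Or.inr a1, a2⟩, ⟨Or.inr b1, b2⟩, c⟩
    · intro e he x hx
      rcases List.mem_append.1 he with he | he <;> rcases Finset.mem_union.1 hx with hx | hx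
      · exact h₁.hits_left e he x hx
      · exact hits₁ e he x (h₂.left_mem x hx).1
      · exact hits₂ e he x (h₁.left_mem x hx).1
      · exact h₂.hits_left e he x hx
    · intro e he x hx
      rcases List.mem_append.1 he with he | he <;> rcases Finset.mem_union.1 hx with hx | hx
      · exact h₁.hits_right e he x hx
      · exact hits₁ e he x (h₂.right_mem x hx).1
      · exact hits₂ e he x (h₁.right_mem x hx).1
      · exact h₂.hits_right e he x hx
  have hQ₁ := fun x hx => (h₁.left_mem x hx).1
  have hQ₂ := fun x hx => (h₂.left_mem x hx).1
  have hR₁ := fun x hx => (h₁.right_mem x hx).1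
  have hR₂ := fun x hx => (h₂.right_mem x hx).1
  obtain ⟨Q, R, p, hQ, hR, hQc, hRc, hp, h⟩ :=
    exists_isSelection_pop hd hM m₁ h hQ₁ hQ₂ hR₁ hR₂ hs₁ ht₂
  rw [Finset.union_comm Q, Finset.union_comm R₁] at h
  obtain ⟨Q', R', p', hQ', hR', hQc', hRc', hp', h⟩ :=
    exists_isSelection_pop hd.symm (fun x hx y hy => (hM y hy x hx).symm) m₂ h hQ₂
      (fun x hx => hQ₁ x (hQ hx)) (fun x hx => hR₂ x (hR hx)) hR₁ hs₂ ht₁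
  refine ⟨Q' ∪ Q, R ∪ R', p', h, ?_, ?_, ?_⟩
  · rw [Finset.card_union_of_disjoint]
    · omega
    · exact Finset.disjoint_left.2 fun x hx hx' =>
        hd.ne_of_mem (hQ₁ x (hQ hx')) (hQ₂ x (hQ' hx)) rfl
  · rw [Finset.card_union_of_disjoint]
    · omega
    · exact Finset.disjoint_left.2 fun x hx hx' =>
        hd.ne_of_mem (hR₁ x (hR' hx')) (hR₂ x (hR hx)) rfl
  · rw [hp', hp, List.length_append]

end

theorem Selectable.right_le_card [Fintype V] {H : SimpleGraph V} {S M : Set V} {s t g : ℕ}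
    (h : H.Selectable S M s t g) : t ≤ Fintype.card V := by
  obtain ⟨Q, R, p, -, -, rfl, -⟩ := h
  exact Finset.card_le_univ R

/-- The pairs of a selection, the vertices of its clique in `S` one by one, and finally the
vertex `v` are the classes of a first-fit colouring of an induced subgraph. -/
theorem Selectable.add_le_grundyNumber [Finite V] {G : SimpleGraph V} {v : V} {M : Set V}
    {s t g : ℕ} (h : (G.seidelSwitch (G.neighborSet v)).Selectable (G.neighborSet v) M s t g) :
    s + g + 1 ≤ G.grundyNumber := by
  classical
  obtain ⟨Q, R, p, h, rfl, -, rfl⟩ := h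
  have hG : (G.seidelSwitch (G.neighborSet v)).seidelSwitch (G.neighborSet v) = G := by
    rw [seidelSwitch_seidelSwitch, symmDiff_self]
    ext x y
    exact seidelSwitch_adj_of_same (by simp)
  let l : List (Set V) := p.map (fun e => {e.1, e.2}) ++ (Q.toList.map (fun x => {x}) ++ [{v}])
  have hl : l.length = Q.card + p.length + 1 := by simp [l]; omega
  rw [← hl]
  have hp := h.pairwise
  have hpQ := h.hits_left
  rw [hG] at hp hpQ
  refine length_le_grundyNumber G l ?_ ?_ ?_
  · intro C hC
    simp only [l, List.mem_append, List.mem_map, List.mem_singleton] at hC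
    rcases hC with ⟨e, -, rfl⟩ | ⟨x, -, rfl⟩ | rfl
    · exact Set.insert_nonempty _ _
    · exact Set.singleton_nonempty _
    · exact Set.singleton_nonempty _
  · intro C hC
    simp only [l, List.mem_append, List.mem_map, List.mem_singleton] at hC
    rcases hC with ⟨e, he, rfl⟩ | ⟨x, -, rfl⟩ | rfl
    · obtain ⟨⟨-, ha⟩, ⟨-, hb⟩, hab⟩ := h.mem_pair e he
      have hab' : ¬ G.Adj e.1 e.2 := (seidelSwitch_adj_of_not_same (by simp [ha, hb])).1 hab
      rintro x (rfl | rfl) y (rfl | rfl)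
      · exact G.irrefl
      · exact hab'
      · exact fun h => hab' h.symm
      · exact G.irrefl
    · rintro y rfl z rfl
      exact G.irrefl
    · rintro y rfl z rfl
      exact G.irrefl
  · refine List.pairwise_append.2 ⟨?_, List.pairwise_append.2 ⟨?_, List.pairwise_singleton _ _, ?_⟩,
      ?_⟩
    · rw [List.pairwise_map]
      refine hp.imp fun {e f} hef => ?_
      rintro x (rfl | rfl)
      · rcases hef.1 with h | h
        · exact ⟨_, Or.inl rfl, h⟩
        · exact ⟨_, Or.inr rfl, h⟩
      · rcases hef.2 with h | h
        · exact ⟨_, Or.inl rfl, h⟩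
        · exact ⟨_, Or.inr rfl, h⟩
    · rw [List.pairwise_map]
      refine Q.nodup_toList.imp_of_mem fun {x y} hx hy hxy => ?_
      rw [Finset.mem_toList] at hx hy
      rintro z rfl
      refine ⟨x, rfl, ?_⟩
      have := h.left_clique z hy x hx hxy.symm
      rwa [seidelSwitch_adj_of_same] at this
      simp only [(h.left_mem z hy).2, (h.left_mem x hx).2]
    · intro C hC D hD
      obtain ⟨x, hx, rfl⟩ := List.mem_map.1 hC
      rw [List.mem_singleton.1 hD]
      rintro y rfl
      exact ⟨x, rfl, (h.left_mem x (Finset.mem_toList.1 hx)).2⟩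
    · intro C hC D hD
      obtain ⟨e, he, rfl⟩ := List.mem_map.1 hC
      simp only [List.mem_append, List.mem_map, List.mem_singleton] at hD
      rcases hD with ⟨x, hx, rfl⟩ | rfl
      · rintro y rfl
        rcases hpQ e he y (Finset.mem_toList.1 hx) with h | h
        · exact ⟨_, Or.inl rfl, h⟩
        · exact ⟨_, Or.inr rfl, h⟩
      · rintro y rfl
        exact ⟨e.1, Or.inl rfl, (h.mem_pair e he).1.2⟩

/-! ### Colour classes in a module -/

/-- No vertex outside of `M` distinguishes two vertices of `M`. -/
def IsModule (H : SimpleGraph V) (M : Set V) : Prop :=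
  ∀ x ∈ M, ∀ y ∈ M, ∀ z ∉ M, H.Adj x z ↔ H.Adj y z

/-- The colour class `i` has vertices on both sides of the cut `S`, and it lies in `M`. -/
def ClassInside (S : Set V) (c : V → ℕ) (M : Set V) (i : ℕ) : Prop :=
  (∃ x ∈ S, c x = i) ∧ (∃ x ∉ S, c x = i) ∧ ∀ x, c x = i → x ∈ M

open Classical in
/-- The colours below `K` whose classes cross the cut `S` and lie in `M`. -/
noncomputable def insideClasses (S : Set V) (c : V → ℕ) (K : ℕ) (M : Set V) : Finset ℕ :=
  {i ∈ Finset.range K | ClassInside S c M i}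

open Classical in
/-- The colours below `K` whose classes meet `M` in a vertex of `P`, but are not among
`insideClasses S c K M`. The set `P` is going to be `S` or its complement. -/
noncomputable def reachingClasses (S : Set V) (c : V → ℕ) (K : ℕ) (M P : Set V) : Finset ℕ :=
  {i ∈ Finset.range K | ¬ ClassInside S c M i ∧ ∃ x ∈ M, x ∈ P ∧ c x = i}

open Classical in
/-- The colours below `K` whose classes lie in the union of `M₁` and `M₂`, cross the cut `S`, meet
both `M₁` and `M₂`, and have a vertex of `P` in `M₁`. -/
noncomputable def crossingClasses (S : Set V) (c : V → ℕ) (K : ℕ) (M₁ M₂ P : Set V) : Finset ℕ :=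
  {i ∈ Finset.range K | ClassInside S c (M₁ ∪ M₂) i ∧ ¬ ClassInside S c M₁ i ∧
    ¬ ClassInside S c M₂ i ∧ ∃ x ∈ M₁, x ∈ P ∧ c x = i}

section

variable {H : SimpleGraph V} {S M M₁ M₂ P : Set V} {c : V → ℕ} {K : ℕ}

theorem mem_insideClasses {i : ℕ} :
    i ∈ insideClasses S c K M ↔ i < K ∧ ClassInside S c M i := by
  simp [insideClasses]

theorem mem_reachingClasses {i : ℕ} : i ∈ reachingClasses S c K M P ↔
    i < K ∧ ¬ ClassInside S c M i ∧ ∃ x ∈ M, x ∈ P ∧ c x = i := by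
  simp [reachingClasses]

theorem mem_crossingClasses {i : ℕ} : i ∈ crossingClasses S c K M₁ M₂ P ↔
    i < K ∧ ClassInside S c (M₁ ∪ M₂) i ∧ ¬ ClassInside S c M₁ i ∧ ¬ ClassInside S c M₂ i ∧
      ∃ x ∈ M₁, x ∈ P ∧ c x = i := by
  simp [crossingClasses]

theorem ClassInside.mono {i : ℕ} (h : ClassInside S c M₁ i) (hM : M₁ ⊆ M₂) :
    ClassInside S c M₂ i :=
  ⟨h.1, h.2.1, fun x hx => hM (h.2.2 x hx)⟩

theorem ClassInside.not_of_disjoint {i : ℕ} (h : ClassInside S c M₁ i) (hd : Disjoint M₁ M₂)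
    {x : V} (hx : x ∈ M₂) : c x ≠ i :=
  fun hi => hd.ne_of_mem (h.2.2 x hi) hx rfl

theorem IsGreedy.not_adj (hc : (H.seidelSwitch S).IsGreedy c) {x y : V} (h : x ∈ S ↔ y ∈ S)
    (hxy : c x = c y) : ¬ H.Adj x y := fun h' =>
  hc.proper x y ((seidelSwitch_adj_of_same h).2 h') hxy

theorem IsGreedy.adj (hc : (H.seidelSwitch S).IsGreedy c) {x y : V} (h : ¬ (x ∈ S ↔ y ∈ S))
    (hxy : c x = c y) : H.Adj x y := by
  by_contra h'
  exact hc.proper x y ((seidelSwitch_adj_of_not_same h).2 h') hxy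

/-- The trace of a class on one side of a module dominates the later vertices on this side of the
module by edges of `H`, unless the class crosses the cut inside the module. -/
theorem IsGreedy.exists_adj_of_not_classInside (hc : (H.seidelSwitch S).IsGreedy c)
    (hM : H.IsModule M) {a x : V} (ha : a ∈ M) (hx : x ∈ M) (hi : ¬ ClassInside S c M (c a))
    (hlt : c a < c x) (hax : a ∈ S ↔ x ∈ S) :
    ∃ w ∈ M, (x ∈ S ↔ w ∈ S) ∧ c w = c a ∧ H.Adj x w := by
  obtain ⟨w, hxw, hw⟩ := hc.hits x (c a) hlt
  by_cases hs : x ∈ S ↔ w ∈ S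
  · have hadj := (seidelSwitch_adj_of_same hs).1 hxw
    refine ⟨w, ?_, hs, hw, hadj⟩
    by_contra hwM
    exact hc.not_adj (hax.trans hs) hw.symm ((hM x hx a ha w hwM).1 hadj)
  · exfalso
    have hnadj := (seidelSwitch_adj_of_not_same hs).1 hxw
    have haw : ¬ (a ∈ S ↔ w ∈ S) := fun h => hs (hax.symm.trans h)
    have hadj := hc.adj haw hw.symm
    have hwM : w ∈ M := by
      by_contra hwM
      exact hnadj ((hM x hx a ha w hwM).2 hadj)
    refine hi ⟨?_, ?_, fun z hz => ?_⟩
    · by_cases h : a ∈ S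
      · exact ⟨a, h, rfl⟩
      · exact ⟨w, by tauto, hw⟩
    · by_cases h : a ∈ S
      · exact ⟨w, by tauto, hw⟩
      · exact ⟨a, h, rfl⟩
    · by_contra hzM
      by_cases hza : a ∈ S ↔ z ∈ S
      · refine hc.not_adj hza hz.symm ((hM a ha w hwM z hzM).2 (hc.adj ?_ (hw.trans hz.symm)))
        exact fun h => haw (hza.trans h.symm)
      · refine hc.not_adj (y := z) (x := w) ?_ (hw.trans hz.symm)
          ((hM a ha w hwM z hzM).1 (hc.adj hza hz.symm))
        tauto

theorem reachingClasses_union (hc : (H.seidelSwitch S).IsGreedy c) (hd : Disjoint M₁ M₂)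
    (hM : ∀ x ∈ M₁, ∀ y ∈ M₂, ¬ H.Adj x y) :
    reachingClasses S c K (M₁ ∪ M₂) P =
      reachingClasses S c K M₁ P ∪ reachingClasses S c K M₂ P ∧
    insideClasses S c K (M₁ ∪ M₂) = insideClasses S c K M₁ ∪ insideClasses S c K M₂ := by
  -- A class that crosses the cut is connected in `H`.
  have key : ∀ i, ClassInside S c (M₁ ∪ M₂) i ↔ ClassInside S c M₁ i ∨ ClassInside S c M₂ i := by
    refine fun i => ⟨fun ⟨⟨a, ha, hai⟩, ⟨b, hb, hbi⟩, h⟩ => ?_, fun h => ?_⟩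
    · have cross : ∀ x y, c x = i → c y = i → x ∈ S → y ∉ S → (x ∈ M₁ ↔ y ∈ M₁) := by
        intro x y hx hy hxS hyS
        have hadj := hc.adj (x := x) (y := y) (by simp [hxS, hyS]) (hx.trans hy.symm)
        constructor
        · intro hx1
          exact (h y hy).resolve_right fun hy2 => hM x hx1 y hy2 hadj
        · intro hy1
          exact (h x hx).resolve_right fun hx2 => hM y hy1 x hx2 hadj.symm
      have all : ∀ x, c x = i → (x ∈ M₁ ↔ a ∈ M₁) := by
        intro x hx
        by_cases hxS : x ∈ S
        · exact (cross x b hx hbi hxS hb).trans (cross a b hai hbi ha hb).symm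
        · exact (cross a x hai hx ha hxS).symm
      by_cases ha1 : a ∈ M₁
      · exact Or.inl ⟨⟨a, ha, hai⟩, ⟨b, hb, hbi⟩, fun x hx => (all x hx).2 ha1⟩
      · exact Or.inr ⟨⟨a, ha, hai⟩, ⟨b, hb, hbi⟩, fun x hx =>
          (h x hx).resolve_left fun h => ha1 ((all x hx).1 h)⟩
    · rcases h with h | h
      · exact h.mono Set.subset_union_left
      · exact h.mono Set.subset_union_right
  constructor
  · ext i
    simp only [Finset.mem_union, mem_reachingClasses, key, not_or]
    constructor
    · rintro ⟨hi, ⟨h1, h2⟩, x, hx | hx, hxP, hxi⟩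
      · exact Or.inl ⟨hi, h1, x, hx, hxP, hxi⟩
      · exact Or.inr ⟨hi, h2, x, hx, hxP, hxi⟩
    · rintro (⟨hi, h, x, hx, hxP, hxi⟩ | ⟨hi, h, x, hx, hxP, hxi⟩)
      · exact ⟨hi, ⟨h, fun h' => h'.not_of_disjoint hd.symm hx hxi⟩, x, Or.inl hx, hxP, hxi⟩
      · exact ⟨hi, ⟨fun h' => h'.not_of_disjoint hd hx hxi, h⟩, x, Or.inr hx, hxP, hxi⟩
  · ext i
    simp only [Finset.mem_union, mem_insideClasses, key]
    tauto

theorem disjoint_insideClasses (hd : Disjoint M₁ M₂) :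
    Disjoint (insideClasses S c K M₁) (insideClasses S c K M₂) := by
  refine Finset.disjoint_left.2 fun i h1 h2 => ?_
  obtain ⟨⟨x, -, hx⟩, -, h⟩ := (mem_insideClasses.1 h1).2
  exact (mem_insideClasses.1 h2).2.not_of_disjoint hd.symm (h x hx) hx

/-- In a disconnected module, one of the two traces of classes contains the other one: of two
classes that reach different parts only, the earlier one does not dominate the later one. -/
theorem card_reachingClasses_union (hc : (H.seidelSwitch S).IsGreedy c) (hd : Disjoint M₁ M₂)
    (hM : ∀ x ∈ M₁, ∀ y ∈ M₂, ¬ H.Adj x y) (hmod : H.IsModule (M₁ ∪ M₂))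
    (hP : ∀ x ∈ P, ∀ y, (x ∈ S ↔ y ∈ S) ↔ y ∈ P) :
    (reachingClasses S c K (M₁ ∪ M₂) P).card =
      max (reachingClasses S c K M₁ P).card (reachingClasses S c K M₂ P).card := by
  rw [(reachingClasses_union hc hd hM).1]
  -- The class `i` reaches `N₁` but not `N₂`, the later class `j` reaches `N₂`.
  have main : ∀ N₁ N₂ : Set V, Disjoint N₁ N₂ → (∀ x ∈ N₁, ∀ y ∈ N₂, ¬ H.Adj x y) →
      H.IsModule (N₁ ∪ N₂) → ∀ i ∈ reachingClasses S c K N₁ P, i ∉ reachingClasses S c K N₂ P →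
      ∀ j ∈ reachingClasses S c K N₂ P, ¬ i < j := by
    intro N₁ N₂ hd hN hmod i hi hi' j hj hij
    have hiu : i ∈ reachingClasses S c K (N₁ ∪ N₂) P := by
      rw [(reachingClasses_union hc hd hN).1]; exact Finset.mem_union_left _ hi
    obtain ⟨hiK, hin, a, ha, haP, rfl⟩ := mem_reachingClasses.1 hi
    obtain ⟨-, -, x, hx, hxP, rfl⟩ := mem_reachingClasses.1 hj
    have hnot := (mem_reachingClasses.1 hiu).2.1
    obtain ⟨w, hw, hxw, hwa, hadj⟩ := hc.exists_adj_of_not_classInside hmod (Or.inl ha)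
      (Or.inr hx) hnot hij ((hP a haP x).2 hxP)
    rcases hw with hw | hw
    · exact hN w hw x hx hadj.symm
    · exact hi' (mem_reachingClasses.2 ⟨hiK, fun h => hnot (h.mono Set.subset_union_right), w, hw,
        (hP x hxP w).1 hxw, hwa⟩)
  have hsub : reachingClasses S c K M₁ P ⊆ reachingClasses S c K M₂ P ∨
      reachingClasses S c K M₂ P ⊆ reachingClasses S c K M₁ P := by
    by_contra! hcon
    obtain ⟨i, hi, hi'⟩ := Finset.not_subset.1 hcon.1
    obtain ⟨j, hj, hj'⟩ := Finset.not_subset.1 hcon.2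
    have h1 := main M₁ M₂ hd hM hmod i hi hi' j hj
    have h2 := main M₂ M₁ hd.symm (fun x hx y hy h => hM y hy x hx h.symm)
      (by rwa [Set.union_comm]) j hj hj' i hi
    have : i = j := by omega
    exact hi' (this ▸ hj)
  rcases hsub with h | h
  · rw [Finset.union_eq_right.2 h, max_eq_right (Finset.card_le_card h)]
  · rw [Finset.union_eq_left.2 h, max_eq_left (Finset.card_le_card h)]

/-- If a class crosses the cut inside the join of `M₁` and `M₂` and meets both of them, then its
part on one side of the cut lies in `M₁`, and its part on the other side lies in `M₂`. The
hypothesis `hP` says that `P` is one of the two sides. -/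
theorem crossingClasses_comm (hc : (H.seidelSwitch S).IsGreedy c)
    (hM : ∀ x ∈ M₁, ∀ y ∈ M₂, H.Adj x y) (hP : ∀ x y, (x ∈ S ↔ y ∈ S) ↔ (x ∈ P ↔ y ∈ P)) :
    crossingClasses S c K M₂ M₁ P = crossingClasses S c K M₁ M₂ Pᶜ := by
  have same : ∀ x y, x ∈ M₁ → y ∈ M₂ → (x ∈ P ↔ y ∈ P) → c x ≠ c y := fun x y hx hy hxy h =>
    hc.not_adj ((hP x y).2 hxy) h (hM x hx y hy)
  ext i
  rw [mem_crossingClasses, mem_crossingClasses, Set.union_comm]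
  refine and_congr_right fun _ => and_congr_right fun hin => ?_
  have hsides : (∃ x ∈ P, c x = i) ∧ ∃ x ∉ P, c x = i := by
    obtain ⟨⟨a, ha, hai⟩, ⟨b, hb, hbi⟩, -⟩ := hin
    have := hP a b
    by_cases haP : a ∈ P
    · exact ⟨⟨a, haP, hai⟩, b, by tauto, hbi⟩
    · exact ⟨⟨b, by tauto, hbi⟩, a, haP, hai⟩
  constructor
  · rintro ⟨h2, h1, x, hx, hxP, hxi⟩
    refine ⟨h1, h2, ?_⟩
    by_contra! hcon
    refine h2 ⟨hin.1, hin.2.1, fun z hz => (hin.2.2 z hz).resolve_left fun hz1 => ?_⟩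
    by_cases hzP : z ∈ P
    · exact same z x hz1 hx (by tauto) (hz.trans hxi.symm)
    · exact hcon z hz1 hzP hz
  · rintro ⟨h1, h2, x, hx, hxP, hxi⟩
    refine ⟨h2, h1, ?_⟩
    by_contra! hcon
    refine h1 ⟨hin.1, hin.2.1, fun z hz => (hin.2.2 z hz).resolve_right fun hz2 => ?_⟩
    by_cases hzP : z ∈ P
    · exact hcon z hz2 hzP hz
    · exact same x z hx hz2 (by simp only [Set.mem_compl_iff] at hxP; tauto) (hxi.trans hz.symm)

theorem card_reachingClasses_of_disjoint (hd : Disjoint M₁ M₂) :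
    (reachingClasses S c K M₁ P).card = Set.ncard {i | i ∈ reachingClasses S c K (M₁ ∪ M₂) P ∧
      ∃ x ∈ M₁, x ∈ P ∧ c x = i} + (crossingClasses S c K M₁ M₂ P).card := by
  classical
  have hset : {i | i ∈ reachingClasses S c K (M₁ ∪ M₂) P ∧ ∃ x ∈ M₁, x ∈ P ∧ c x = i} =
      ({i ∈ reachingClasses S c K (M₁ ∪ M₂) P | ∃ x ∈ M₁, x ∈ P ∧ c x = i} : Finset ℕ) := by
    ext; simp
  rw [hset, Set.ncard_coe_finset, ← Finset.card_union_of_disjoint]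
  · congr 1
    ext i
    simp only [Finset.mem_union, Finset.mem_filter, mem_reachingClasses, mem_crossingClasses]
    constructor
    · rintro ⟨hi, h, x, hx, hxP, hxi⟩
      by_cases hin : ClassInside S c (M₁ ∪ M₂) i
      · exact Or.inr ⟨hi, hin, h, fun h' => h'.not_of_disjoint hd.symm hx hxi, x, hx, hxP, hxi⟩
      · exact Or.inl ⟨⟨hi, hin, x, Or.inl hx, hxP, hxi⟩, x, hx, hxP, hxi⟩
    · rintro (⟨⟨hi, hin, -⟩, h⟩ | ⟨hi, -, h1, -, h⟩)
      · exact ⟨hi, fun h' => hin (h'.mono Set.subset_union_left), h⟩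
      · exact ⟨hi, h1, h⟩
  · refine Finset.disjoint_left.2 fun i h1 h2 => ?_
    exact (mem_reachingClasses.1 (Finset.mem_filter.1 h1).1).2.1 (mem_crossingClasses.1 h2).2.1

theorem card_reachingClasses_join (hc : (H.seidelSwitch S).IsGreedy c) (hd : Disjoint M₁ M₂)
    (hM : ∀ x ∈ M₁, ∀ y ∈ M₂, H.Adj x y) (hP : ∀ x y, (x ∈ S ↔ y ∈ S) ↔ (x ∈ P ↔ y ∈ P)) :
    (reachingClasses S c K (M₁ ∪ M₂) P).card + (crossingClasses S c K M₁ M₂ P).card +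
      (crossingClasses S c K M₁ M₂ Pᶜ).card =
      (reachingClasses S c K M₁ P).card + (reachingClasses S c K M₂ P).card := by
  classical
  rw [card_reachingClasses_of_disjoint hd, card_reachingClasses_of_disjoint hd.symm,
    crossingClasses_comm hc hM hP, Set.union_comm M₂ M₁]
  have : (reachingClasses S c K (M₁ ∪ M₂) P).card =
      Set.ncard {i | i ∈ reachingClasses S c K (M₁ ∪ M₂) P ∧ ∃ x ∈ M₁, x ∈ P ∧ c x = i} +
      Set.ncard {i | i ∈ reachingClasses S c K (M₁ ∪ M₂) P ∧ ∃ x ∈ M₂, x ∈ P ∧ c x = i} := by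
    rw [← Set.ncard_union_eq, ← Set.ncard_coe_finset]
    · congr 1
      ext i
      simp only [Finset.mem_coe, Set.mem_union, Set.mem_ofPred_eq, ← and_or_left]
      refine (and_iff_left_of_imp fun hi => ?_).symm
      obtain ⟨-, -, x, hx | hx, h⟩ := mem_reachingClasses.1 hi
      · exact Or.inl ⟨x, hx, h⟩
      · exact Or.inr ⟨x, hx, h⟩
    · refine Set.disjoint_left.2 ?_
      rintro i ⟨-, x, hx, hxP, hxi⟩ ⟨-, y, hy, hyP, hyi⟩
      exact hc.not_adj ((hP x y).2 (by tauto)) (hxi.trans hyi.symm) (hM x hx y hy)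
  omega

theorem card_insideClasses_join (hc : (H.seidelSwitch S).IsGreedy c) (hd : Disjoint M₁ M₂)
    (hM : ∀ x ∈ M₁, ∀ y ∈ M₂, H.Adj x y) :
    (insideClasses S c K (M₁ ∪ M₂)).card = (insideClasses S c K M₁).card +
      (insideClasses S c K M₂).card + (crossingClasses S c K M₁ M₂ S).card +
      (crossingClasses S c K M₁ M₂ Sᶜ).card := by
  classical
  rw [← Finset.card_union_of_disjoint (disjoint_insideClasses hd), ← Finset.card_union_of_disjoint,
    ← Finset.card_union_of_disjoint]
  · congr 1
    ext i
    simp only [Finset.mem_union, mem_insideClasses, mem_crossingClasses]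
    constructor
    · rintro ⟨hi, h⟩
      by_cases h1 : ClassInside S c M₁ i
      · exact Or.inl (Or.inl (Or.inl ⟨hi, h1⟩))
      by_cases h2 : ClassInside S c M₂ i
      · exact Or.inl (Or.inl (Or.inr ⟨hi, h2⟩))
      have h3 : ∃ x ∈ M₁, c x = i := by
        by_contra! hcon
        exact h2 ⟨h.1, h.2.1, fun x hx => (h.2.2 x hx).resolve_left fun hx1 => hcon x hx1 hx⟩
      obtain ⟨x, hx, hxi⟩ := h3
      by_cases hxS : x ∈ S
      · exact Or.inl (Or.inr ⟨hi, h, h1, h2, x, hx, hxS, hxi⟩)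
      · exact Or.inr ⟨hi, h, h1, h2, x, hx, hxS, hxi⟩
    · rintro (((⟨hi, h⟩ | ⟨hi, h⟩) | ⟨hi, h, -⟩) | ⟨hi, h, -⟩)
      · exact ⟨hi, h.mono Set.subset_union_left⟩
      · exact ⟨hi, h.mono Set.subset_union_right⟩
      · exact ⟨hi, h⟩
      · exact ⟨hi, h⟩
  · refine Finset.disjoint_left.2 fun i h1 h2 => ?_
    obtain ⟨-, hin, n1, n2, x, hx, hxS, hxi⟩ := mem_crossingClasses.1 h2
    simp only [Finset.mem_union, mem_insideClasses] at h1
    rcases h1 with (h1 | h1) | h1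
    · exact n1 h1.2
    · exact n2 h1.2
    · -- The part outside of `S` lies in `M₁`, so the part in `S` lies in `M₂`.
      have hcomm := crossingClasses_comm (K := K) hc hM (P := S) fun x y => Iff.rfl
      rw [← hcomm] at h2
      obtain ⟨-, -, -, -, y, hy, hyS, hyi⟩ := mem_crossingClasses.1 h2
      obtain ⟨-, -, -, -, z, hz, hzS, hzi⟩ := mem_crossingClasses.1 h1
      exact hc.not_adj (by simp [hyS, hzS]) (hzi.trans hyi.symm) (hM z hz y hy)
  · refine Finset.disjoint_left.2 fun i h1 h2 => ?_
    obtain ⟨-, -, n1, n2, -⟩ := mem_crossingClasses.1 h2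
    simp only [Finset.mem_union, mem_insideClasses] at h1
    tauto

theorem card_crossingClasses_le (hd : Disjoint M₁ M₂) :
    (crossingClasses S c K M₁ M₂ P).card ≤ (reachingClasses S c K M₁ P).card := by
  rw [card_reachingClasses_of_disjoint hd]; omega

end

/-! ### Tables -/

/-- The relation `T` lies between two extremes: its members `(s, t, g)` are the numbers of some
selection in `M`, and it contains the numbers of classes of every greedy colouring. -/
structure IsTable (H : SimpleGraph V) (S M : Set V) (T : ℕ → ℕ → ℕ → Prop) : Prop where
  sound : ∀ s t g, T s t g → H.Selectable S M s t g
  complete : ∀ (c : V → ℕ) (K : ℕ), (H.seidelSwitch S).IsGreedy c →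
    T (reachingClasses S c K M S).card (reachingClasses S c K M Sᶜ).card
      (insideClasses S c K M).card

/-- The table of a single vertex; `b` tells whether it belongs to the cut. -/
def leafTable (b : Prop) (s t g : ℕ) : Prop :=
  g = 0 ∧ (s = 0 ∧ t = 0 ∨ b ∧ s = 1 ∧ t = 0 ∨ ¬ b ∧ s = 0 ∧ t = 1)

/-- The table of the disjoint union of two graphs. -/
def unionTable (T₁ T₂ : ℕ → ℕ → ℕ → Prop) (s t g : ℕ) : Prop :=
  ∃ s₁ t₁ g₁ s₂ t₂ g₂, T₁ s₁ t₁ g₁ ∧ T₂ s₂ t₂ g₂ ∧ s = max s₁ s₂ ∧ t = max t₁ t₂ ∧ g = g₁ + g₂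

/-- The table of the join of two graphs: `m₁` new pairs have their end in `S` in the first graph,
and `m₂` new pairs have it in the second graph. -/
def joinTable (T₁ T₂ : ℕ → ℕ → ℕ → Prop) (s t g : ℕ) : Prop :=
  ∃ s₁ t₁ g₁ s₂ t₂ g₂ m₁ m₂, T₁ s₁ t₁ g₁ ∧ T₂ s₂ t₂ g₂ ∧ m₁ ≤ s₁ ∧ m₁ ≤ t₂ ∧ m₂ ≤ s₂ ∧ m₂ ≤ t₁ ∧
    s + m₁ + m₂ = s₁ + s₂ ∧ t + m₁ + m₂ = t₁ + t₂ ∧ g = g₁ + g₂ + m₁ + m₂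

section

variable {H : SimpleGraph V} {S M₁ M₂ : Set V} {T₁ T₂ : ℕ → ℕ → ℕ → Prop}

theorem isTable_leaf (H : SimpleGraph V) (S : Set V) (v : V) :
    H.IsTable S {v} (leafTable (v ∈ S)) where
  sound := by
    rintro s t g ⟨rfl, ⟨rfl, rfl⟩ | ⟨hv, rfl, rfl⟩ | ⟨hv, rfl, rfl⟩⟩
    · exact selectable_zero H S _
    · exact selectable_of_mem H hv
    · exact selectable_of_notMem H hv
  complete c K hc := by
    have hin : ∀ i, ¬ ClassInside S c {v} i := by
      rintro i ⟨⟨a, ha, hai⟩, ⟨b, hb, hbi⟩, h⟩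
      have h1 := h a hai
      have h2 := h b hbi
      rw [Set.mem_singleton_iff] at h1 h2
      exact hb (h2 ▸ h1 ▸ ha)
    have h0 : insideClasses S c K {v} = ∅ :=
      Finset.eq_empty_of_forall_notMem fun i hi => hin i (mem_insideClasses.1 hi).2
    have h1 : ∀ P : Set V, v ∉ P → reachingClasses S c K {v} P = ∅ := by
      refine fun P hv => Finset.eq_empty_of_forall_notMem fun i hi => ?_
      obtain ⟨-, -, x, rfl, hx, -⟩ := mem_reachingClasses.1 hi
      exact hv hx
    have h2 : ∀ P : Set V, (reachingClasses S c K {v} P).card = 0 ∨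
        (reachingClasses S c K {v} P).card = 1 := by
      intro P
      have : (reachingClasses S c K {v} P).card ≤ ({c v} : Finset ℕ).card := by
        refine Finset.card_le_card fun i hi => ?_
        obtain ⟨-, -, x, rfl, -, hx⟩ := mem_reachingClasses.1 hi
        simp [hx]
      rw [Finset.card_singleton] at this
      omega
    rw [h0]
    refine ⟨rfl, ?_⟩
    by_cases hv : v ∈ S
    · rw [h1 Sᶜ (by simpa using hv)]
      have := h2 S
      simp only [Finset.card_empty, and_true, hv, true_and, not_true, false_and, or_false]
      exact this
    · rw [h1 S hv]
      have := h2 Sᶜ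
      simp only [Finset.card_empty, true_and, hv, false_and, not_false_eq_true, false_or]
      exact this

theorem IsTable.union (h₁ : H.IsTable S M₁ T₁) (h₂ : H.IsTable S M₂ T₂) (hd : Disjoint M₁ M₂)
    (hM : ∀ x ∈ M₁, ∀ y ∈ M₂, ¬ H.Adj x y) (hmod : H.IsModule (M₁ ∪ M₂)) :
    H.IsTable S (M₁ ∪ M₂) (unionTable T₁ T₂) where
  sound := by
    rintro s t g ⟨s₁, t₁, g₁, s₂, t₂, g₂, hT₁, hT₂, rfl, rfl, rfl⟩
    exact (h₁.sound _ _ _ hT₁).union (h₂.sound _ _ _ hT₂) hM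
  complete c K hc := by
    refine ⟨_, _, _, _, _, _, h₁.complete c K hc, h₂.complete c K hc, ?_, ?_, ?_⟩
    · exact card_reachingClasses_union hc hd hM hmod fun x hx y => by simp [hx]
    · refine card_reachingClasses_union hc hd hM hmod fun x hx y => ?_
      simp only [Set.mem_compl_iff] at hx ⊢
      simp [hx]
    · rw [(reachingClasses_union (P := S) hc hd hM).2,
        Finset.card_union_of_disjoint (disjoint_insideClasses hd)]

theorem IsTable.join (h₁ : H.IsTable S M₁ T₁) (h₂ : H.IsTable S M₂ T₂) (hd : Disjoint M₁ M₂)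
    (hM : ∀ x ∈ M₁, ∀ y ∈ M₂, H.Adj x y) : H.IsTable S (M₁ ∪ M₂) (joinTable T₁ T₂) where
  sound := by
    rintro s t g ⟨s₁, t₁, g₁, s₂, t₂, g₂, m₁, m₂, hT₁, hT₂, e1, e2, e3, e4, hs, ht, rfl⟩
    exact (h₁.sound _ _ _ hT₁).join (h₂.sound _ _ _ hT₂) hd hM e1 e2 e3 e4 hs ht
  complete c K hc := by
    have hS : ∀ x y, (x ∈ S ↔ y ∈ S) ↔ (x ∈ S ↔ y ∈ S) := fun x y => Iff.rfl
    have hS' : ∀ x y, (x ∈ S ↔ y ∈ S) ↔ (x ∈ Sᶜ ↔ y ∈ Sᶜ) := fun x y => by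
      simp only [Set.mem_compl_iff]; tauto
    have c1 := crossingClasses_comm (K := K) hc hM hS
    have c2 := crossingClasses_comm (K := K) hc hM hS'
    have j2 := card_reachingClasses_join (K := K) hc hd hM hS'
    rw [compl_compl] at c2 j2
    refine ⟨_, _, _, _, _, _, (crossingClasses S c K M₁ M₂ S).card,
      (crossingClasses S c K M₁ M₂ Sᶜ).card, h₁.complete c K hc, h₂.complete c K hc,
      card_crossingClasses_le hd, ?_, ?_, card_crossingClasses_le hd,
      card_reachingClasses_join hc hd hM hS, by omega, card_insideClasses_join hc hd hM⟩
    · rw [← c2]; exact card_crossingClasses_le hd.symm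
    · rw [← c1]; exact card_crossingClasses_le hd.symm

end

/-- In a greedy colouring, take a vertex `v` of the last class, and switch with respect to its
neighbourhood `S`. Then every earlier class meets `S`, so that it either crosses the cut or lies in
`S`. -/
theorem exists_add_eq_grundyNumber [Finite V] [Nonempty V] (G : SimpleGraph V) :
    ∃ v : V, ∀ T : ℕ → ℕ → ℕ → Prop,
      (G.seidelSwitch (G.neighborSet v)).IsTable (G.neighborSet v) Set.univ T →
        ∃ s t g, T s t g ∧ s + g + 1 = G.grundyNumber := by
  classical
  obtain ⟨c, v, hc, hv⟩ := exists_isGreedy_of_nonempty G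
  refine ⟨v, fun T hT => ⟨_, _, _, hT.complete c (c v) ?_, ?_⟩⟩
  · rw [seidelSwitch_seidelSwitch, symmDiff_self]
    convert hc
    ext x y
    exact seidelSwitch_adj_of_same (by simp)
  · rw [← hv, Nat.succ_inj, ← Finset.card_union_of_disjoint]
    · conv_rhs => rw [← Finset.card_range (c v)]
      congr 1
      ext i
      rw [Finset.mem_union, mem_reachingClasses, mem_insideClasses, Finset.mem_range]
      constructor
      · rintro (h | h) <;> exact h.1
      · intro hi
        by_cases h : ClassInside (G.neighborSet v) c Set.univ i
        · exact Or.inr ⟨hi, h⟩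
        · obtain ⟨x, hvx, hx⟩ := hc.hits v i hi
          exact Or.inl ⟨hi, h, x, trivial, hvx, hx⟩
    · exact Finset.disjoint_left.2 fun i h1 h2 =>
        (mem_reachingClasses.1 h1).2.1 (mem_insideClasses.1 h2).2

end SimpleGraph

namespace RAM

/-! ### A language of bounded loops -/

/-- The state with a new value of one variable. -/
def State.setVar (s : State) (x v : ℕ) : State :=
  { s with var := Function.update s.var x v }

/-- The state with a new value in one cell of an array. -/
def State.setArr (s : State) (a i v : ℕ) : State :=
  { s with arr := Function.update s.arr a (Function.update (s.arr a) i v) }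

@[simp] theorem State.setVar_var (s : State) (x v : ℕ) :
    (s.setVar x v).var = Function.update s.var x v := rfl

@[simp] theorem State.setVar_arr (s : State) (x v : ℕ) : (s.setVar x v).arr = s.arr := rfl

@[simp] theorem State.setArr_var (s : State) (a i v : ℕ) : (s.setArr a i v).var = s.var := rfl

@[simp] theorem State.setArr_arr (s : State) (a i v : ℕ) : (s.setArr a i v).arr =
    Function.update s.arr a (Function.update (s.arr a) i v) := rfl

/-- Commands in which the only loop is `loop x P`: the variable `x` counts from `0` up to the value
of the variable `1`, and `P` is executed for each value below it. -/
inductive Cmd where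
  | skip
  | assign (x : ℕ) (e : Expr)
  | write (a : ℕ) (i e : Expr)
  | seq (P Q : Cmd)
  | ite (e : Expr) (P Q : Cmd)
  | loop (x : ℕ) (P : Cmd)

/-- The program that carries out a command. -/
def Cmd.compile : Cmd → Program
  | skip => .skip
  | assign x e => .assign x e
  | write a i e => .write a i e
  | seq P Q => .seq P.compile Q.compile
  | ite e P Q => .ite e P.compile Q.compile
  | loop x P => .seq (.assign x (.lit 0)) (.while (.sub (.var 1) (.var x))
      (.seq P.compile (.assign x (.add (.var x) (.lit 1)))))

/-- The state after `i` rounds of a loop with the loop variable `x` and the body `f`. -/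
def loopState (f : State → State) (x : ℕ) (s : State) : ℕ → State
  | 0 => s.setVar x 0
  | i + 1 => (f (loopState f x s i)).setVar x (i + 1)

/-- The effect of a command. -/
def Cmd.run : Cmd → State → State
  | skip, s => s
  | assign x e, s => s.setVar x (e.eval s)
  | write a i e, s => s.setArr a (i.eval s) (e.eval s)
  | seq P Q, s => Q.run (P.run s)
  | ite e P Q, s => if e.eval s ≠ 0 then P.run s else Q.run s
  | loop x P, s => loopState P.run x s (s.var 1)

/-- The variables that a command may change. -/
def Cmd.vars : Cmd → List ℕ
  | skip => []
  | assign x _ => [x]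
  | write _ _ _ => []
  | seq P Q => P.vars ++ Q.vars
  | ite _ P Q => P.vars ++ Q.vars
  | loop x P => x :: P.vars

/-- The arrays that a command may change. -/
def Cmd.arrs : Cmd → List ℕ
  | skip => []
  | assign _ _ => []
  | write a _ _ => [a]
  | seq P Q => P.arrs ++ Q.arrs
  | ite _ P Q => P.arrs ++ Q.arrs
  | loop _ P => P.arrs

/-- No loop changes its own loop variable, or the bound of the loops. -/
def Cmd.WellFormed : Cmd → Prop
  | skip => True
  | assign _ _ => True
  | write _ _ _ => True
  | seq P Q => P.WellFormed ∧ Q.WellFormed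
  | ite _ P Q => P.WellFormed ∧ Q.WellFormed
  | loop x P => x ≠ 1 ∧ x ∉ P.vars ∧ 1 ∉ P.vars ∧ P.WellFormed

/-- A bound for the running time, in terms of the value of the variable `1`. -/
noncomputable def Cmd.time : Cmd → Polynomial ℕ
  | skip => 1
  | assign _ e => .C (e.cost + 1)
  | write _ i e => .C (i.cost + e.cost + 1)
  | seq P Q => P.time + Q.time
  | ite e P Q => .C (e.cost + 1) + (P.time + Q.time)
  | loop _ P => .X * (P.time + .C 8) + .C 6

theorem Cmd.run_var_of_notMem {y : ℕ} : ∀ (P : Cmd) (s : State), y ∉ P.vars →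
    (P.run s).var y = s.var y
  | skip, s, _ => rfl
  | assign x e, s, h => by
    have : y ≠ x := by simpa [vars] using h
    simp [run, this]
  | write a i e, s, _ => rfl
  | seq P Q, s, h => by
    simp only [vars, List.mem_append, not_or] at h
    rw [run, run_var_of_notMem Q _ h.2, run_var_of_notMem P _ h.1]
  | ite e P Q, s, h => by
    simp only [vars, List.mem_append, not_or] at h
    rw [run]
    split
    · exact run_var_of_notMem P _ h.1
    · exact run_var_of_notMem Q _ h.2
  | loop x P, s, h => by
    simp only [vars, List.mem_cons, not_or] at h
    rw [run]
    induction s.var 1 with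
    | zero => simp [loopState, h.1]
    | succ i ih => simp [loopState, h.1, run_var_of_notMem P _ h.2, ih]

theorem Cmd.run_arr_of_notMem {a : ℕ} : ∀ (P : Cmd) (s : State), a ∉ P.arrs →
    (P.run s).arr a = s.arr a
  | skip, s, _ => rfl
  | assign x e, s, _ => rfl
  | write b i e, s, h => by
    have : a ≠ b := by simpa [arrs] using h
    simp [run, this]
  | seq P Q, s, h => by
    simp only [arrs, List.mem_append, not_or] at h
    rw [run, run_arr_of_notMem Q _ h.2, run_arr_of_notMem P _ h.1]
  | ite e P Q, s, h => by
    simp only [arrs, List.mem_append, not_or] at h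
    rw [run]
    split
    · exact run_arr_of_notMem P _ h.1
    · exact run_arr_of_notMem Q _ h.2
  | loop x P, s, h => by
    rw [run]
    induction s.var 1 with
    | zero => simp [loopState]
    | succ i ih => simp [loopState, run_arr_of_notMem P _ h, ih]

theorem loopState_var {P : Cmd} {x : ℕ} (hx : x ≠ 1) (h1 : 1 ∉ P.vars) (s : State) (i : ℕ) :
    (loopState P.run x s i).var x = i ∧ (loopState P.run x s i).var 1 = s.var 1 := by
  induction i with
  | zero => simp [loopState, hx.symm]
  | succ i ih => simp [loopState, hx.symm, P.run_var_of_notMem _ h1, ih.2]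

/-- The compiled program has the effect of the command, within the time bound. -/
theorem Cmd.runs_compile : ∀ (P : Cmd), P.WellFormed → 1 ∉ P.vars → ∀ (s : State),
    ∃ t ≤ P.time.eval (s.var 1), Runs P.compile s t (P.run s)
  | skip, _, _, s => ⟨1, by simp [time], .skip s⟩
  | assign x e, _, _, s => ⟨e.cost + 1, by simp [time], .assign x e s⟩
  | write a i e, _, _, s => ⟨i.cost + e.cost + 1, by simp [time], .write a i e s⟩
  | seq P Q, h, h1, s => by
    simp only [vars, List.mem_append, not_or] at h1
    obtain ⟨t, ht, hP⟩ := runs_compile P h.1 h1.1 s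
    obtain ⟨t', ht', hQ⟩ := runs_compile Q h.2 h1.2 (P.run s)
    rw [P.run_var_of_notMem _ h1.1] at ht'
    exact ⟨t + t', by simp only [time, Polynomial.eval_add]; omega, .seq hP hQ⟩
  | ite e P Q, h, h1, s => by
    simp only [vars, List.mem_append, not_or] at h1
    by_cases he : e.eval s = 0
    · obtain ⟨t, ht, hQ⟩ := runs_compile Q h.2 h1.2 s
      refine ⟨e.cost + 1 + t, by simp only [time, Polynomial.eval_add, Polynomial.eval_C]; omega, ?_⟩
      rw [run, if_neg (not_not.2 he)]
      exact .ite_false he hQ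
    · obtain ⟨t, ht, hP⟩ := runs_compile P h.1 h1.1 s
      refine ⟨e.cost + 1 + t, by simp only [time, Polynomial.eval_add, Polynomial.eval_C]; omega, ?_⟩
      rw [run, if_pos he]
      exact .ite_true he hP
  | loop x P, h, h1, s => by
    obtain ⟨hx, hxP, h1P, hP⟩ := h
    have hv := loopState_var hx h1P s
    have key : ∀ j i, i + j = s.var 1 → ∃ t ≤ j * (P.time.eval (s.var 1) + 8) + 4,
        Runs (.while (.sub (.var 1) (.var x)) (.seq P.compile (.assign x (.add (.var x) (.lit 1)))))
          (loopState P.run x s i) t (loopState P.run x s (s.var 1)) := by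
      intro j
      induction j with
      | zero =>
        intro i hi
        refine ⟨4, by omega, ?_⟩
        rw [← hi]
        exact .while_false (by simp [Expr.eval, hv, ← hi])
      | succ j ih =>
        intro i hi
        obtain ⟨t, ht, hrun⟩ := runs_compile P hP h1P (loopState P.run x s i)
        rw [(hv i).2] at ht
        obtain ⟨t', ht', hrest⟩ := ih (i + 1) (by omega)
        refine ⟨3 + 1 + (t + 4) + t', by rw [Nat.succ_mul]; omega, ?_⟩
        refine .while_true (by simp [Expr.eval, hv]; omega) (.seq hrun ?_) hrest
        have := Runs.assign x (.add (.var x) (.lit 1)) (P.run (loopState P.run x s i))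
        simp only [Expr.eval, P.run_var_of_notMem _ hxP, (hv i).1] at this
        exact this
    obtain ⟨t, ht, hw⟩ := key (s.var 1) 0 (by omega)
    refine ⟨2 + t, ?_, .seq (.assign x (.lit 0) s) hw⟩
    simp only [time, Polynomial.eval_add, Polynomial.eval_mul, Polynomial.eval_X,
      Polynomial.eval_C]
    omega

/-- An invariant of a loop holds at its end. -/
theorem Cmd.loop_induction {x : ℕ} {P : Cmd} {s : State} (Inv : ℕ → State → Prop)
    (zero : Inv 0 (s.setVar x 0))
    (succ : ∀ i < s.var 1, ∀ s' : State, s'.var x = i → Inv i s' →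
      Inv (i + 1) ((P.run s').setVar x (i + 1))) :
    Inv (s.var 1) ((loop x P).run s) := by
  have : ∀ i ≤ s.var 1, Inv i (loopState P.run x s i) := by
    intro i
    induction i with
    | zero => exact fun _ => zero
    | succ i ih =>
      intro hi
      refine succ i hi _ ?_ (ih (by omega))
      cases i <;> simp [loopState]
  exact this _ le_rfl

/-! ### Nested loops that mark cells of an array -/

/-- Nested loops. -/
def nest (xs : List ℕ) (b : Cmd) : Cmd :=
  xs.foldr Cmd.loop b

/-- Some assignment of numbers below `N` to the variables in `xs` satisfies the condition `Φ`. -/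
def ExistsBelow (N : ℕ) : List ℕ → ((ℕ → ℕ) → Prop) → (ℕ → ℕ) → Prop
  | [], Φ, f => Φ f
  | x :: xs, Φ, f => ∃ i < N, ExistsBelow N xs Φ (Function.update f x i)

theorem ExistsBelow.congr {N : ℕ} {Φ : (ℕ → ℕ) → Prop} : ∀ (xs : List ℕ) {f f' : ℕ → ℕ},
    (∀ z ∉ xs, f z = f' z) → (ExistsBelow N xs Φ f ↔ ExistsBelow N xs Φ f')
  | [], f, f', h => by
    rw [funext fun z => h z (by simp)]
  | x :: xs, f, f', h => by
    refine exists_congr fun i => and_congr_right fun _ => ExistsBelow.congr xs fun z hz => ?_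
    by_cases hzx : z = x
    · simp [hzx]
    · simp [hzx, h z (by simp [hzx, hz])]

/-- If the body of nested loops marks the cells `k` with `Φ f k`, where `f` are the current
values of the variables, then the loops mark the cells `k` for which `Φ f k` holds for some values
of the loop variables. -/
theorem nest_run {a N : ℕ} {b : Cmd} {Φ : ℕ → (ℕ → ℕ) → Prop} : ∀ (xs : List ℕ), xs.Nodup →
    ∀ (Good : State → Prop), (∀ s, Good s → s.var 1 = N) →
    (∀ s, ∀ x ∈ xs, ∀ v, Good s → Good (s.setVar x v)) →
    (∀ s, Good s → (∀ x ∈ xs, s.var x < N) → Good (b.run s) ∧ (b.run s).var = s.var ∧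
      ∀ k, (b.run s).arr a k ≠ 0 ↔ s.arr a k ≠ 0 ∨ Φ k s.var) →
    ∀ s, Good s → Good ((nest xs b).run s) ∧ (∀ z ∉ xs, ((nest xs b).run s).var z = s.var z) ∧
      ∀ k, ((nest xs b).run s).arr a k ≠ 0 ↔ s.arr a k ≠ 0 ∨ ExistsBelow N xs (Φ k) s.var
  | [], _, Good, _, _, hb, s, hs => by
    obtain ⟨h1, h2, h3⟩ := hb s hs (by simp)
    exact ⟨h1, fun z _ => congrFun h2 z, h3⟩
  | x :: xs, hx, Good, hN, hset, hb, s, hs => by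
    rw [List.nodup_cons] at hx
    have ih := nest_run (a := a) (N := N) (b := b) (Φ := Φ) xs hx.2
      (fun s => Good s ∧ s.var x < N) (fun s h => hN s h.1)
      (fun s y hy v h => ⟨hset s y (List.mem_cons_of_mem _ hy) v h.1, by
        have : x ≠ y := by rintro rfl; exact hx.1 hy
        simpa [this] using h.2⟩)
      (fun s h hlt => by
        obtain ⟨h1, h2, h3⟩ := hb s h.1 (by simpa using ⟨h.2, hlt⟩)
        exact ⟨⟨h1, by rw [h2]; exact h.2⟩, h2, h3⟩)
    have main := Cmd.loop_induction (x := x) (P := nest xs b) (s := s)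
      (fun i s' => Good s' ∧ (∀ z ∉ x :: xs, s'.var z = s.var z) ∧
        ∀ k, s'.arr a k ≠ 0 ↔ s.arr a k ≠ 0 ∨
          ∃ j < i, ExistsBelow N xs (Φ k) (Function.update s.var x j))
      ⟨hset s x (by simp) 0 hs, fun z hz => by
        have : z ≠ x := by rintro rfl; simp at hz
        simp [this], fun k => by simp⟩
      (fun i hi s' hsx ⟨h1, h2, h3⟩ => by
        obtain ⟨⟨i1, -⟩, i2, i3⟩ := ih s' ⟨h1, by rw [hsx, ← hN s hs]; exact hi⟩
        refine ⟨hset _ x (by simp) _ i1, fun z hz => ?_, fun k => ?_⟩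
        · have hzx : z ≠ x := by rintro rfl; simp at hz
          have hzxs : z ∉ xs := fun h => hz (List.mem_cons_of_mem _ h)
          simp only [State.setVar_var, Function.update_of_ne hzx, i2 z hzxs, h2 z hz]
        · have hcongr : ExistsBelow N xs (Φ k) s'.var ↔
              ExistsBelow N xs (Φ k) (Function.update s.var x i) := by
            refine ExistsBelow.congr xs fun z hz => ?_
            by_cases hzx : z = x
            · simp [hzx, hsx]
            · simp [hzx, h2 z (by simp [hzx, hz])]
          rw [State.setVar_arr, i3 k, h3 k, hcongr, or_assoc]
          refine or_congr_right ⟨?_, ?_⟩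
          · rintro (⟨j, hj, h⟩ | h)
            · exact ⟨j, by omega, h⟩
            · exact ⟨i, by omega, h⟩
          · rintro ⟨j, hj, h⟩
            rcases Nat.lt_succ_iff_lt_or_eq.1 hj with hj | rfl
            · exact Or.inl ⟨j, hj, h⟩
            · exact Or.inr h)
    rw [hN s hs] at main
    exact main

/-- The states `s` and `s'` agree, except for the variables in `xs` and the part from `q` on of the
array `a`. -/
structure Agree (xs : List ℕ) (a q : ℕ) (s s' : State) : Prop where
  var : ∀ z ∉ xs, s'.var z = s.var z
  arr : ∀ b, b ≠ a → s'.arr b = s.arr b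
  low : ∀ k < q, s'.arr a k = s.arr a k

/-- Nested loops that write `1` into the cells `i` of the array `a` for which a test `e` succeeds,
if these cells are beyond the part of the array that matters for the test. -/
theorem nest_write_run {a q : ℕ} {e i : Expr} {xs : List ℕ} {C : (ℕ → ℕ) → Prop}
    {A : (ℕ → ℕ) → ℕ} (s : State) (hxs : xs.Nodup) (h1 : 1 ∉ xs)
    (h : ∀ s', Agree xs a q s s' → (∀ x ∈ xs, s'.var x < s.var 1) →
      (e.eval s' ≠ 0 ↔ C s'.var) ∧ (C s'.var → i.eval s' = A s'.var ∧ q ≤ A s'.var)) :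
    Agree xs a q s ((nest xs (.ite e (.write a i (.lit 1)) .skip)).run s) ∧
      ∀ k, ((nest xs (.ite e (.write a i (.lit 1)) .skip)).run s).arr a k ≠ 0 ↔
        s.arr a k ≠ 0 ∨ ExistsBelow (s.var 1) xs (fun f => C f ∧ k = A f) s.var := by
  have := nest_run (a := a) (N := s.var 1) (b := .ite e (.write a i (.lit 1)) .skip)
    (Φ := fun k f => C f ∧ k = A f) xs hxs (Agree xs a q s) (fun s' hs' => hs'.var 1 h1)
    (fun s' x hx v hs' => ⟨fun z hz => by
      have : z ≠ x := by rintro rfl; exact hz hx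
      simp [this, hs'.var z hz], hs'.arr, hs'.low⟩)
    (fun s' hs' hlt => by
      obtain ⟨h2, h3⟩ := h s' hs' hlt
      by_cases hC : C s'.var
      · obtain ⟨h4, h5⟩ := h3 hC
        rw [Cmd.run, if_pos (h2.2 hC)]
        refine ⟨⟨hs'.var, fun b hb => ?_, fun k hk => ?_⟩, rfl, fun k => ?_⟩
        · simp [Cmd.run, hb, hs'.arr b hb]
        · have : k ≠ A s'.var := by omega
          simp [Cmd.run, h4, this, hs'.low k hk]
        · by_cases hk : k = A s'.var
          · simp [Cmd.run, h4, hk, hC, Expr.eval]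
          · simp [Cmd.run, h4, hk]
      · rw [Cmd.run, if_neg (fun h => hC (h2.1 h))]
        exact ⟨hs', rfl, fun k => by simp [Cmd.run, hC]⟩)
    s ⟨fun _ _ => rfl, fun _ _ => rfl, fun _ _ => rfl⟩
  exact ⟨this.1, this.2.2⟩

/-! ### Expressions -/

/-- Conjunction. -/
def Expr.and (a b : Expr) : Expr :=
  .sub (.lit 1) (.add (.sub (.lit 1) a) (.sub (.lit 1) b))

/-- The distance of two numbers, as a test for their being different. -/
def Expr.dist (a b : Expr) : Expr :=
  .add (.sub a b) (.sub b a)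

/-- The test `a ≤ b`. -/
def Expr.le (a b : Expr) : Expr :=
  .sub (.lit 1) (.sub a b)

/-- The maximum. -/
def Expr.max (a b : Expr) : Expr :=
  .add a (.sub b a)

theorem Expr.eval_and_ne_zero (a b : Expr) (s : State) :
    (a.and b).eval s ≠ 0 ↔ a.eval s ≠ 0 ∧ b.eval s ≠ 0 := by
  simp only [Expr.and, eval]; omega

theorem Expr.eval_dist_ne_zero (a b : Expr) (s : State) :
    (a.dist b).eval s ≠ 0 ↔ a.eval s ≠ b.eval s := by
  simp only [Expr.dist, eval]; omega

theorem Expr.eval_le_ne_zero (a b : Expr) (s : State) :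
    (a.le b).eval s ≠ 0 ↔ a.eval s ≤ b.eval s := by
  simp only [Expr.le, eval]; omega

theorem Expr.eval_max (a b : Expr) (s : State) :
    (a.max b).eval s = Max.max (a.eval s) (b.eval s) := by
  simp only [Expr.max, eval]; omega

open SimpleGraph

/-! ### The program -/

/-!
Here `n` is the number of vertices and `N = n + 1`. The variables are used as follows:
* `0`: `n`, in the end the result; `1`: `N`, the bound of all loops; `8`: `N ^ 2`; `9`: `N ^ 3`;
* `2`: the vertex `v`; `3`: the number of a round of merging; `4`, `5`, `6`: vertices;
* `7`: the first free address of the array `4`;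
* `10`, `19`: auxiliary; `11`, `12`, `13` and `14`, `15`, `16`: entries `(s, t, g)` of two tables;
  `17`, `18`: the numbers `m₁`, `m₂` of new pairs in a join.

The arrays are used as follows:
* `0`: the adjacency matrix; `1`, `2`, `3`: the multiples of `n`, of `N ^ 2` and of `N`;
* `4`: the tables, each of which occupies `N ^ 3` cells and is never overwritten;
* `5`: the marks of the representatives; `6`: the addresses of their tables;
* `7`: a flag in the cell `0`; `8`: marks at the numbers of colours that have been found.
-/

/-- The adjacency of the vertices in the variables `x` and `y`. Row `i` of the adjacency matrix
starts at the address `n * i`, which is kept in the array `1`. -/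
def adjExpr (x y : ℕ) : Expr :=
  .read 0 (.add (.read 1 (.var x)) (.var y))

/-- The adjacency of the vertices in the variables `x` and `y` after a switch with respect to the
neighbourhood of the vertex in the variable `2`. -/
def switchExpr (x y : ℕ) : Expr :=
  (adjExpr x y).dist ((adjExpr 2 x).dist (adjExpr 2 y))

/-- The address of the entry `(s, t, g)` of the table that starts at `p`. The arrays `2` and `3`
hold the multiples of `N ^ 2` and of `N`. -/
def cellExpr (p s t g : Expr) : Expr :=
  .add p (.add (.read 2 s) (.add (.read 3 t) g))

/-- The entry given by the variables `s`, `t`, `g` of the table of the vertex in the variable `x`.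
The array `4` holds all tables, the array `6` their starting addresses. -/
def entryExpr (x s t g : ℕ) : Expr :=
  .read 4 (cellExpr (.read 6 (.var x)) (.var s) (.var t) (.var g))

/-- Fill the array `a` with the multiples of the variable `x`. -/
def multiplesCmd (a x : ℕ) : Cmd :=
  .seq (.assign 10 (.lit 0))
    (.loop 19 (.seq (.write a (.var 19) (.var 10)) (.assign 10 (.add (.var 10) (.var x)))))

/-- Prepare the arrays `1`, `2`, `3` of multiples, and store `N ^ 2` and `N ^ 3` in the variables
`8` and `9`. -/
def setupCmd : Cmd :=
  .seq (multiplesCmd 1 0) (.seq (multiplesCmd 3 1) (.seq (.assign 8 (.var 10))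
    (.seq (multiplesCmd 2 8) (.assign 9 (.var 10)))))

/-- Close the table that starts at the address in the variable `7`, where the free part of the
array `4` begins. -/
def nextTableCmd : Cmd :=
  .assign 7 (.add (.var 7) (.var 9))

/-- Create the leaf table of the vertex in the variable `4`, and mark the vertex in the array `5` of
representatives. -/
def leafCmd : Cmd :=
  .seq (.write 5 (.var 4) (.lit 1)) (.seq (.write 6 (.var 4) (.var 7))
    (.seq (.write 4 (.var 7) (.lit 1))
      (.seq (.ite (adjExpr 2 4) (.write 4 (.add (.var 7) (.var 8)) (.lit 1))
        (.write 4 (.add (.var 7) (.var 1)) (.lit 1))) nextTableCmd)))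

/-- Create all leaf tables. -/
def leavesCmd : Cmd :=
  .loop 4 (.ite (.sub (.var 0) (.var 4)) leafCmd .skip)

/-- Mark the cell `0` of the array `7` if some third representative distinguishes the vertices in
the variables `4` and `5`. -/
def twinsCmd : Cmd :=
  .seq (.write 7 (.lit 0) (.lit 0)) (nest [6]
    (.ite ((Expr.read 5 (.var 6)).and
      ((((Expr.var 6).dist (.var 4)).and ((Expr.var 6).dist (.var 5))).and
        ((switchExpr 4 6).dist (switchExpr 5 6))))
      (.write 7 (.lit 0) (.lit 1)) .skip))

/-- Create the union of the tables of the vertices in the variables `4` and `5`. -/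
def unionCmd : Cmd :=
  nest [11, 12, 13, 14, 15, 16]
    (.ite ((entryExpr 4 11 12 13).and (entryExpr 5 14 15 16))
      (.write 4 (cellExpr (.var 7) ((Expr.var 11).max (.var 14)) ((Expr.var 12).max (.var 15))
        (.add (.var 13) (.var 16))) (.lit 1)) .skip)

/-- Create the join of the tables of the vertices in the variables `4` and `5`. -/
def joinCmd : Cmd :=
  nest [11, 12, 13, 14, 15, 16, 17, 18]
    (.ite (((entryExpr 4 11 12 13).and (entryExpr 5 14 15 16)).and
        ((((Expr.var 17).le (.var 11)).and ((Expr.var 17).le (.var 15))).and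
          (((Expr.var 18).le (.var 14)).and ((Expr.var 18).le (.var 12)))))
      (.write 4 (cellExpr (.var 7)
        (.sub (.add (.var 11) (.var 14)) (.add (.var 17) (.var 18)))
        (.sub (.add (.var 12) (.var 15)) (.add (.var 17) (.var 18)))
        (.add (.add (.var 13) (.var 16)) (.add (.var 17) (.var 18)))) (.lit 1)) .skip)

/-- Merge the module of the vertex in the variable `5` into that of the vertex in the variable
`4`. -/
def mergeCmd : Cmd :=
  .seq (.ite (switchExpr 4 5) joinCmd unionCmd) (.seq (.write 6 (.var 4) (.var 7))
    (.seq (.write 5 (.var 5) (.lit 0)) nextTableCmd))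

/-- Merge the vertices in the variables `4` and `5` if they are twins among the
representatives. -/
def tryMergeCmd : Cmd :=
  .ite (((Expr.read 5 (.var 4)).and (.read 5 (.var 5))).and ((Expr.var 4).dist (.var 5)))
    (.seq twinsCmd (.ite (.read 7 (.lit 0)) .skip mergeCmd)) .skip

/-- Merge until a single representative is left. -/
def reduceCmd : Cmd :=
  .loop 3 (.loop 4 (.loop 5 tryMergeCmd))

/-- Mark `s + g + 1` in the array `8` for all entries `(s, t, g)` of the tables of the
representatives. -/
def collectCmd : Cmd :=
  nest [4, 11, 12, 13] (.ite ((Expr.read 5 (.var 4)).and (entryExpr 4 11 12 13))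
    (.write 8 (.add (.add (.var 11) (.var 13)) (.lit 1)) (.lit 1)) .skip)

/-- Store the largest marked cell of the array `8` in the variable `0`. -/
def outputCmd : Cmd :=
  .loop 4 (.ite (.read 8 (.var 4)) (.assign 0 (.var 4)) .skip)

/-- The Grundy number, for the value `n + 1` of the variable `1`. The vertex in the variable `2`
is the one whose neighbourhood is switched. -/
def grundyCmd : Cmd :=
  .seq setupCmd (.seq (.loop 2 (.ite (.sub (.var 0) (.var 2))
    (.seq leavesCmd (.seq reduceCmd collectCmd)) .skip)) outputCmd)

theorem grundyCmd_wellFormed : grundyCmd.WellFormed ∧ 1 ∉ grundyCmd.vars := by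
  simp [grundyCmd, setupCmd, multiplesCmd, leavesCmd, leafCmd, nextTableCmd, reduceCmd, tryMergeCmd,
    twinsCmd, mergeCmd, joinCmd, unionCmd, collectCmd, outputCmd, nest, Cmd.WellFormed, Cmd.vars]

/-! ### Tables in memory -/

theorem mul_add_lt {a b A B : ℕ} (ha : a < A) (hb : b < B) : a * B + b < A * B := by
  calc a * B + b < a * B + B := by omega
    _ = (a + 1) * B := by ring
    _ ≤ A * B := Nat.mul_le_mul_right B ha

theorem mul_add_inj {a b a' b' B : ℕ} (hb : b < B) (hb' : b' < B)
    (h : a * B + b = a' * B + b') : a = a' ∧ b = b' := by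
  have key : ∀ c d : ℕ, d < B → (c * B + d) / B = c := fun c d hd => by
    rw [mul_comm, Nat.mul_add_div (by omega), Nat.div_eq_of_lt hd, add_zero]
  have ha : a = a' := by rw [← key a b hb, h, key a' b' hb']
  subst ha
  exact ⟨rfl, by omega⟩

/-- The position of the entry `(s, t, g)` in a table. -/
def cell (N s t g : ℕ) : ℕ :=
  s * (N * N) + (t * N + g)

theorem cell_lt {N s t g : ℕ} (hs : s < N) (ht : t < N) (hg : g < N) :
    cell N s t g < N * (N * N) :=
  mul_add_lt hs (mul_add_lt ht hg)

theorem cell_inj {N s t g s' t' g' : ℕ} (ht : t < N) (hg : g < N) (ht' : t' < N) (hg' : g' < N)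
    (h : cell N s t g = cell N s' t' g') : s = s' ∧ t = t' ∧ g = g' := by
  obtain ⟨h1, h2⟩ := mul_add_inj (mul_add_lt ht hg) (mul_add_lt ht' hg') h
  obtain ⟨h3, h4⟩ := mul_add_inj hg hg' h2
  exact ⟨h1, h3, h4⟩

/-- The table stored in `A` from the address `p` on. -/
def tableAt (A : ℕ → ℕ) (p N : ℕ) (s t g : ℕ) : Prop :=
  s < N ∧ t < N ∧ g < N ∧ A (p + cell N s t g) ≠ 0

theorem tableAt_congr {A A' : ℕ → ℕ} {p q N : ℕ} (hp : p + N * (N * N) ≤ q)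
    (h : ∀ k < q, A' k = A k) : tableAt A' p N = tableAt A p N := by
  funext s t g
  refine propext (and_congr_right fun hs => and_congr_right fun ht => and_congr_right fun hg => ?_)
  rw [h _ (by have := cell_lt hs ht hg; omega)]

/-! ### Invariants -/

section

variable {n : ℕ} {G : SimpleGraph (Fin n)} {v : Fin n}

open Classical in
/-- The constants of the program have been set up. -/
structure Env (G : SimpleGraph (Fin n)) (s : State) : Prop where
  var_zero : s.var 0 = n
  var_one : s.var 1 = n + 1
  sq : s.var 8 = (n + 1) * (n + 1)
  cube : s.var 9 = (n + 1) * ((n + 1) * (n + 1))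
  adj : ∀ i j : Fin n, s.arr 0 (s.arr 1 i + j) = if G.Adj i j then 1 else 0
  mul_sq : ∀ i < n + 1, s.arr 2 i = i * ((n + 1) * (n + 1))
  mul : ∀ i < n + 1, s.arr 3 i = i * (n + 1)

theorem Env.congr {s s' : State} (h : Env G s) (hv : ∀ z ∈ [0, 1, 8, 9], s'.var z = s.var z)
    (ha : ∀ a ∈ [0, 1, 2, 3], s'.arr a = s.arr a) : Env G s' := by
  have h0 := hv 0 (by simp)
  have h1 := hv 1 (by simp)
  have h8 := hv 8 (by simp)
  have h9 := hv 9 (by simp)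
  have a0 := ha 0 (by simp)
  have a1 := ha 1 (by simp)
  have a2 := ha 2 (by simp)
  have a3 := ha 3 (by simp)
  constructor
  · rw [h0, h.var_zero]
  · rw [h1, h.var_one]
  · rw [h8, h.sq]
  · rw [h9, h.cube]
  · rw [a0, a1]; exact h.adj
  · rw [a2]; exact h.mul_sq
  · rw [a3]; exact h.mul

theorem Env.setVar {s : State} (h : Env G s) {x : ℕ} (hx : x ∉ [0, 1, 8, 9]) (w : ℕ) :
    Env G (s.setVar x w) :=
  h.congr (fun z hz => by
    have : z ≠ x := by rintro rfl; exact hx hz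
    simp [this]) fun _ _ => rfl

theorem Env.run {s : State} (h : Env G s) (P : Cmd) (hv : ∀ z ∈ [0, 1, 8, 9], z ∉ P.vars)
    (ha : ∀ a ∈ [0, 1, 2, 3], a ∉ P.arrs) : Env G (P.run s) :=
  h.congr (fun z hz => P.run_var_of_notMem s (hv z hz)) fun a h' => P.run_arr_of_notMem s (ha a h')

open Classical in
theorem Env.eval_adjExpr {s : State} (h : Env G s) {x y : ℕ} {i j : Fin n} (hx : s.var x = i)
    (hy : s.var y = j) : (adjExpr x y).eval s = if G.Adj i j then 1 else 0 := by
  rw [← h.adj, ← hx, ← hy]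
  rfl

open Classical in
theorem Env.eval_switchExpr {s : State} (h : Env G s) (hv : s.var 2 = v) {x y : ℕ} {i j : Fin n}
    (hx : s.var x = i) (hy : s.var y = j) : (switchExpr x y).eval s =
      if (G.seidelSwitch (G.neighborSet v)).Adj i j then 1 else 0 := by
  simp only [switchExpr, Expr.dist, Expr.eval, h.eval_adjExpr hx hy, h.eval_adjExpr hv hx,
    h.eval_adjExpr hv hy, seidelSwitch, mem_neighborSet]
  by_cases h1 : G.Adj i j <;> by_cases h2 : G.Adj v i <;> by_cases h3 : G.Adj v j <;>
    simp [h1, h2, h3]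

theorem Env.eval_cellExpr {s : State} (h : Env G s) {p e₁ e₂ e₃ : Expr} (h₁ : e₁.eval s < n + 1)
    (h₂ : e₂.eval s < n + 1) : (cellExpr p e₁ e₂ e₃).eval s =
      p.eval s + cell (n + 1) (e₁.eval s) (e₂.eval s) (e₃.eval s) := by
  simp only [cellExpr, Expr.eval, h.mul_sq _ h₁, h.mul _ h₂, cell]

/-- The representatives. -/
def reps (n : ℕ) (s : State) : Finset (Fin n) :=
  {x | s.arr 5 x ≠ 0}

theorem mem_reps {s : State} {x : Fin n} : x ∈ reps n s ↔ s.arr 5 x ≠ 0 := by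
  simp [reps]

/-- The free part of the array `4` is empty, and only vertices are marked as representatives. -/
structure Clean (n : ℕ) (s : State) : Prop where
  fresh : ∀ k, s.var 7 ≤ k → s.arr 4 k = 0
  lt : ∀ k, s.arr 5 k ≠ 0 → k < n

/-- The vertex set is partitioned into the sets `M x`, one for each representative `x`. The
adjacency, in the switch, of vertices of different sets is that of their representatives, and the
memory holds a table for each of these sets. -/
structure Forest (G : SimpleGraph (Fin n)) (v : Fin n) (s : State) (M : Fin n → Set (Fin n)) :
    Prop extends Env G s, Clean n s where
  var_two : s.var 2 = v
  le : ∀ x ∈ reps n s, s.arr 6 x + (n + 1) * ((n + 1) * (n + 1)) ≤ s.var 7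
  table : ∀ x ∈ reps n s, (G.seidelSwitch (G.neighborSet v)).IsTable (G.neighborSet v) (M x)
    (tableAt (s.arr 4) (s.arr 6 x) (n + 1))
  mem : ∀ x ∈ reps n s, x ∈ M x
  disj : ∀ x ∈ reps n s, ∀ y ∈ reps n s, x ≠ y → Disjoint (M x) (M y)
  adj_iff : ∀ x ∈ reps n s, ∀ y ∈ reps n s, x ≠ y → ∀ a ∈ M x, ∀ b ∈ M y,
    ((G.seidelSwitch (G.neighborSet v)).Adj a b ↔ (G.seidelSwitch (G.neighborSet v)).Adj x y)
  cover : ∀ a, ∃ x ∈ reps n s, a ∈ M x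

theorem Clean.congr {s s' : State} (h : Clean n s) (h7 : s'.var 7 = s.var 7)
    (h4 : s'.arr 4 = s.arr 4) (h5 : s'.arr 5 = s.arr 5) : Clean n s' :=
  ⟨by rw [h7, h4]; exact h.fresh, by rw [h5]; exact h.lt⟩

theorem Forest.congr {s s' : State} {M : Fin n → Set (Fin n)} (h : Forest G v s M)
    (hv : ∀ z ∈ [0, 1, 8, 9, 2, 7], s'.var z = s.var z)
    (ha : ∀ a ∈ [0, 1, 2, 3, 4, 5, 6], s'.arr a = s.arr a) : Forest G v s' M := by
  have h2 := hv 2 (by simp)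
  have h7 := hv 7 (by simp)
  have a4 := ha 4 (by simp)
  have a5 := ha 5 (by simp)
  have a6 := ha 6 (by simp)
  have hr : reps n s' = reps n s := by ext x; rw [mem_reps, mem_reps, a5]
  refine ⟨h.toEnv.congr (fun z hz => hv z ?_) (fun a h' => ha a ?_), h.toClean.congr h7 a4 a5,
    ?_, ?_, ?_, ?_, ?_, ?_, ?_⟩
  · simp only [List.mem_cons, List.not_mem_nil] at hz ⊢; tauto
  · simp only [List.mem_cons, List.not_mem_nil] at h' ⊢; tauto
  · rw [h2, h.var_two]
  · rw [hr, a6, h7]; exact h.le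
  · rw [hr, a4, a6]; exact h.table
  · rw [hr]; exact h.mem
  · rw [hr]; exact h.disj
  · rw [hr]; exact h.adj_iff
  · rw [hr]; exact h.cover

theorem Forest.setVar {s : State} {M : Fin n → Set (Fin n)} (h : Forest G v s M) {x : ℕ}
    (hx : x ∉ [0, 1, 8, 9, 2, 7]) (w : ℕ) : Forest G v (s.setVar x w) M :=
  h.congr (fun z hz => by
    have : z ≠ x := by rintro rfl; exact hx hz
    simp [this]) fun _ _ => rfl

/-- The entries of a table are at most the number of vertices. -/
theorem lt_of_isTable {M : Set (Fin n)} {T : ℕ → ℕ → ℕ → Prop}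
    (h : (G.seidelSwitch (G.neighborSet v)).IsTable (G.neighborSet v) M T) {s t g : ℕ}
    (hT : T s t g) : s < n + 1 ∧ t < n + 1 ∧ g < n + 1 := by
  have h1 := (h.sound s t g hT).right_le_card
  have h2 := (h.sound s t g hT).add_le_grundyNumber
  have h3 := G.grundyNumber_le_card
  rw [Fintype.card_fin] at h1 h3
  omega

/-! ### Creating and combining tables -/

theorem multiplesCmd_run (a x : ℕ) (hx : x ≠ 10) (hx' : x ≠ 19) (s : State) :
    ((multiplesCmd a x).run s).var 10 = s.var 1 * s.var x ∧
      ∀ i < s.var 1, ((multiplesCmd a x).run s).arr a i = i * s.var x := by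
  have := Cmd.loop_induction (x := 19)
    (P := .seq (.write a (.var 19) (.var 10)) (.assign 10 (.add (.var 10) (.var x))))
    (s := s.setVar 10 0) (fun i s' => s'.var x = s.var x ∧ s'.var 10 = i * s.var x ∧
      ∀ j < i, s'.arr a j = j * s.var x)
    ⟨by simp [hx, hx'], by simp, by simp⟩
    (fun i _ s' hi ⟨h1, h2, h3⟩ => by
      refine ⟨by simp [Cmd.run, hx, hx', h1], ?_, fun j hj => ?_⟩
      · simp [Cmd.run, Expr.eval, h1, h2]; ring
      · by_cases hji : j = i
        · simp [Cmd.run, Expr.eval, hi, hji, h2]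
        · simp [Cmd.run, Expr.eval, hi, hji, h3 j (by omega)])
  exact this.2

theorem setupCmd_run {s : State} (h0 : s.var 0 = n) (h1 : s.var 1 = n + 1)
    (hs : s.arr 0 = (graphInput G).arr 0) : Env G (setupCmd.run s) := by
  classical
  obtain ⟨-, m1⟩ := multiplesCmd_run 1 0 (by simp) (by simp) s
  have f1 : ∀ z, z ≠ 10 → z ≠ 19 → ((multiplesCmd 1 0).run s).var z = s.var z := fun z h h' =>
    Cmd.run_var_of_notMem _ _ (by simp [multiplesCmd, Cmd.vars, h, h'])
  have g1 : ∀ a, a ≠ 1 → ((multiplesCmd 1 0).run s).arr a = s.arr a := fun a h =>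
    Cmd.run_arr_of_notMem _ _ (by simp [multiplesCmd, Cmd.arrs, h])
  set s1 := (multiplesCmd 1 0).run s
  obtain ⟨k2, m2⟩ := multiplesCmd_run 3 1 (by simp) (by simp) s1
  have f2 : ∀ z, z ≠ 10 → z ≠ 19 → ((multiplesCmd 3 1).run s1).var z = s1.var z := fun z h h' =>
    Cmd.run_var_of_notMem _ _ (by simp [multiplesCmd, Cmd.vars, h, h'])
  have g2 : ∀ a, a ≠ 3 → ((multiplesCmd 3 1).run s1).arr a = s1.arr a := fun a h =>
    Cmd.run_arr_of_notMem _ _ (by simp [multiplesCmd, Cmd.arrs, h])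
  set s2 := (multiplesCmd 3 1).run s1
  obtain ⟨k3, m3⟩ := multiplesCmd_run 2 8 (by simp) (by simp) (s2.setVar 8 (s2.var 10))
  have f3 : ∀ z, z ≠ 10 → z ≠ 19 → ((multiplesCmd 2 8).run (s2.setVar 8 (s2.var 10))).var z =
      (s2.setVar 8 (s2.var 10)).var z := fun z h h' =>
    Cmd.run_var_of_notMem _ _ (by simp [multiplesCmd, Cmd.vars, h, h'])
  have g3 : ∀ a, a ≠ 2 → ((multiplesCmd 2 8).run (s2.setVar 8 (s2.var 10))).arr a = s2.arr a :=
    fun a h => Cmd.run_arr_of_notMem _ _ (by simp [multiplesCmd, Cmd.arrs, h])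
  have hrun : setupCmd.run s = ((multiplesCmd 2 8).run (s2.setVar 8 (s2.var 10))).setVar 9
      (((multiplesCmd 2 8).run (s2.setVar 8 (s2.var 10))).var 10) := rfl
  have e1 : s1.var 1 = n + 1 := by rw [f1 1 (by simp) (by simp), h1]
  have e2 : s2.var 1 = n + 1 := by rw [f2 1 (by simp) (by simp), e1]
  have e3 : s2.var 10 = (n + 1) * (n + 1) := by rw [k2, e1]
  rw [hrun]
  set s3 := (multiplesCmd 2 8).run (s2.setVar 8 (s2.var 10))
  constructor
  · simp [f3, f2, f1, h0]
  · simp [f3, f2, f1, h1]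
  · simp [f3, e3]
  · simp [k3, e2, e3]
  · intro i j
    have hi := m1 i (by have := i.2; omega)
    simp only [State.setVar_arr, g3 0 (by simp), g2 0 (by simp), g1 0 (by simp), g3 1 (by simp),
      g2 1 (by simp), hi, hs, h0, graphInput, true_and]
    refine if_congr ⟨?_, fun h => ⟨i, j, by ring, h⟩⟩ rfl rfl
    rintro ⟨i', j', he, h⟩
    rw [mul_comm n] at he
    obtain ⟨h3, h4⟩ := mul_add_inj j.2 j'.2 he
    rwa [Fin.ext h3, Fin.ext h4]
  · intro i hi
    have := m3 i (by simpa [e2] using hi)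
    simpa [e3] using this
  · intro i hi
    have := m2 i (by rwa [e1])
    simp only [State.setVar_arr, g3 3 (by simp), this, e1]

theorem leafCmd_run {s : State} (he : Env G s) (hc : Clean n s) (h2 : s.var 2 = v) {x : Fin n}
    (h4 : s.var 4 = x) : Clean n (leafCmd.run s) ∧
      (leafCmd.run s).var 7 = s.var 7 + (n + 1) * ((n + 1) * (n + 1)) ∧
      (∀ y : Fin n, y ≠ x → (leafCmd.run s).arr 5 y = s.arr 5 y ∧
        (leafCmd.run s).arr 6 y = s.arr 6 y) ∧
      (leafCmd.run s).arr 5 x ≠ 0 ∧ (leafCmd.run s).arr 6 x = s.var 7 ∧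
      (∀ k < s.var 7, (leafCmd.run s).arr 4 k = s.arr 4 k) ∧
      tableAt ((leafCmd.run s).arr 4) (s.var 7) (n + 1) = leafTable (G.Adj v x) := by
  classical
  have hn : 0 < n := x.pos
  -- The second entry of the leaf table is `(1, 0, 0)` or `(0, 1, 0)`.
  obtain ⟨c, hc1, hc2⟩ : ∃ c, c = (if G.Adj v x then (n + 1) * (n + 1) else n + 1) ∧
      leafCmd.run s = (((((s.setArr 5 x 1).setArr 6 x (s.var 7)).setArr 4 (s.var 7) 1).setArr 4
        (s.var 7 + c) 1).setVar 7 (s.var 7 + (n + 1) * ((n + 1) * (n + 1)))) := by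
    refine ⟨_, rfl, ?_⟩
    have hadj : (adjExpr 2 4).eval (((s.setArr 5 x 1).setArr 6 x (s.var 7)).setArr 4 (s.var 7) 1) =
        if G.Adj v x then 1 else 0 := by
      refine Env.eval_adjExpr (he.congr (by simp) fun a ha => ?_) (by simpa using h2)
        (by simpa using h4)
      simp only [List.mem_cons, List.not_mem_nil, or_false] at ha
      have h4 : a ≠ 4 := by omega
      have h5 : a ≠ 5 := by omega
      have h6 : a ≠ 6 := by omega
      simp [h4, h5, h6]
    by_cases h : G.Adj v x
    · simp only [h, if_true] at hadj
      simp [leafCmd, nextTableCmd, Cmd.run, Expr.eval, h4, hadj, h, he.cube, he.sq]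
    · simp only [h, if_false] at hadj
      simp [leafCmd, nextTableCmd, Cmd.run, Expr.eval, h4, hadj, h, he.cube, he.var_one]
  have hc0 : c = cell (n + 1) (if G.Adj v x then 1 else 0) (if G.Adj v x then 0 else 1) 0 := by
    rw [hc1]; split <;> simp [cell]
  have hlt : c < (n + 1) * ((n + 1) * (n + 1)) := by
    rw [hc0]; exact cell_lt (by split <;> omega) (by split <;> omega) (by omega)
  have hpos : 0 < (n + 1) * ((n + 1) * (n + 1)) := by positivity
  rw [hc2]
  refine ⟨⟨fun k hk => ?_, fun k hk => ?_⟩, by simp, fun y hy => ?_, by simp, by simp,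
    fun k hk => ?_, ?_⟩
  · have hk : s.var 7 + (n + 1) * ((n + 1) * (n + 1)) ≤ k := by simpa using hk
    have k1 : k ≠ s.var 7 := by omega
    have k2 : k ≠ s.var 7 + c := by omega
    simp [k1, k2, hc.fresh k (by omega)]
  · by_cases hkx : k = x
    · rw [hkx]; exact x.2
    · exact hc.lt k (by simpa [hkx] using hk)
  · have hy' : (y : ℕ) ≠ x := fun h => hy (Fin.ext h)
    simp [hy']
  · have k1 : k ≠ s.var 7 := by omega
    have k2 : k ≠ s.var 7 + c := by omega
    simp [k1, k2]
  · funext a b g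
    refine propext ?_
    simp only [tableAt, State.setVar_arr, State.setArr_arr, Function.update_self]
    have hval : ∀ k, Function.update (Function.update (s.arr 4) (s.var 7) 1) (s.var 7 + c) 1
        (s.var 7 + k) ≠ 0 ↔ k = 0 ∨ k = c := by
      intro k
      by_cases k1 : k = c
      · simp [k1]
      · by_cases k0 : k = 0
        · subst k0
          rw [add_zero, Function.update_of_ne (by omega)]
          simp
        · have k2 : s.var 7 + k ≠ s.var 7 + c := by omega
          have k3 : s.var 7 + k ≠ s.var 7 := by omega
          simp [k1, k0, hc.fresh]
    have h0 : (0 : ℕ) = cell (n + 1) 0 0 0 := by simp [cell]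
    simp only [Function.update_of_ne (show (4 : ℕ) ≠ 5 by omega),
      Function.update_of_ne (show (4 : ℕ) ≠ 6 by omega), hval]
    constructor
    · rintro ⟨ha, hb, hg, h | h⟩
      · rw [h0] at h
        obtain ⟨rfl, rfl, rfl⟩ := cell_inj hb hg (by omega) (by omega) h
        exact ⟨rfl, Or.inl ⟨rfl, rfl⟩⟩
      · rw [hc0] at h
        obtain ⟨rfl, rfl, rfl⟩ := cell_inj hb hg (by split <;> omega) (by omega) h
        by_cases hvx : G.Adj v x <;> simp [leafTable, hvx]
    · rintro ⟨rfl, ⟨rfl, rfl⟩ | ⟨h, rfl, rfl⟩ | ⟨h, rfl, rfl⟩⟩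
      · exact ⟨by omega, by omega, by omega, Or.inl h0.symm⟩
      · exact ⟨by omega, by omega, by omega, Or.inr (by simp [hc0, h])⟩
      · exact ⟨by omega, by omega, by omega, Or.inr (by simp [hc0, h])⟩

theorem leavesCmd_run {s : State} (he : Env G s) (hc : Clean n s) (h2 : s.var 2 = v) :
    ∃ M, Forest G v (leavesCmd.run s) M := by
  have := Cmd.loop_induction (x := 4) (P := .ite (.sub (.var 0) (.var 4)) leafCmd .skip) (s := s)
    (fun i s' => Env G s' ∧ Clean n s' ∧ s'.var 2 = v ∧ ∀ x : Fin n, x < i → s'.arr 5 x ≠ 0 ∧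
      s'.arr 6 x + (n + 1) * ((n + 1) * (n + 1)) ≤ s'.var 7 ∧
      tableAt (s'.arr 4) (s'.arr 6 x) (n + 1) = leafTable (G.Adj v x))
    ⟨he.setVar (by simp) 0, hc.congr (by simp) rfl rfl, by simpa using h2, by simp⟩
    (fun i _ s' hi ⟨i1, i2, i3, i4⟩ => by
      by_cases hin : i < n
      · have hrun : (Cmd.ite (.sub (.var 0) (.var 4)) leafCmd .skip).run s' = leafCmd.run s' := by
          have : (Expr.sub (.var 0) (.var 4)).eval s' ≠ 0 := by
            simp only [Expr.eval, i1.var_zero, hi]; omega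
          rw [Cmd.run, if_pos this]
        rw [hrun]
        obtain ⟨j1, j2, j3, j4, j5, j6, j7⟩ := leafCmd_run (x := ⟨i, hin⟩) i1 i2 i3 hi
        have k1 : Env G (leafCmd.run s') := i1.run _
          (by simp [leafCmd, nextTableCmd, Cmd.vars]) (by simp [leafCmd, nextTableCmd, Cmd.arrs])
        have k3 : (leafCmd.run s').var 2 = v := by
          rw [Cmd.run_var_of_notMem _ _ (by simp [leafCmd, nextTableCmd, Cmd.vars]), i3]
        refine ⟨k1.setVar (by simp) _, j1.congr (by simp) rfl rfl, by simpa using k3,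
          fun x hx => ?_⟩
        simp only [State.setVar_arr, State.setVar_var,
          Function.update_of_ne (show (7 : ℕ) ≠ 4 by omega), j2]
        by_cases hxi : x = ⟨i, hin⟩
        · subst hxi
          exact ⟨j4, by rw [j5], by rw [j5, j7]⟩
        · have hxi' : (x : ℕ) ≠ i := fun h => hxi (Fin.ext h)
          obtain ⟨l1, l2, l3⟩ := i4 x (by omega)
          obtain ⟨m1, m2⟩ := j3 x hxi
          exact ⟨by rwa [m1], by rw [m2]; omega, by rw [m2, tableAt_congr l2 j6, l3]⟩
      · have hrun : (Cmd.ite (.sub (.var 0) (.var 4)) leafCmd .skip).run s' = s' := by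
          have : (Expr.sub (.var 0) (.var 4)).eval s' = 0 := by
            simp only [Expr.eval, i1.var_zero, hi]; omega
          rw [Cmd.run, if_neg (not_not.2 this), Cmd.run]
        rw [hrun]
        exact ⟨i1.setVar (by simp) _, i2.congr (by simp) rfl rfl, by simpa using i3,
          fun x _ => i4 x (by omega)⟩)
  rw [he.var_one] at this
  obtain ⟨i1, i2, i3, i4⟩ := this
  have i5 : ∀ x : Fin n, _ := fun x => i4 x (by omega)
  refine ⟨fun x => {x}, i1, i2, i3, fun x _ => (i5 x).2.1, fun x _ => ?_, fun x _ => rfl,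
    fun x _ y _ hxy => by simpa using hxy, ?_, fun a => ⟨a, mem_reps.2 (i5 a).1, rfl⟩⟩
  · have := (i5 x).2.2
    rw [leavesCmd, this]
    exact isTable_leaf _ _ x
  · rintro x - y - - a rfl b rfl
    rfl

theorem twinsCmd_run {s : State} (he : Env G s) (hc : Clean n s) (h2 : s.var 2 = v) {x y : Fin n}
    (h4 : s.var 4 = x) (h5 : s.var 5 = y) :
    (∀ z, z ≠ 6 → (twinsCmd.run s).var z = s.var z) ∧
    (∀ b, b ≠ 7 → (twinsCmd.run s).arr b = s.arr b) ∧
    ((twinsCmd.run s).arr 7 0 ≠ 0 ↔ ∃ z ∈ reps n s, z ≠ x ∧ z ≠ y ∧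
      ¬ ((G.seidelSwitch (G.neighborSet v)).Adj x z ↔
        (G.seidelSwitch (G.neighborSet v)).Adj y z)) := by
  classical
  let C : (ℕ → ℕ) → Prop := fun f => ∃ z : Fin n, f 6 = z ∧ z ∈ reps n s ∧ z ≠ x ∧ z ≠ y ∧
    ¬ ((G.seidelSwitch (G.neighborSet v)).Adj x z ↔ (G.seidelSwitch (G.neighborSet v)).Adj y z)
  have := nest_write_run (a := 7) (q := 0)
    (e := (Expr.read 5 (.var 6)).and
      ((((Expr.var 6).dist (.var 4)).and ((Expr.var 6).dist (.var 5))).and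
        ((switchExpr 4 6).dist (switchExpr 5 6)))) (i := .lit 0) (xs := [6]) (C := C)
    (A := fun _ => 0) (s.setArr 7 0 0) (by simp) (by simp) (fun s' hs' _ => by
      have he' : Env G s' := he.congr (fun z hz => by
        simp only [List.mem_cons, List.not_mem_nil, or_false] at hz
        rw [hs'.var z (by simp; omega), State.setArr_var]) fun a ha => by
        simp only [List.mem_cons, List.not_mem_nil, or_false] at ha
        have : a ≠ 7 := by omega
        rw [hs'.arr a this, State.setArr_arr, Function.update_of_ne this]
      have h2' : s'.var 2 = v := by rw [hs'.var 2 (by simp)]; exact h2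
      have h4' : s'.var 4 = x := by rw [hs'.var 4 (by simp)]; exact h4
      have h5' : s'.var 5 = y := by rw [hs'.var 5 (by simp)]; exact h5
      have ha5 : s'.arr 5 = s.arr 5 := by rw [hs'.arr 5 (by simp)]; simp
      refine ⟨?_, fun _ => ⟨rfl, le_rfl⟩⟩
      simp only [Expr.eval_and_ne_zero, Expr.eval_dist_ne_zero]
      have hread : (Expr.read 5 (.var 6)).eval s' = s.arr 5 (s'.var 6) := by
        simp [Expr.eval, ha5]
      have hvar : ∀ z, (Expr.var z).eval s' = s'.var z := fun _ => rfl
      rw [hread, hvar, hvar, hvar, h4', h5']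
      have hsw : ∀ z : Fin n, s'.var 6 = z →
          ((switchExpr 4 6).eval s' ≠ (switchExpr 5 6).eval s' ↔
            ¬ ((G.seidelSwitch (G.neighborSet v)).Adj x z ↔
              (G.seidelSwitch (G.neighborSet v)).Adj y z)) := by
        intro z hz
        rw [he'.eval_switchExpr h2' h4' hz, he'.eval_switchExpr h2' h5' hz]
        by_cases a1 : (G.seidelSwitch (G.neighborSet v)).Adj x z <;>
          by_cases a2 : (G.seidelSwitch (G.neighborSet v)).Adj y z <;> simp [a1, a2]
      constructor
      · rintro ⟨a1, ⟨a2, a3⟩, a4⟩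
        refine ⟨⟨s'.var 6, hc.lt _ a1⟩, rfl, mem_reps.2 a1, ?_, ?_, (hsw ⟨_, hc.lt _ a1⟩ rfl).1 a4⟩
        · exact fun h => a2 (congrArg Fin.val h)
        · exact fun h => a3 (congrArg Fin.val h)
      · rintro ⟨z, hz, a1, a2, a3, a4⟩
        rw [hsw z hz, hz]
        exact ⟨mem_reps.1 a1, ⟨fun h => a2 (Fin.ext h), fun h => a3 (Fin.ext h)⟩, a4⟩)
  have hrun : twinsCmd.run s = (nest [6] (.ite ((Expr.read 5 (.var 6)).and
      ((((Expr.var 6).dist (.var 4)).and ((Expr.var 6).dist (.var 5))).and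
        ((switchExpr 4 6).dist (switchExpr 5 6)))) (.write 7 (.lit 0) (.lit 1)) .skip)).run
      (s.setArr 7 0 0) := rfl
  rw [hrun]
  obtain ⟨a1, a2⟩ := this
  refine ⟨fun z hz => ?_, fun b hb => ?_, ?_⟩
  · rw [a1.var z (by simpa using hz)]; rfl
  · rw [a1.arr b hb]; simp [hb]
  · rw [a2 0]
    simp only [State.setArr_arr, State.setArr_var, Function.update_self, ne_eq, not_true, false_or,
      ExistsBelow, and_true, C, he.var_one]
    constructor
    · rintro ⟨i, -, z, -, h⟩
      exact ⟨z, h⟩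
    · rintro ⟨z, h⟩
      exact ⟨z, by omega, z, by simp, h⟩

theorem Env.eval_entryExpr {s : State} (he : Env G s) {x a b c : ℕ} (ha : s.var a < n + 1)
    (hb : s.var b < n + 1) (hc : s.var c < n + 1) : (entryExpr x a b c).eval s ≠ 0 ↔
      tableAt (s.arr 4) (s.arr 6 (s.var x)) (n + 1) (s.var a) (s.var b) (s.var c) := by
  have := he.eval_cellExpr (p := .read 6 (.var x)) (e₁ := .var a) (e₂ := .var b) (e₃ := .var c) ha hb
  rw [entryExpr, Expr.eval, this]
  simp only [tableAt, ha, hb, hc, true_and, Expr.eval]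

/-- The table that is written by nested loops into the free part of the array `4`: the loops mark
the entries described by `C` and `f₁`, `f₂`, `f₃`. -/
theorem tableAt_of_marks {s s' : State} (hc : Clean n s) {xs : List ℕ} {C : (ℕ → ℕ) → Prop}
    {f₁ f₂ f₃ : (ℕ → ℕ) → ℕ}
    (h : ∀ k, s'.arr 4 k ≠ 0 ↔ s.arr 4 k ≠ 0 ∨ ExistsBelow (n + 1) xs (fun f => C f ∧
      k = s.var 7 + cell (n + 1) (f₁ f) (f₂ f) (f₃ f)) s.var) (a b c : ℕ) :
    tableAt (s'.arr 4) (s.var 7) (n + 1) a b c ↔ a < n + 1 ∧ b < n + 1 ∧ c < n + 1 ∧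
      ExistsBelow (n + 1) xs (fun f => C f ∧
        cell (n + 1) a b c = cell (n + 1) (f₁ f) (f₂ f) (f₃ f)) s.var := by
  simp only [tableAt, h, hc.fresh _ (Nat.le_add_right _ _), ne_eq, not_true, false_or,
    Nat.add_left_cancel_iff]

theorem unionCmd_run {s : State} (he : Env G s) (hc : Clean n s) {x y : Fin n}
    (h4 : s.var 4 = x) (h5 : s.var 5 = y)
    (hx : s.arr 6 x + (n + 1) * ((n + 1) * (n + 1)) ≤ s.var 7)
    (hy : s.arr 6 y + (n + 1) * ((n + 1) * (n + 1)) ≤ s.var 7)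
    (hlt : ∀ a b c, unionTable (tableAt (s.arr 4) (s.arr 6 x) (n + 1))
      (tableAt (s.arr 4) (s.arr 6 y) (n + 1)) a b c → a < n + 1 ∧ b < n + 1 ∧ c < n + 1) :
    Agree [11, 12, 13, 14, 15, 16] 4 (s.var 7) s (unionCmd.run s) ∧
      (∀ k, s.var 7 + (n + 1) * ((n + 1) * (n + 1)) ≤ k → (unionCmd.run s).arr 4 k = 0) ∧
      tableAt ((unionCmd.run s).arr 4) (s.var 7) (n + 1) =
        unionTable (tableAt (s.arr 4) (s.arr 6 x) (n + 1))
          (tableAt (s.arr 4) (s.arr 6 y) (n + 1)) := by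
  set T₁ := tableAt (s.arr 4) (s.arr 6 x) (n + 1) with hT₁
  set T₂ := tableAt (s.arr 4) (s.arr 6 y) (n + 1) with hT₂
  let C : (ℕ → ℕ) → Prop := fun f => T₁ (f 11) (f 12) (f 13) ∧ T₂ (f 14) (f 15) (f 16)
  have hC : ∀ f, C f → max (f 11) (f 14) < n + 1 ∧ max (f 12) (f 15) < n + 1 ∧
      f 13 + f 16 < n + 1 := fun f hf => hlt _ _ _ ⟨_, _, _, _, _, _, hf.1, hf.2, rfl, rfl, rfl⟩
  obtain ⟨h1, h2⟩ := nest_write_run (a := 4) (q := s.var 7)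
    (e := (entryExpr 4 11 12 13).and (entryExpr 5 14 15 16))
    (i := cellExpr (.var 7) ((Expr.var 11).max (.var 14)) ((Expr.var 12).max (.var 15))
        (.add (.var 13) (.var 16))) (xs := [11, 12, 13, 14, 15, 16]) (C := C)
    (A := fun f => s.var 7 + cell (n + 1) (max (f 11) (f 14)) (max (f 12) (f 15)) (f 13 + f 16))
    s (by simp) (by simp) (fun s' hs' hs => by
      have he' : Env G s' := he.congr (fun z hz => by
        simp only [List.mem_cons, List.not_mem_nil, or_false] at hz
        exact hs'.var z (by simp; omega)) fun a ha => by
        simp only [List.mem_cons, List.not_mem_nil, or_false] at ha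
        exact hs'.arr a (by omega)
      simp only [he.var_one, List.forall_mem_cons, List.not_mem_nil, false_imp_iff, implies_true,
        and_true] at hs
      obtain ⟨l1, l2, l3, l4, l5, l6⟩ := hs
      constructor
      · rw [Expr.eval_and_ne_zero, he'.eval_entryExpr l1 l2 l3, he'.eval_entryExpr l4 l5 l6,
          hs'.var 4 (by simp), hs'.var 5 (by simp), h4, h5, hs'.arr 6 (by simp),
          tableAt_congr hx hs'.low, tableAt_congr hy hs'.low]
      · intro hf
        obtain ⟨m1, m2, m3⟩ := hC _ hf
        refine ⟨?_, Nat.le_add_right _ _⟩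
        rw [he'.eval_cellExpr (by rw [Expr.eval_max]; exact m1) (by rw [Expr.eval_max]; exact m2),
          Expr.eval_max, Expr.eval_max]
        simp only [Expr.eval, hs'.var 7 (by simp)])
  rw [he.var_one] at h2
  refine ⟨h1, fun k hk => ?_, ?_⟩
  · by_contra hne
    rcases (h2 k).1 hne with h | h
    · exact h (hc.fresh k (by omega))
    · simp only [ExistsBelow] at h
      obtain ⟨_, _, _, _, _, _, _, _, _, _, _, _, hf, rfl⟩ := h
      obtain ⟨m1, m2, m3⟩ := hC _ hf
      have := cell_lt m1 m2 m3
      omega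
  · funext a b c
    refine propext ((tableAt_of_marks hc h2 a b c).trans ?_)
    constructor
    · rintro ⟨ha, hb, hg, h⟩
      simp only [ExistsBelow] at h
      obtain ⟨_, _, _, _, _, _, _, _, _, _, _, _, hf, hcell⟩ := h
      obtain ⟨m1, m2, m3⟩ := hC _ hf
      obtain ⟨rfl, rfl, rfl⟩ := cell_inj hb hg m2 m3 hcell
      exact ⟨_, _, _, _, _, _, hf.1, hf.2, rfl, rfl, rfl⟩
    · intro h
      obtain ⟨ha, hb, hg⟩ := hlt a b c h
      obtain ⟨s₁, t₁, g₁, s₂, t₂, g₂, hf₁, hf₂, rfl, rfl, rfl⟩ := h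
      refine ⟨ha, hb, hg, s₁, hf₁.1, t₁, hf₁.2.1, g₁, hf₁.2.2.1, s₂, hf₂.1, t₂, hf₂.2.1, g₂,
        hf₂.2.2.1, ?_⟩
      simp only [ExistsBelow, C, Function.update_self, Function.update_of_ne, ne_eq,
        Nat.reduceEqDiff, not_false_eq_true]
      exact ⟨⟨hf₁, hf₂⟩, trivial⟩

theorem joinCmd_run {s : State} (he : Env G s) (hc : Clean n s) {x y : Fin n}
    (h4 : s.var 4 = x) (h5 : s.var 5 = y)
    (hx : s.arr 6 x + (n + 1) * ((n + 1) * (n + 1)) ≤ s.var 7)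
    (hy : s.arr 6 y + (n + 1) * ((n + 1) * (n + 1)) ≤ s.var 7)
    (hlt : ∀ a b c, joinTable (tableAt (s.arr 4) (s.arr 6 x) (n + 1))
      (tableAt (s.arr 4) (s.arr 6 y) (n + 1)) a b c → a < n + 1 ∧ b < n + 1 ∧ c < n + 1) :
    Agree [11, 12, 13, 14, 15, 16, 17, 18] 4 (s.var 7) s (joinCmd.run s) ∧
      (∀ k, s.var 7 + (n + 1) * ((n + 1) * (n + 1)) ≤ k → (joinCmd.run s).arr 4 k = 0) ∧
      tableAt ((joinCmd.run s).arr 4) (s.var 7) (n + 1) =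
        joinTable (tableAt (s.arr 4) (s.arr 6 x) (n + 1))
          (tableAt (s.arr 4) (s.arr 6 y) (n + 1)) := by
  set T₁ := tableAt (s.arr 4) (s.arr 6 x) (n + 1) with hT₁
  set T₂ := tableAt (s.arr 4) (s.arr 6 y) (n + 1) with hT₂
  let C : (ℕ → ℕ) → Prop := fun f => (T₁ (f 11) (f 12) (f 13) ∧ T₂ (f 14) (f 15) (f 16)) ∧
    (f 17 ≤ f 11 ∧ f 17 ≤ f 15) ∧ f 18 ≤ f 14 ∧ f 18 ≤ f 12
  have hC : ∀ f, C f → f 11 + f 14 - (f 17 + f 18) < n + 1 ∧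
      f 12 + f 15 - (f 17 + f 18) < n + 1 ∧ f 13 + f 16 + (f 17 + f 18) < n + 1 := by
    rintro f ⟨⟨hf₁, hf₂⟩, ⟨m1, m2⟩, m3, m4⟩
    exact hlt _ _ _ ⟨_, _, _, _, _, _, f 17, f 18, hf₁, hf₂, m1, m2, m3, m4, by omega, by omega,
      by omega⟩
  obtain ⟨h1, h2⟩ := nest_write_run (a := 4) (q := s.var 7)
    (e := ((entryExpr 4 11 12 13).and (entryExpr 5 14 15 16)).and
        ((((Expr.var 17).le (.var 11)).and ((Expr.var 17).le (.var 15))).and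
          (((Expr.var 18).le (.var 14)).and ((Expr.var 18).le (.var 12)))))
    (i := cellExpr (.var 7)
        (.sub (.add (.var 11) (.var 14)) (.add (.var 17) (.var 18)))
        (.sub (.add (.var 12) (.var 15)) (.add (.var 17) (.var 18)))
        (.add (.add (.var 13) (.var 16)) (.add (.var 17) (.var 18))))
    (xs := [11, 12, 13, 14, 15, 16, 17, 18]) (C := C)
    (A := fun f => s.var 7 + cell (n + 1) (f 11 + f 14 - (f 17 + f 18))
      (f 12 + f 15 - (f 17 + f 18)) (f 13 + f 16 + (f 17 + f 18)))
    s (by simp) (by simp) (fun s' hs' hs => by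
      have he' : Env G s' := he.congr (fun z hz => by
        simp only [List.mem_cons, List.not_mem_nil, or_false] at hz
        exact hs'.var z (by simp; omega)) fun a ha => by
        simp only [List.mem_cons, List.not_mem_nil, or_false] at ha
        exact hs'.arr a (by omega)
      simp only [he.var_one, List.forall_mem_cons, List.not_mem_nil, false_imp_iff, implies_true,
        and_true] at hs
      obtain ⟨l1, l2, l3, l4, l5, l6, -, -⟩ := hs
      constructor
      · simp only [Expr.eval_and_ne_zero, Expr.eval_le_ne_zero]
        rw [he'.eval_entryExpr l1 l2 l3, he'.eval_entryExpr l4 l5 l6,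
          hs'.var 4 (by simp), hs'.var 5 (by simp), h4, h5, hs'.arr 6 (by simp),
          tableAt_congr hx hs'.low, tableAt_congr hy hs'.low]
        rfl
      · intro hf
        obtain ⟨m1, m2, m3⟩ := hC _ hf
        refine ⟨?_, Nat.le_add_right _ _⟩
        rw [he'.eval_cellExpr (by exact m1) (by exact m2)]
        simp only [Expr.eval, hs'.var 7 (by simp)])
  rw [he.var_one] at h2
  refine ⟨h1, fun k hk => ?_, ?_⟩
  · by_contra hne
    rcases (h2 k).1 hne with h | h
    · exact h (hc.fresh k (by omega))
    · simp only [ExistsBelow] at h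
      obtain ⟨_, _, _, _, _, _, _, _, _, _, _, _, _, _, _, _, hf, rfl⟩ := h
      obtain ⟨m1, m2, m3⟩ := hC _ hf
      have := cell_lt m1 m2 m3
      omega
  · funext a b c
    refine propext ((tableAt_of_marks hc h2 a b c).trans ?_)
    constructor
    · rintro ⟨ha, hb, hg, h⟩
      simp only [ExistsBelow] at h
      obtain ⟨_, _, _, _, _, _, _, _, _, _, _, _, _, _, _, _, hf, hcell⟩ := h
      obtain ⟨m1, m2, m3⟩ := hC _ hf
      obtain ⟨rfl, rfl, rfl⟩ := cell_inj hb hg m2 m3 hcell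
      obtain ⟨⟨hf₁, hf₂⟩, ⟨p1, p2⟩, p3, p4⟩ := hf
      exact ⟨_, _, _, _, _, _, _, _, hf₁, hf₂, p1, p2, p3, p4, by omega, by omega, by omega⟩
    · intro h
      obtain ⟨ha, hb, hg⟩ := hlt a b c h
      obtain ⟨s₁, t₁, g₁, s₂, t₂, g₂, m₁, m₂, hf₁, hf₂, p1, p2, p3, p4, q1, q2, rfl⟩ := h
      have := hf₁.1
      have := hf₂.1
      refine ⟨ha, hb, hg, s₁, hf₁.1, t₁, hf₁.2.1, g₁, hf₁.2.2.1, s₂, hf₂.1, t₂, hf₂.2.1, g₂,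
        hf₂.2.2.1, m₁, by omega, m₂, by omega, ?_⟩
      simp only [ExistsBelow, C, Function.update_self, Function.update_of_ne, ne_eq,
        Nat.reduceEqDiff, not_false_eq_true]
      refine ⟨⟨⟨hf₁, hf₂⟩, ⟨p1, p2⟩, p3, p4⟩, ?_⟩
      rw [show s₁ + s₂ - (m₁ + m₂) = a by omega, show t₁ + t₂ - (m₁ + m₂) = b by omega, add_assoc]

/-! ### Merging twins -/

/-- No third vertex of `W` distinguishes the vertices `x` and `y` of `W`. -/
def Twins (H : SimpleGraph (Fin n)) (W : Finset (Fin n)) (x y : Fin n) : Prop :=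
  x ∈ W ∧ y ∈ W ∧ x ≠ y ∧ ∀ z ∈ W, z ≠ x → z ≠ y → (H.Adj x z ↔ H.Adj y z)

theorem Forest.isModule {s : State} {M : Fin n → Set (Fin n)} (h : Forest G v s M) {x y : Fin n}
    (ht : Twins (G.seidelSwitch (G.neighborSet v)) (reps n s) x y) :
    (G.seidelSwitch (G.neighborSet v)).IsModule (M x ∪ M y) := by
  obtain ⟨hx, hy, -, ht⟩ := ht
  have key : ∀ a ∈ M x ∪ M y, ∀ z ∈ reps n s, z ≠ x → z ≠ y → ∀ b ∈ M z,
      ((G.seidelSwitch (G.neighborSet v)).Adj a b ↔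
        (G.seidelSwitch (G.neighborSet v)).Adj x z) := by
    rintro a (ha | ha) z hz hzx hzy b hb
    · exact h.adj_iff x hx z hz hzx.symm a ha b hb
    · exact (h.adj_iff y hy z hz hzy.symm a ha b hb).trans (ht z hz hzx hzy).symm
  intro a ha a' ha' b hb
  obtain ⟨z, hz, hbz⟩ := h.cover b
  have hzx : z ≠ x := by rintro rfl; exact hb (Or.inl hbz)
  have hzy : z ≠ y := by rintro rfl; exact hb (Or.inr hbz)
  exact (key a ha z hz hzx hzy b hbz).trans (key a' ha' z hz hzx hzy b hbz).symm

/-- The new table of merged twins. -/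
theorem Forest.exists_table {s : State} {M : Fin n → Set (Fin n)} (h : Forest G v s M)
    {x y : Fin n} (h4 : s.var 4 = x) (h5 : s.var 5 = y)
    (ht : Twins (G.seidelSwitch (G.neighborSet v)) (reps n s) x y) :
    let s' := (Cmd.ite (switchExpr 4 5) joinCmd unionCmd).run s
    (∀ z < 11, s'.var z = s.var z) ∧ (∀ b ≠ 4, s'.arr b = s.arr b) ∧
      (∀ k < s.var 7, s'.arr 4 k = s.arr 4 k) ∧
      (∀ k, s.var 7 + (n + 1) * ((n + 1) * (n + 1)) ≤ k → s'.arr 4 k = 0) ∧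
      (G.seidelSwitch (G.neighborSet v)).IsTable (G.neighborSet v) (M x ∪ M y)
        (tableAt (s'.arr 4) (s.var 7) (n + 1)) := by
  classical
  intro s'
  obtain ⟨hx, hy, hxy, -⟩ := id ht
  have hsw := h.eval_switchExpr h.var_two h4 h5
  by_cases hadj : (G.seidelSwitch (G.neighborSet v)).Adj x y
  · have hs' : s' = joinCmd.run s := by
      simp only [s', Cmd.run, hsw, hadj, if_true, ne_eq, one_ne_zero, not_false_eq_true]
    have hT := (h.table x hx).join (h.table y hy) (h.disj x hx y hy hxy)
      fun a ha b hb => (h.adj_iff x hx y hy hxy a ha b hb).2 hadj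
    obtain ⟨h1, h2, h3⟩ := joinCmd_run h.toEnv h.toClean h4 h5 (h.le x hx) (h.le y hy)
      fun a b c habc => lt_of_isTable hT habc
    rw [hs', h3]
    exact ⟨fun z hz => h1.var z (by simp; omega), h1.arr, h1.low, h2, hT⟩
  · have hs' : s' = unionCmd.run s := by
      simp only [s', Cmd.run, hsw, hadj, if_false, ne_eq, not_true]
    have hT := (h.table x hx).union (h.table y hy) (h.disj x hx y hy hxy)
      (fun a ha b hb hab => hadj ((h.adj_iff x hx y hy hxy a ha b hb).1 hab)) (h.isModule ht)
    obtain ⟨h1, h2, h3⟩ := unionCmd_run h.toEnv h.toClean h4 h5 (h.le x hx) (h.le y hy)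
      fun a b c habc => lt_of_isTable hT habc
    rw [hs', h3]
    exact ⟨fun z hz => h1.var z (by simp; omega), h1.arr, h1.low, h2, hT⟩

theorem mergeCmd_run {s : State} {M : Fin n → Set (Fin n)} (h : Forest G v s M)
    {x y : Fin n} (h4 : s.var 4 = x) (h5 : s.var 5 = y)
    (ht : Twins (G.seidelSwitch (G.neighborSet v)) (reps n s) x y) :
    Forest G v (mergeCmd.run s) (Function.update M x (M x ∪ M y)) ∧
      reps n (mergeCmd.run s) = (reps n s).erase y := by
  classical
  obtain ⟨t1, t2, t3, t4, t5⟩ := h.exists_table h4 h5 ht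
  obtain ⟨hx, hy, hxy, htw⟩ := id ht
  have hrun : mergeCmd.run s = ((((Cmd.ite (switchExpr 4 5) joinCmd unionCmd).run s).setArr 6 x
      (s.var 7)).setArr 5 y 0).setVar 7 (s.var 7 + (n + 1) * ((n + 1) * (n + 1))) := by
    rw [mergeCmd, Cmd.run]
    generalize (Cmd.ite (switchExpr 4 5) joinCmd unionCmd).run s = s' at *
    simp [Cmd.run, nextTableCmd, Expr.eval, t1, h4, h5, h.cube]
  generalize (Cmd.ite (switchExpr 4 5) joinCmd unionCmd).run s = s' at *
  have hr : reps n (mergeCmd.run s) = (reps n s).erase y := by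
    ext z
    rw [Finset.mem_erase, mem_reps, mem_reps, hrun]
    by_cases hzy : z = y
    · simp [hzy]
    · have : (z : ℕ) ≠ y := fun h => hzy (Fin.ext h)
      simp [hzy, this, t2]
  have hxr : ∀ z ∈ (reps n s).erase y, z = x ∨ z ≠ x ∧ z ≠ y ∧ z ∈ reps n s := by
    intro z hz
    rw [Finset.mem_erase] at hz
    tauto
  have h6x : (mergeCmd.run s).arr 6 x = s.var 7 := by rw [hrun]; simp
  have h6 : ∀ z : Fin n, z ≠ x → (mergeCmd.run s).arr 6 z = s.arr 6 z := by
    intro z hz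
    have : (z : ℕ) ≠ x := fun h => hz (Fin.ext h)
    rw [hrun]; simp [this, t2]
  have h4' : (mergeCmd.run s).arr 4 = s'.arr 4 := by rw [hrun]; simp
  have h7' : (mergeCmd.run s).var 7 = s.var 7 + (n + 1) * ((n + 1) * (n + 1)) := by
    rw [hrun]; simp
  refine ⟨⟨?_, ⟨?_, ?_⟩, ?_, ?_, ?_, ?_, ?_, ?_, ?_⟩, hr⟩
  · refine h.toEnv.congr (fun z hz => ?_) fun a ha => ?_
    · simp only [List.mem_cons, List.not_mem_nil, or_false] at hz
      have : z ≠ 7 := by omega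
      simp [hrun, this, t1 z (by omega)]
    · simp only [List.mem_cons, List.not_mem_nil, or_false] at ha
      have a5 : a ≠ 5 := by omega
      have a6 : a ≠ 6 := by omega
      simp [hrun, a5, a6, t2 a (by omega)]
  · rw [h4', h7']; exact t4
  · intro k hk
    have hk' : Function.update (s.arr 5) y 0 k ≠ 0 := by simpa [hrun, t2] using hk
    by_cases hky : k = y
    · rw [hky]; exact y.2
    · exact h.lt k (by simpa [hky] using hk')
  · rw [hrun]; simp [t1, h.var_two]
  · rw [hr, h7']
    intro z hz
    rcases hxr z hz with rfl | ⟨hzx, -, hz⟩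
    · rw [h6x]
    · rw [h6 z hzx]
      exact (h.le z hz).trans (Nat.le_add_right _ _)
  · rw [hr, h4']
    intro z hz
    rcases hxr z hz with rfl | ⟨hzx, -, hz⟩
    · rw [h6x, Function.update_self]; exact t5
    · rw [h6 z hzx, Function.update_of_ne hzx, tableAt_congr (h.le z hz) t3]
      exact h.table z hz
  · rw [hr]
    intro z hz
    rcases hxr z hz with rfl | ⟨hzx, -, hz⟩
    · rw [Function.update_self]; exact Or.inl (h.mem z hx)
    · rw [Function.update_of_ne hzx]; exact h.mem z hz
  · rw [hr]
    intro z hz w hw hzw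
    rcases hxr z hz with rfl | ⟨hzx, hzy, hz⟩ <;> rcases hxr w hw with rfl | ⟨hwx, hwy, hw⟩
    · exact absurd rfl hzw
    · rw [Function.update_self, Function.update_of_ne hwx, Set.disjoint_union_left]
      exact ⟨h.disj _ hx w hw hzw, h.disj y hy w hw hwy.symm⟩
    · rw [Function.update_self, Function.update_of_ne hzx, Set.disjoint_union_right]
      exact ⟨h.disj z hz _ hx hzw, h.disj z hz y hy hzy⟩
    · rw [Function.update_of_ne hzx, Function.update_of_ne hwx]
      exact h.disj z hz w hw hzw
  · -- The two modules are joined to every other one in the same way, since `x` and `y` are twins.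
    have main : ∀ w ∈ reps n s, w ≠ x → w ≠ y → ∀ a ∈ M x ∪ M y, ∀ b ∈ M w,
        ((G.seidelSwitch (G.neighborSet v)).Adj a b ↔
          (G.seidelSwitch (G.neighborSet v)).Adj x w) := by
      rintro w hw hwx hwy a (ha | ha) b hb
      · exact h.adj_iff x hx w hw hwx.symm a ha b hb
      · exact (h.adj_iff y hy w hw hwy.symm a ha b hb).trans (htw w hw hwx hwy).symm
    rw [hr]
    intro z hz w hw hzw a ha b hb
    rcases hxr z hz with rfl | ⟨hzx, hzy, hz⟩ <;> rcases hxr w hw with rfl | ⟨hwx, hwy, hw⟩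
    · exact absurd rfl hzw
    · rw [Function.update_self] at ha
      rw [Function.update_of_ne hwx] at hb
      exact main w hw hwx hwy a ha b hb
    · rw [Function.update_of_ne hzx] at ha
      rw [Function.update_self] at hb
      rw [adj_comm _ a b, adj_comm _ z w]
      exact main z hz hzx hzy b hb a ha
    · rw [Function.update_of_ne hzx] at ha
      rw [Function.update_of_ne hwx] at hb
      exact h.adj_iff z hz w hw hzw a ha b hb
  · rw [hr]
    intro a
    obtain ⟨z, hz, haz⟩ := h.cover a
    by_cases hzx : z = x
    · exact ⟨x, Finset.mem_erase.2 ⟨hxy, hx⟩, by rw [Function.update_self]; exact Or.inl (hzx ▸ haz)⟩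
    by_cases hzy : z = y
    · exact ⟨x, Finset.mem_erase.2 ⟨hxy, hx⟩, by rw [Function.update_self]; exact Or.inr (hzy ▸ haz)⟩
    · exact ⟨z, Finset.mem_erase.2 ⟨hzy, hz⟩, by rwa [Function.update_of_ne hzx]⟩

/-- The memory holds tables for some partition of the vertex set. -/
def Ready (G : SimpleGraph (Fin n)) (v : Fin n) (s : State) : Prop :=
  ∃ M, Forest G v s M

theorem Ready.setVar {s : State} (h : Ready G v s) {x : ℕ} (hx : x ∉ [0, 1, 8, 9, 2, 7]) (w : ℕ) :
    Ready G v (s.setVar x w) := by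
  obtain ⟨M, h⟩ := h
  exact ⟨M, h.setVar hx w⟩

theorem tryMergeCmd_run {s : State} (h : Ready G v s) : Ready G v (tryMergeCmd.run s) ∧
    reps n (tryMergeCmd.run s) ⊆ reps n s ∧ (reps n (tryMergeCmd.run s) = reps n s →
      ∀ x y : Fin n, s.var 4 = x → s.var 5 = y →
        ¬ Twins (G.seidelSwitch (G.neighborSet v)) (reps n s) x y) := by
  obtain ⟨M, h⟩ := h
  by_cases hc : (((Expr.read 5 (.var 4)).and (.read 5 (.var 5))).and
      ((Expr.var 4).dist (.var 5))).eval s ≠ 0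
  · rw [tryMergeCmd, Cmd.run, if_pos hc, Cmd.run]
    simp only [Expr.eval_and_ne_zero, Expr.eval_dist_ne_zero] at hc
    obtain ⟨⟨hc4, hc5⟩, hc⟩ := hc
    obtain ⟨x, hx⟩ : ∃ x : Fin n, s.var 4 = x := ⟨⟨_, h.lt _ hc4⟩, rfl⟩
    obtain ⟨y, hy⟩ : ∃ y : Fin n, s.var 5 = y := ⟨⟨_, h.lt _ hc5⟩, rfl⟩
    obtain ⟨t1, t2, t3⟩ := twinsCmd_run h.toEnv h.toClean h.var_two hx hy
    have h' : Forest G v (twinsCmd.run s) M := h.congr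
      (fun z hz => by
        simp only [List.mem_cons, List.not_mem_nil, or_false] at hz
        exact t1 z (by omega))
      (fun a ha => by
        simp only [List.mem_cons, List.not_mem_nil, or_false] at ha
        exact t2 a (by omega))
    have hr : reps n (twinsCmd.run s) = reps n s := by
      ext z; rw [mem_reps, mem_reps, t2 5 (by simp)]
    have hxr : x ∈ reps n s := mem_reps.2 (by rw [← hx]; exact hc4)
    have hyr : y ∈ reps n s := mem_reps.2 (by rw [← hy]; exact hc5)
    have hxy : x ≠ y := by
      rintro rfl
      exact hc (hx.trans hy.symm)
    by_cases hm : (Expr.read 7 (.lit 0)).eval (twinsCmd.run s) ≠ 0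
    · rw [Cmd.run, if_pos hm, Cmd.run, hr]
      refine ⟨⟨M, h'⟩, subset_rfl, fun _ x' y' hx' hy' htw => ?_⟩
      obtain rfl : x = x' := Fin.ext (hx.symm.trans hx')
      obtain rfl : y = y' := Fin.ext (hy.symm.trans hy')
      obtain ⟨z, hz, hzx, hzy, hne⟩ := t3.1 hm
      exact hne (htw.2.2.2 z hz hzx hzy)
    · rw [Cmd.run, if_neg hm]
      have htw : Twins (G.seidelSwitch (G.neighborSet v)) (reps n (twinsCmd.run s)) x y := by
        rw [hr]
        refine ⟨hxr, hyr, hxy, fun z hz hzx hzy => ?_⟩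
        by_contra hne
        exact hm (t3.2 ⟨z, hz, hzx, hzy, hne⟩)
      obtain ⟨m1, m2⟩ := mergeCmd_run h' (by rw [t1 4 (by simp), hx]) (by rw [t1 5 (by simp), hy])
        htw
      rw [hr] at m2
      refine ⟨⟨_, m1⟩, by rw [m2]; exact Finset.erase_subset _ _, fun heq => ?_⟩
      rw [m2] at heq
      exact absurd hyr (Finset.erase_eq_self.1 heq)
  · rw [tryMergeCmd, Cmd.run, if_neg hc, Cmd.run]
    refine ⟨⟨M, h⟩, subset_rfl, fun _ x y hx hy htw => hc ?_⟩
    simp only [Expr.eval_and_ne_zero, Expr.eval_dist_ne_zero, Expr.eval]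
    rw [hx, hy]
    exact ⟨⟨mem_reps.1 htw.1, mem_reps.1 htw.2.1⟩, fun h => htw.2.2.1 (Fin.ext h)⟩

/-- If every round `i` of a loop keeps the data `Ready` and either removes a representative or
ensures a property `Φ` of `i` and the representatives, then so does the whole loop for all `i`. -/
theorem loop_reps {x : ℕ} {P : Cmd} {Q : State → Prop} {Φ : Finset (Fin n) → ℕ → Prop}
    (hx : x ∉ [0, 1, 8, 9, 2, 7]) (hQ : ∀ s w, Q s → Q (s.setVar x w))
    (hP : ∀ s, Ready G v s → Q s → Ready G v (P.run s) ∧ Q (P.run s) ∧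
      reps n (P.run s) ⊆ reps n s ∧ (reps n (P.run s) = reps n s → Φ (reps n s) (s.var x)))
    {s : State} (h : Ready G v s) (hs : Q s) :
    Ready G v ((Cmd.loop x P).run s) ∧ Q ((Cmd.loop x P).run s) ∧
      reps n ((Cmd.loop x P).run s) ⊆ reps n s ∧
      (reps n ((Cmd.loop x P).run s) = reps n s → ∀ i < n + 1, Φ (reps n s) i) := by
  have := Cmd.loop_induction (x := x) (P := P) (s := s)
    (fun i s' => Ready G v s' ∧ Q s' ∧ reps n s' ⊆ reps n s ∧
      (reps n s' = reps n s → ∀ j < i, Φ (reps n s) j))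
    ⟨h.setVar hx 0, hQ s 0 hs, subset_rfl, by simp⟩
    (fun i _ s' hi ⟨i1, i2, i3, i4⟩ => by
      obtain ⟨j1, j2, j3, j4⟩ := hP s' i1 i2
      refine ⟨j1.setVar hx _, hQ _ _ j2, j3.trans i3, fun heq j hj => ?_⟩
      have heq : reps n (P.run s') = reps n s := heq
      have h1 : reps n s' = reps n s := i3.antisymm (heq ▸ j3)
      rcases Nat.lt_succ_iff_lt_or_eq.1 hj with hj | rfl
      · exact i4 h1 j hj
      · rw [← hi, ← h1]
        exact j4 (heq.trans h1.symm))
  obtain ⟨M, hM⟩ := id h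
  rw [hM.var_one] at this
  exact this

theorem reduceCmd_run (hG : G.IsCameron) {s : State} (h : Ready G v s) :
    Ready G v (reduceCmd.run s) ∧ (reps n (reduceCmd.run s)).card ≤ 1 := by
  -- One sweep over all pairs removes a representative, unless only one is left.
  have sweep : ∀ s, Ready G v s → Ready G v ((Cmd.loop 4 (.loop 5 tryMergeCmd)).run s) ∧
      reps n ((Cmd.loop 4 (.loop 5 tryMergeCmd)).run s) ⊆ reps n s ∧
      (reps n ((Cmd.loop 4 (.loop 5 tryMergeCmd)).run s) = reps n s →
        (reps n s).card ≤ 1) := by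
    intro s h
    have inner : ∀ i, ∀ s, Ready G v s → s.var 4 = i → _ := fun i s h hi =>
      loop_reps (x := 5) (P := tryMergeCmd) (Q := fun s => s.var 4 = i)
        (Φ := fun W j => ∀ x y : Fin n, i = x → j = y →
          ¬ Twins (G.seidelSwitch (G.neighborSet v)) W x y)
        (by simp) (fun s w hs => by simpa using hs) (fun s h hs => by
          obtain ⟨t1, t2, t3⟩ := tryMergeCmd_run h
          refine ⟨t1, ?_, t2, ?_⟩
          · rw [Cmd.run_var_of_notMem]
            · exact hs
            · simp [tryMergeCmd, twinsCmd, mergeCmd, joinCmd, unionCmd, nextTableCmd, nest, Cmd.vars]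
          · rw [hs] at t3
            exact t3) h hi
    obtain ⟨o1, -, o2, o3⟩ := loop_reps (x := 4) (P := .loop 5 tryMergeCmd) (Q := fun _ => True)
      (Φ := fun W i => ∀ x y : Fin n, i = x →
          ¬ Twins (G.seidelSwitch (G.neighborSet v)) W x y)
      (by simp) (fun _ _ _ => trivial) (fun s h _ => by
        obtain ⟨t1, -, t2, t3⟩ := inner (s.var 4) s h rfl
        exact ⟨t1, trivial, t2, fun heq x y hx => t3 heq y (by omega) x y hx rfl⟩) h trivial
    refine ⟨o1, o2, fun heq => ?_⟩
    by_contra! hcard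
    obtain ⟨x, hx, y, hy, hxy, ht⟩ := (hG.isCograph_seidelSwitch v).exists_twins _ hcard
    exact o3 heq x (by omega) x y rfl ⟨hx, hy, hxy, ht⟩
  have := Cmd.loop_induction (x := 3) (P := .loop 4 (.loop 5 tryMergeCmd)) (s := s)
    (fun i s' => Ready G v s' ∧ (reps n s').card ≤ max 1 (n - i))
    ⟨h.setVar (by simp) 0, by
      have := (reps n (s.setVar 3 0)).card_le_univ
      rw [Fintype.card_fin] at this
      omega⟩
    (fun i _ s' _ ⟨i1, i2⟩ => by
      obtain ⟨j1, j2, j3⟩ := sweep s' i1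
      refine ⟨j1.setVar (by simp) _, ?_⟩
      change (reps n ((Cmd.loop 4 (.loop 5 tryMergeCmd)).run s')).card ≤ _
      have hle := Finset.card_le_card j2
      by_cases heq : reps n ((Cmd.loop 4 (.loop 5 tryMergeCmd)).run s') = reps n s'
      · have := j3 heq
        omega
      · have := Finset.card_lt_card (j2.ssubset_of_ne heq)
        omega)
  obtain ⟨M, hM⟩ := id h
  rw [hM.var_one] at this
  exact ⟨this.1, by have := this.2; rw [reduceCmd]; omega⟩

/-! ### Collecting the result -/

/-- When a single representative is left, its table is a table of the whole graph. -/
theorem collectCmd_run {s : State} (h : Ready G v s) (hcard : (reps n s).card ≤ 1) :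
    ∃ T, (G.seidelSwitch (G.neighborSet v)).IsTable (G.neighborSet v) Set.univ T ∧
      ∀ k, (collectCmd.run s).arr 8 k ≠ 0 ↔
        s.arr 8 k ≠ 0 ∨ ∃ a b c, T a b c ∧ k = a + c + 1 := by
  obtain ⟨M, h⟩ := h
  obtain ⟨x, hx, -⟩ := h.cover v
  have huniq : ∀ y ∈ reps n s, y = x := fun y hy => Finset.card_le_one.1 hcard y hy x hx
  have huniv : M x = Set.univ := by
    refine Set.eq_univ_of_forall fun a => ?_
    obtain ⟨y, hy, ha⟩ := h.cover a
    rwa [huniq y hy] at ha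
  set T := tableAt (s.arr 4) (s.arr 6 x) (n + 1) with hT
  have hT' := h.table x hx
  rw [huniv] at hT'
  refine ⟨T, hT', fun k => ?_⟩
  obtain ⟨-, h2⟩ := nest_write_run (a := 8) (q := 0)
    (e := (Expr.read 5 (.var 4)).and (entryExpr 4 11 12 13))
    (i := .add (.add (.var 11) (.var 13)) (.lit 1)) (xs := [4, 11, 12, 13])
    (C := fun f => f 4 = x ∧ T (f 11) (f 12) (f 13)) (A := fun f => f 11 + f 13 + 1)
    s (by simp) (by simp) (fun s' hs' hs => by
      have he' : Env G s' := h.toEnv.congr (fun z hz => by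
        simp only [List.mem_cons, List.not_mem_nil, or_false] at hz
        exact hs'.var z (by simp; omega)) fun a ha => by
        simp only [List.mem_cons, List.not_mem_nil, or_false] at ha
        exact hs'.arr a (by omega)
      simp only [h.var_one, List.forall_mem_cons, List.not_mem_nil, false_imp_iff, implies_true,
        and_true] at hs
      obtain ⟨l0, l1, l2, l3⟩ := hs
      refine ⟨?_, fun _ => ⟨rfl, Nat.zero_le _⟩⟩
      rw [Expr.eval_and_ne_zero, he'.eval_entryExpr l1 l2 l3, hs'.arr 4 (by simp),
        hs'.arr 6 (by simp)]
      have hread : (Expr.read 5 (.var 4)).eval s' = s.arr 5 (s'.var 4) := by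
        simp only [Expr.eval, hs'.arr 5 (by simp)]
      rw [hread]
      constructor
      · rintro ⟨a1, a2⟩
        have : s'.var 4 = x := congrArg Fin.val (huniq ⟨s'.var 4, h.lt _ a1⟩ (mem_reps.2 a1))
        rw [this] at a2
        exact ⟨this, a2⟩
      · rintro ⟨a1, a2⟩
        rw [a1]
        exact ⟨mem_reps.1 hx, a2⟩)
  rw [h.var_one] at h2
  refine (h2 k).trans (or_congr_right ?_)
  simp only [ExistsBelow, Function.update_self, Function.update_of_ne, ne_eq,
    Nat.reduceEqDiff, not_false_eq_true]
  constructor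
  · rintro ⟨_, -, a, -, b, -, c, -, ⟨-, hf⟩, rfl⟩
    exact ⟨a, b, c, hf, rfl⟩
  · rintro ⟨a, b, c, hf, rfl⟩
    exact ⟨x, by omega, a, hf.1, b, hf.2.1, c, hf.2.2.1, ⟨rfl, hf⟩, rfl⟩

/-- The data between two choices of the vertex `v`: all marks in the array `8` are at most the
Grundy number, and the marks of the vertices below `i` are present. -/
structure Marked (G : SimpleGraph (Fin n)) (i : ℕ) (s : State) : Prop extends Env G s,
    Clean n s where
  le : ∀ k, s.arr 8 k ≠ 0 → k ≤ G.grundyNumber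
  of_lt : ∀ u : Fin n, u < i → ∀ k, (∀ T, (G.seidelSwitch (G.neighborSet u)).IsTable
    (G.neighborSet u) Set.univ T → ∃ a b c, T a b c ∧ a + c + 1 = k) → s.arr 8 k ≠ 0

/-- The effect of the body of the main loop, for the vertex `v`. -/
theorem round_run (hG : G.IsCameron) {s : State} (h : Marked G v s) (h2 : s.var 2 = v) :
    Marked G (v + 1) ((Cmd.seq leavesCmd (.seq reduceCmd collectCmd)).run s) := by
  have h1 := leavesCmd_run h.toEnv h.toClean h2
  obtain ⟨r1, r2⟩ := reduceCmd_run hG h1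
  obtain ⟨T, hT, hmark⟩ := collectCmd_run r1 r2
  have h8 : (reduceCmd.run (leavesCmd.run s)).arr 8 = s.arr 8 := by
    rw [Cmd.run_arr_of_notMem, Cmd.run_arr_of_notMem]
    · simp [leavesCmd, leafCmd, nextTableCmd, Cmd.arrs]
    · simp [reduceCmd, tryMergeCmd, twinsCmd, mergeCmd, joinCmd, unionCmd, nextTableCmd, nest,
        Cmd.arrs]
  rw [h8] at hmark
  obtain ⟨M, hM⟩ := r1
  rw [Cmd.run, Cmd.run]
  generalize reduceCmd.run (leavesCmd.run s) = s' at *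
  refine ⟨hM.toEnv.run _ ?_ ?_, hM.toClean.congr ?_ ?_ ?_, fun k hk => ?_, fun u hu k hk => ?_⟩
  · simp [collectCmd, nest, Cmd.vars]
  · simp [collectCmd, nest, Cmd.arrs]
  · exact Cmd.run_var_of_notMem _ _ (by simp [collectCmd, nest, Cmd.vars])
  · exact Cmd.run_arr_of_notMem _ _ (by simp [collectCmd, nest, Cmd.arrs])
  · exact Cmd.run_arr_of_notMem _ _ (by simp [collectCmd, nest, Cmd.arrs])
  · rcases (hmark k).1 hk with hk | ⟨a, b, c, habc, rfl⟩
    · exact h.le k hk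
    · exact (hT.sound a b c habc).add_le_grundyNumber
  · rw [hmark]
    by_cases huv : u = v
    · subst huv
      obtain ⟨a, b, c, habc, hk⟩ := hk T hT
      exact Or.inr ⟨a, b, c, habc, hk.symm⟩
    · have : (u : ℕ) ≠ v := fun h => huv (Fin.ext h)
      exact Or.inl (h.of_lt u (by omega) k hk)

theorem outputCmd_run {s : State} {m : ℕ} (h1 : s.var 1 = n + 1) (hm : m ≤ n)
    (hle : ∀ k, s.arr 8 k ≠ 0 → k ≤ m) (hmark : 0 < m → s.arr 8 m ≠ 0)
    (h0 : m = 0 → s.var 0 = 0) : (outputCmd.run s).var 0 = m := by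
  have := Cmd.loop_induction (x := 4) (P := .ite (.read 8 (.var 4)) (.assign 0 (.var 4)) .skip)
    (s := s) (fun i s' => s'.arr 8 = s.arr 8 ∧ (m < i → s'.var 0 = m) ∧ (m = 0 → s'.var 0 = 0))
    ⟨rfl, by simp, by simpa using h0⟩
    (fun i _ s' hi ⟨i1, i2, i3⟩ => by
      by_cases hc : s.arr 8 i ≠ 0
      · have hrun : (Cmd.ite (.read 8 (.var 4)) (.assign 0 (.var 4)) .skip).run s' =
            s'.setVar 0 i := by
          simp [Cmd.run, Expr.eval, i1, hi, hc]
        have := hle i hc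
        rw [hrun]
        refine ⟨i1, fun hmi => ?_, fun hm0 => ?_⟩
        · simp; omega
        · simp; omega
      · have hrun : (Cmd.ite (.read 8 (.var 4)) (.assign 0 (.var 4)) .skip).run s' = s' := by
          rw [Cmd.run, if_neg (by simpa [Expr.eval, i1, hi] using hc), Cmd.run]
        rw [hrun]
        refine ⟨i1, fun hmi => ?_, by simpa using i3⟩
        rcases Nat.lt_succ_iff_lt_or_eq.1 hmi with hlt | rfl
        · simpa using i2 hlt
        · have hm0 : m = 0 := by
            by_contra hm0
            exact hc (hmark (by omega))
          simpa [hm0] using i3 hm0)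
  rw [h1] at this
  exact this.2.1 (by omega)

theorem grundyCmd_run (hG : G.IsCameron) :
    (grundyCmd.run ((graphInput G).setVar 1 (n + 1))).var 0 = G.grundyNumber := by
  set s := (graphInput G).setVar 1 (n + 1) with hs
  have he : Env G (setupCmd.run s) := setupCmd_run (by simp [hs, graphInput]) (by simp [hs]) rfl
  have hz : ∀ a, a ∉ setupCmd.arrs → a ≠ 0 → (setupCmd.run s).arr a = fun _ => 0 := by
    intro a ha ha0
    rw [Cmd.run_arr_of_notMem _ _ ha]
    funext k
    simp [hs, graphInput, ha0]
  have a4 := hz 4 (by simp [setupCmd, multiplesCmd, Cmd.arrs]) (by simp)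
  have a5 := hz 5 (by simp [setupCmd, multiplesCmd, Cmd.arrs]) (by simp)
  have a8 := hz 8 (by simp [setupCmd, multiplesCmd, Cmd.arrs]) (by simp)
  have h0 : Marked G 0 (setupCmd.run s) :=
    ⟨he, ⟨by simp [a4], by simp [a5]⟩, by simp [a8], by simp⟩
  have hmarked := Cmd.loop_induction (x := 2) (P := .ite (.sub (.var 0) (.var 2))
      (.seq leavesCmd (.seq reduceCmd collectCmd)) .skip) (s := setupCmd.run s)
    (fun i s' => Marked G i s')
    ⟨h0.toEnv.setVar (by simp) 0, h0.toClean.congr (by simp) rfl rfl, h0.le, h0.of_lt⟩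
    (fun i _ s' hi h => by
      have key : Marked G (i + 1) ((Cmd.ite (.sub (.var 0) (.var 2))
          (.seq leavesCmd (.seq reduceCmd collectCmd)) .skip).run s') := by
        by_cases hin : i < n
        · have : (Expr.sub (.var 0) (.var 2)).eval s' ≠ 0 := by
            simp only [Expr.eval, h.var_zero, hi]; omega
          rw [Cmd.run, if_pos this]
          exact round_run (v := ⟨i, hin⟩) hG h hi
        · have : (Expr.sub (.var 0) (.var 2)).eval s' = 0 := by
            simp only [Expr.eval, h.var_zero, hi]; omega
          rw [Cmd.run, if_neg (not_not.2 this), Cmd.run]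
          exact ⟨h.toEnv, h.toClean, h.le, fun u _ => h.of_lt u (by omega)⟩
      exact ⟨key.toEnv.setVar (by simp) _, key.toClean.congr (by simp) rfl rfl, key.le, key.of_lt⟩)
  rw [he.var_one] at hmarked
  have hcard := G.grundyNumber_le_card
  rw [Fintype.card_fin] at hcard
  refine outputCmd_run hmarked.var_one hcard hmarked.le (fun hpos => ?_) fun hzero => ?_
  · have : Nonempty (Fin n) := ⟨⟨0, by omega⟩⟩
    obtain ⟨v, hv⟩ := exists_add_eq_grundyNumber G
    exact hmarked.of_lt v (by omega) _ hv
  · rw [hmarked.var_zero]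
    by_contra hn
    have : Nonempty (Fin n) := ⟨⟨0, by omega⟩⟩
    obtain ⟨c, v, -, hv⟩ := exists_isGreedy_of_nonempty G
    omega

end

end RAM

/-- There is a polynomial-time algorithm that computes the Grundy number of every Cameron graph. -/
theorem mainTheorem1 :
    ∃ (P : RAM.Program) (T : Polynomial ℕ), ∀ (n : ℕ) (G : SimpleGraph (Fin n)), G.IsCameron →
      ∃ (t : ℕ) (s : RAM.State),
        RAM.Runs P (RAM.graphInput G) t s ∧ t ≤ T.eval n ∧ s.var 0 = G.grundyNumber := by
  refine ⟨.seq (.assign 1 (.add (.var 0) (.lit 1))) RAM.grundyCmd.compile,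
    .C 4 + RAM.grundyCmd.time.comp (.X + .C 1), fun n G hG => ?_⟩
  obtain ⟨hwf, h1⟩ := RAM.grundyCmd_wellFormed
  obtain ⟨t, ht, hrun⟩ :=
    RAM.grundyCmd.runs_compile hwf h1 ((RAM.graphInput G).setVar 1 (n + 1))
  refine ⟨4 + t, _, .seq (.assign 1 (.add (.var 0) (.lit 1)) _) hrun, ?_, RAM.grundyCmd_run hG⟩
  simpa using ht
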